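/- **Setting.** Consider the plant $x_{t+1}=Ax_t+Bu_t+w_t$, $y_t=Cx_t+Du_t$ with $x_t\in\mathbb R^{n_x}$, $u_t\in\mathbb R^{n_u}$, $y_t\in\mathbb R^{n_y}$, where $(A,B)$ is stabilizable and $(C,A)$ is observable. Let $\eta$ be the observability index, i.e. the least $k\ge 1$ such that $[C;CA;\dots;CA^{k-1}]$ has rank $n_x$. The controller receives $\zeta_t=y_t+n_t$ with network noise $n_t$. Norms are Euclidean. For $t\ge 0$ put $z_t=[u_{[t-\eta,t-1]};y_{[t-\eta,t-1]}]$ and $\tilde z_t=[u_{[t-\eta,t-1]};\zeta_{[t-\eta,t-1]}]$; the plant equations hold for all $t\ge-\eta$. *Data.* Let $L\ge\eta+n_x$. Offline, an input sequence $u^s=(u^s_0,\dots,u^s_{N-1})$ that is persistently exciting of order $L+n_x+\eta$ (its Hankel matrix of that depth has rank $n_u(L+n_x+\eta)$) is applied to the plant from the initial state $x^s_0$, with process noise $w^s$; the output $y^s$ is recorded without network noise. $H_k(s)$ denotes the Hankel matrix of depth $k$, with $N-k+1$ columns. *MPC problem.* Let $R_1,R_2\succ0$, $\lambda_g,\lambda_h,\bar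 v>0$, and let $\mathbb U\subseteq\mathbb R^{n_u}$ be convex with $0$ in its interior. Given $\tilde z$, minimize over $g$ and over $h_i,\bar u_i,\bar y_i$, $-\eta\le i\le L-1$, $$\sum_{i=0}^{L-1}\big(\bar u_i^\top R_1\bar u_i+\bar y_i^\top R_2\bar y_i\big)+\lambda_g\bar v\|g\|^2+\frac{\lambda_h}{\bar v}\|h\|^2$$ subject to $\bar u=H_{L+\eta}(u^s)g$, $\bar y+h=H_{L+\eta}(y^s)g$, $[\bar u_{[-\eta,-1]};\bar y_{[-\eta,-1]}]=\tilde z$, $\bar u_i=0$ and $\bar y_i=0$ for $L-\eta\le i\le L-1$, and $\bar u_i\in\mathbb U$ for $0\le i\le L-1$. Let $J_L^*(\tilde z)$ be the optimal value. *Attacks.* A denial-of-service attack is a sequence $\ell_t\in\{0,1\}$, $t\ge0$; the transmission at time $t$ succeeds iff $\ell_t=0$. Let $s_0<s_1<\cdots$ be the successful instants. For constants $\kappa_f,\kappa_d\ge0$, $\nu_f\ge2$, $\nu_d\ge1$ with $\frac1{\nu_f}+\frac1{\nu_d}<1$ and for all integers $0\le t_1\le t_2$, the number of $t\in[t_1,t_2)$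 with $t\ge1$, $\ell_t=1$, $\ell_{t-1}=0$ is at most $\kappa_f+(t_2-t_1)/\nu_f$, and the number of $t\in[t_1,t_2)$ with $\ell_t=1$ is at most $\kappa_d+(t_2-t_1)/\nu_d$. *Controller.* At each successful instant $s_r$ the MPC problem is solved with $\tilde z=\tilde z_{s_r}$. For $s_r\le t<s_{r+1}$ the input is $u_t=\bar u^*_{t-s_r}(s_r)$ if $t-s_r\le L-1$, and $u_t=0$ otherwise; for $0\le t<s_0$, $u_t=0$. *Lyapunov function.* $V_t=J^*_L(\tilde z_t)+\gamma z_t^\top Pz_t$, where $\gamma>0$, $P\succ0$, and for some $\sigma_1,\sigma_2,\sigma_3>0$ one has $z_{t+1}^\top Pz_{t+1}-z_t^\top Pz_t\le-\sigma_1\|z_t\|^2+\sigma_2\|u_t\|^2+\sigma_3\|y_t\|^2$ for all $t\ge 0$ along all plant trajectories. **Theorem.** Fix $A,B,C,D,L,R_1,R_2,\mathbb U,N,u^s,x^s_0,\kappa_f,\nu_f,\kappa_d,\nu_d,P,\gamma$ as above. There is $\delta>0$ such that for every $V_{in}>0$ there are constants $0<\underline\lambda_g<\overline\lambda_g$, $0<\underline\lambda_h<\overline\lambda_h$,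 $\bar v_0>0$, a class-$\mathcal{KL}$ function $\beta$ and a class-$\mathcal K_\infty$ function $\alpha$ with the following property. Let $\lambda_g\in[\underline\lambda_g,\overline\lambda_g]$, $\lambda_h\in[\underline\lambda_h,\overline\lambda_h]$, $0<\bar v\le\bar v_0$, let all noises be bounded by $\bar v$ ($\|w^s_t\|\le\bar v$ for $0\le t<N$, and $\|w_t\|,\|n_t\|\le\bar v$ for $t\ge-\eta$), let the attack satisfy the bounds above, and let $\|z_0\|\le\delta$. If the MPC problem is feasible at $s_0$ and $V_{s_0}\le V_{in}$, then 1. the MPC problem is feasible at every successful transmission instant $s_r$, $r\ge0$; and 2. the closed loop is (locally) input-to-state stable with respect to the noise level: $\|x_t\|\le\beta(\|x_0\|,t)+\alpha(\bar v)$ for all $t\ge0$. -/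

import Mathlib

open scoped Matrix

/-- Real column vectors of length `n`, with the Euclidean norm. -/
abbrev RVec (n : ℕ) : Type := EuclideanSpace ℝ (Fin n)

/-- A comparison function of class `K` on `[0, ∞)`. -/
def IsClassK (α : ℝ → ℝ) : Prop :=
  ContinuousOn α (Set.Ici 0) ∧ StrictMonoOn α (Set.Ici 0) ∧ α 0 = 0

/-- Class `K∞`: class `K` and unbounded. -/
def IsClassKInf (α : ℝ → ℝ) : Prop :=
  IsClassK α ∧ ∀ M : ℝ, ∃ s : ℝ, 0 ≤ s ∧ M < α s

/-- Class `KL`: class `K` in the first argument, and nonincreasing with limit `0` in the second. -/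
def IsClassKL (β : ℝ → ℝ → ℝ) : Prop :=
  (∀ t : ℝ, 0 ≤ t → IsClassK (fun s => β s t)) ∧
  ∀ s : ℝ, 0 ≤ s → AntitoneOn (fun t => β s t) (Set.Ici 0) ∧
    Filter.Tendsto (fun t => β s t) Filter.atTop (nhds 0)

/-- The matrices of the plant `x⁺ = A x + B u + w`, `y = C x + D u`. -/
structure LTISystem (nx nu ny : ℕ) where
  A : Matrix (Fin nx) (Fin nx) ℝ
  B : Matrix (Fin nx) (Fin nu) ℝ
  C : Matrix (Fin ny) (Fin nx) ℝ
  D : Matrix (Fin ny) (Fin nu) ℝ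

namespace LTISystem

variable {nx nu ny : ℕ}

/-- Some static state feedback `K` makes `A + B K` Schur stable. -/
def Stabilizable (S : LTISystem nx nu ny) : Prop :=
  ∃ K : Matrix (Fin nu) (Fin nx) ℝ,
    ∀ μ ∈ spectrum ℂ ((S.A + S.B * K).map (algebraMap ℝ ℂ)), ‖μ‖ < 1

/-- The stacked matrix `[C; C A; …; C A ^ (k - 1)]`. -/
def obsMatrix (S : LTISystem nx nu ny) (k : ℕ) : Matrix (Fin k × Fin ny) (Fin nx) ℝ :=
  Matrix.of fun p j => (S.C * S.A ^ (p.1 : ℕ)) p.2 j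

def Observable (S : LTISystem nx nu ny) : Prop :=
  (S.obsMatrix nx).rank = nx

/-- `η` is the least number of outputs, at least one, that determines the state. -/
def IsObservabilityIndex (S : LTISystem nx nu ny) (η : ℕ) : Prop :=
  IsLeast {k : ℕ | 1 ≤ k ∧ (S.obsMatrix k).rank = nx} η

/-- The plant equations with process noise `w` at all times in `I`. -/
def IsTrajectoryOn {τ : Type} [Add τ] [One τ] (S : LTISystem nx nu ny) (I : Set τ)
    (x : τ → RVec nx) (u : τ → RVec nu) (y : τ → RVec ny) (w : τ → RVec nx) : Prop :=
  ∀ t ∈ I,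
    x (t + 1) = Matrix.toEuclideanLin S.A (x t) + Matrix.toEuclideanLin S.B (u t) + w t ∧
    y t = Matrix.toEuclideanLin S.C (x t) + Matrix.toEuclideanLin S.D (u t)

end LTISystem

/-- Index set of an augmented state: `η` past inputs and `η` past outputs. -/
abbrev AugIdx (nu ny η : ℕ) : Type := (Fin η × Fin nu) ⊕ (Fin η × Fin ny)

/-- The stacked window `[u_{[t-η, t-1]}; y_{[t-η, t-1]}]`. -/
noncomputable def augState {nu ny : ℕ} (η : ℕ) (u : ℤ → RVec nu) (y : ℤ → RVec ny) (t : ℤ) :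
    EuclideanSpace ℝ (AugIdx nu ny η) :=
  WithLp.toLp 2 (Sum.elim
    (fun p => u (t - (η : ℤ) + ((p.1 : ℕ) : ℤ)) p.2)
    (fun p => y (t - (η : ℤ) + ((p.1 : ℕ) : ℤ)) p.2))

/-- The quadratic form `vᵀ M v`. -/
def quadForm {ι : Type} [Fintype ι] (M : Matrix ι ι ℝ) (v : EuclideanSpace ℝ ι) : ℝ :=
  v.ofLp ⬝ᵥ (M *ᵥ v.ofLp)

/-- `z ↦ zᵀ P z` is a UIOSS-Lyapunov function for the augmented state of the plant. Arbitrary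
process noise is allowed. -/
def IsUIOSSLyapunov {nx nu ny η : ℕ} (S : LTISystem nx nu ny)
    (P : Matrix (AugIdx nu ny η) (AugIdx nu ny η) ℝ) : Prop :=
  P.PosDef ∧ ∃ σ₁ σ₂ σ₃ : ℝ, 0 < σ₁ ∧ 0 < σ₂ ∧ 0 < σ₃ ∧
    ∀ (x : ℤ → RVec nx) (u : ℤ → RVec nu) (y : ℤ → RVec ny) (w : ℤ → RVec nx),
      S.IsTrajectoryOn (Set.Ici (-(η : ℤ))) x u y w →
      ∀ t : ℤ, 0 ≤ t →
        quadForm P (augState η u y (t + 1)) - quadForm P (augState η u y t) ≤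
          -σ₁ * ‖augState η u y t‖ ^ 2 + σ₂ * ‖u t‖ ^ 2 + σ₃ * ‖y t‖ ^ 2

/-- The Hankel matrix of depth `k` of `s 0, …, s (N - 1)`; it has `N - k + 1` columns
(none if `N < k`). -/
def hankel {m : ℕ} (k N : ℕ) (s : ℕ → RVec m) : Matrix (Fin k × Fin m) (Fin (N + 1 - k)) ℝ :=
  Matrix.of fun p j => s ((p.1 : ℕ) + (j : ℕ)) p.2

/-- `s 0, …, s (N - 1)` is persistently exciting of order `k`. -/
def PersistentlyExciting {m : ℕ} (k N : ℕ) (s : ℕ → RVec m) : Prop :=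
  (hankel k N s).rank = m * k

/-- Number of attacked instants in `[t₁, t₂)`. -/
def dosDuration (atk : ℕ → Bool) (t₁ t₂ : ℕ) : ℕ :=
  ∑ i ∈ Finset.Ico t₁ t₂, if atk i = true then 1 else 0

/-- Number of off/on transitions of the attack in `[t₁, t₂)`; a transition needs a
predecessor, so it occurs at an instant `i ≥ 1`. -/
def dosFrequency (atk : ℕ → Bool) (t₁ t₂ : ℕ) : ℕ :=
  ∑ i ∈ Finset.Ico t₁ t₂, if 1 ≤ i ∧ atk i = true ∧ atk (i - 1) = false then 1 else 0

/-- The attack respects the bounds on frequency and duration over every interval. -/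
def DosBounded (κf νf κd νd : ℝ) (atk : ℕ → Bool) : Prop :=
  ∀ t₁ t₂ : ℕ, t₁ ≤ t₂ →
    (dosFrequency atk t₁ t₂ : ℝ) ≤ κf + ((t₂ : ℝ) - (t₁ : ℝ)) / νf ∧
    (dosDuration atk t₁ t₂ : ℝ) ≤ κd + ((t₂ : ℝ) - (t₁ : ℝ)) / νd

/-- Decision variables of the MPC problem. Entry `i` of `h`, `ubar`, `ybar` belongs to the
relative time `i - η`, so these sequences cover the relative times `-η, …, L - 1`. -/
structure MPCVars (nu ny N L η : ℕ) where
  g : RVec (N + 1 - (L + η))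
  h : Fin (L + η) → RVec ny
  ubar : Fin (L + η) → RVec nu
  ybar : Fin (L + η) → RVec ny

/-- Computed input for the relative time `q ≥ 0`; it is zero beyond the horizon. -/
def MPCVars.predInput {nu ny N L η : ℕ} (o : MPCVars nu ny N L η) (q : ℕ) : RVec nu :=
  if hq : q < L then o.ubar ⟨q + η, by omega⟩ else 0

/-- The parameters of the data-driven MPC problem. -/
structure MPCProblem (nu ny N L η : ℕ) where
  us : ℕ → RVec nu
  ys : ℕ → RVec ny
  R₁ : Matrix (Fin nu) (Fin nu) ℝ
  R₂ : Matrix (Fin ny) (Fin ny) ℝ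
  U : Set (RVec nu)
  lamg : ℝ
  lamh : ℝ
  vbar : ℝ

namespace MPCProblem

variable {nu ny N L η : ℕ}

/-- The constraints of the problem with initial window `z`. -/
structure IsFeasible (p : MPCProblem nu ny N L η) (z : EuclideanSpace ℝ (AugIdx nu ny η))
    (o : MPCVars nu ny N L η) : Prop where
  hankel_u : ∀ (i : Fin (L + η)) (a : Fin nu),
    o.ubar i a = (hankel (L + η) N p.us *ᵥ o.g.ofLp) (i, a)
  hankel_y : ∀ (i : Fin (L + η)) (a : Fin ny),
    o.ybar i a + o.h i a = (hankel (L + η) N p.ys *ᵥ o.g.ofLp) (i, a)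
  init_u : ∀ (i : Fin η) (a : Fin nu), o.ubar ⟨i, by omega⟩ a = z (Sum.inl (i, a))
  init_y : ∀ (i : Fin η) (a : Fin ny), o.ybar ⟨i, by omega⟩ a = z (Sum.inr (i, a))
  terminal : ∀ i : Fin (L + η), L ≤ (i : ℕ) → o.ubar i = 0 ∧ o.ybar i = 0
  input_mem : ∀ i : Fin (L + η), η ≤ (i : ℕ) → o.ubar i ∈ p.U

/-- The objective: stage costs over the relative times `0, …, L - 1` plus regularization. -/
noncomputable def cost (p : MPCProblem nu ny N L η) (o : MPCVars nu ny N L η) : ℝ :=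
  (∑ q : Fin L, (quadForm p.R₁ (o.ubar ⟨q + η, by omega⟩) +
      quadForm p.R₂ (o.ybar ⟨q + η, by omega⟩))) +
    p.lamg * p.vbar * ‖o.g‖ ^ 2 + p.lamh / p.vbar * ∑ i, ‖o.h i‖ ^ 2

/-- The problem with initial window `z` has a feasible point. -/
def Feasible (p : MPCProblem nu ny N L η) (z : EuclideanSpace ℝ (AugIdx nu ny η)) : Prop :=
  ∃ o, p.IsFeasible z o

/-- `o` solves the problem with initial window `z`. -/
def IsOptimal (p : MPCProblem nu ny N L η) (z : EuclideanSpace ℝ (AugIdx nu ny η))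
    (o : MPCVars nu ny N L η) : Prop :=
  p.IsFeasible z o ∧ ∀ o', p.IsFeasible z o' → p.cost o ≤ p.cost o'

/-- The optimal value; meaningful where the problem is feasible. -/
noncomputable def value (p : MPCProblem nu ny N L η)
    (z : EuclideanSpace ℝ (AugIdx nu ny η)) : ℝ :=
  sInf (p.cost '' {o | p.IsFeasible z o})

end MPCProblem

/-- The plant in closed loop with the resilient MPC algorithm. The plant evolves from time `-η`
on, the controller acts from time `0` on, and `opt s` is the solution computed at the
successful transmission instant `s` (unspecified if the problem is infeasible at `s`). -/
structure IsClosedLoop {nx nu ny N L η : ℕ} (S : LTISystem nx nu ny)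
    (p : MPCProblem nu ny N L η) (atk : ℕ → Bool)
    (x : ℤ → RVec nx) (u : ℤ → RVec nu) (y : ℤ → RVec ny)
    (w : ℤ → RVec nx) (n : ℤ → RVec ny) (opt : ℕ → MPCVars nu ny N L η) : Prop where
  plant : S.IsTrajectoryOn (Set.Ici (-(η : ℤ))) x u y w
  solve : ∀ s : ℕ, atk s = false → p.Feasible (augState η u (y + n) s) →
    p.IsOptimal (augState η u (y + n) s) (opt s)
  input : ∀ s t : ℕ, s ≤ t → atk s = false → (∀ i, s < i → i ≤ t → atk i = true) →
    u t = (opt s).predInput (t - s)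
  input_init : ∀ t : ℕ, (∀ i, i ≤ t → atk i = true) → u t = 0

/-! Recursive feasibility rests on the slack `h`, which absorbs any output mismatch: since
persistent excitation makes every input window of length `L + η` a combination of data windows, the
MPC problem has a feasible point for every initial window (`feasible_of_exists_dataComb`). The real
content is stability.

Write v for the noise level. A solution of cost at most V satisfies v‖g‖ ≤ √V √v and ‖h‖ ≤ √V √v, so
the noise-free plant trajectory generated by the same `g` agrees with the computed one up to O(√v)
(`exists_model_error`). The terminal zeros and observability make its state at time L equally small;
moving to the kernel of the final-state map gives a nearby trajectory that reaches the origin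
exactly in k = L - η steps. Comparing the optimizer with its shifts along data windows shows that
this trajectory is optimal, up to O(√v), among null controls of size at most r
(`exists_isNearOptimal`).

For such controls the noise-free horizon cost J acts as a Lyapunov function near the origin. It is
quadratically small because a small null-controllable state needs only a small input. At the next
success, however late, the tail of the old control plus a small linear correction is a competitor,
so J drops by a multiple of the input-output energy spent meanwhile, up to O(√v)
(`exists_cost_decrease`). Energy over η steps bounds the state (`exists_energy_bound`), and the
attack bounds force a success among any T + 1 consecutive instants. Hence J contracts over η + T
steps, the squared state decays exponentially up to O(√v), and the gain in the final estimate is a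
multiple of the fourth root of v.

The argument needs a bounded optimal cost at every success, and smallness of the state does not
imply it. The plant is only stabilizable: data windows generate only trajectories that start in the
`orbit` of the offline experiment, and only states in `nullReach` can be steered to the origin.
However, a bounded cost at the first success forces the state at the start of the window to be
O(√v)-close to `orbit ⊓ nullReach`. This subspace is invariant under A and contains the reachable
one, so modulo it the input disappears and stabilizability makes the motion contract; the distance
therefore stays O(√v) forever (`Stabilizable.exists_decay`). Conversely, a small state and this
proximity give a feasible point with ‖h‖ = O(√v), whose cost is bounded because the penalty is
‖h‖²/v (`exists_feasible_of_near`). An induction over the successes closes the circle between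
bounded cost and small state (`exists_exponential_decay`). -/

/-! ### Linear maps with quantitative preimages, and zero extension. -/

/-- Every linear map between finite-dimensional spaces admits bounded preimages on its range. -/
theorem LinearMap.exists_bounded_preimage {V W : Type*} [NormedAddCommGroup V] [NormedSpace ℝ V]
    [FiniteDimensional ℝ V] [NormedAddCommGroup W] [NormedSpace ℝ W] (f : V →ₗ[ℝ] W) :
    ∃ C : ℝ, 0 < C ∧ ∀ v, ∃ v', f v' = f v ∧ ‖v'‖ ≤ C * ‖f v‖ := by
  have : CompleteSpace V := FiniteDimensional.complete ℝ V
  have : FiniteDimensional ℝ (LinearMap.range f) := inferInstance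
  have : CompleteSpace (LinearMap.range f) := FiniteDimensional.complete ℝ _
  let F : V →L[ℝ] LinearMap.range f := LinearMap.toContinuousLinearMap f.rangeRestrict
  -- Open mapping theorem for the surjection onto the range.
  obtain ⟨C, hC, h⟩ := F.exists_preimage_norm_le (fun y => by
    obtain ⟨v, hv⟩ := f.surjective_rangeRestrict y
    exact ⟨v, hv⟩)
  refine ⟨C, hC, fun v => ?_⟩
  obtain ⟨v', h1, h2⟩ := h (f.rangeRestrict v)
  exact ⟨v', congrArg Subtype.val h1, h2⟩

/-- A linear map on a finite-dimensional space is bounded. -/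
theorem LinearMap.exists_norm_bound {V W : Type*} [NormedAddCommGroup V] [NormedSpace ℝ V]
    [FiniteDimensional ℝ V] [NormedAddCommGroup W] [NormedSpace ℝ W] (f : V →ₗ[ℝ] W) :
    ∃ C : ℝ, 0 < C ∧ ∀ v, ‖f v‖ ≤ C * ‖v‖ := by
  obtain ⟨C, hC, h⟩ := (LinearMap.toContinuousLinearMap f).bound
  exact ⟨C, hC, h⟩

/-- Every vector is close to the kernel of a linear map if its image is small. -/
theorem LinearMap.exists_near_ker {V W : Type*} [NormedAddCommGroup V] [NormedSpace ℝ V]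
    [FiniteDimensional ℝ V] [NormedAddCommGroup W] [NormedSpace ℝ W] (f : V →ₗ[ℝ] W) :
    ∃ C : ℝ, 0 < C ∧ ∀ v, ∃ k, f k = 0 ∧ ‖v - k‖ ≤ C * ‖f v‖ := by
  obtain ⟨C, hC, h⟩ := f.exists_bounded_preimage
  refine ⟨C, hC, fun v => ?_⟩
  obtain ⟨v', h1, h2⟩ := h v
  exact ⟨v - v', by simp [h1], by simpa using h2⟩

theorem Matrix.mulVec_injective_of_rank_eq_card {m n : Type*} [Fintype n]
    {M : Matrix m n ℝ} (h : M.rank = Fintype.card n) : Function.Injective M.mulVec := by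
  have h1 := M.mulVecLin.finrank_range_add_finrank_ker
  have h2 : Module.finrank ℝ (LinearMap.range M.mulVecLin) = Fintype.card n := h
  rw [h2, Module.finrank_fintype_fun_eq_card, Nat.add_eq_left] at h1
  exact LinearMap.ker_eq_bot.mp (Submodule.finrank_eq_zero.mp h1)

/-- Extension by zero of a finite sequence. -/
def extendZero {E : Type*} [AddCommMonoid E] [Module ℝ E] (k : ℕ) : (Fin k → E) →ₗ[ℝ] (ℕ → E) where
  toFun v i := if h : i < k then v ⟨i, h⟩ else 0
  map_add' v w := by
    funext i
    by_cases h : i < k <;> simp [h]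
  map_smul' c v := by
    funext i
    by_cases h : i < k <;> simp [h]

section extendZero

variable {E : Type*} [NormedAddCommGroup E] [NormedSpace ℝ E] {k : ℕ}

theorem extendZero_of_lt (v : Fin k → E) {i : ℕ} (h : i < k) : extendZero k v i = v ⟨i, h⟩ := by
  simp [extendZero, h]

theorem extendZero_of_le (v : Fin k → E) {i : ℕ} (h : k ≤ i) : extendZero k v i = 0 := by
  simp [extendZero, Nat.not_lt.mpr h]

theorem norm_extendZero_le (v : Fin k → E) (i : ℕ) : ‖extendZero k v i‖ ≤ ‖v‖ := by
  by_cases h : i < k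
  · rw [extendZero_of_lt v h]; exact norm_le_pi_norm v _
  · rw [extendZero_of_le v (not_lt.mp h)]; simp

theorem extendZero_restrict (s : ℕ → E) (hs : ∀ i, k ≤ i → s i = 0) :
    extendZero k (fun i : Fin k => s i) = s := by
  funext i
  by_cases h : i < k
  · rw [extendZero_of_lt _ h]
  · rw [extendZero_of_le _ (not_lt.mp h), hs i (not_lt.mp h)]

end extendZero

/-! ### Noise-free motion of the plant, perturbation and observability bounds. -/

namespace LTISystem

variable {nx nu ny : ℕ} (S : LTISystem nx nu ny)

/-- The noise-free state at time `t` as a linear function of the initial state and the input. -/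
noncomputable def state : ℕ → (RVec nx × (ℕ → RVec nu)) →ₗ[ℝ] RVec nx
  | 0 => LinearMap.fst ℝ _ _
  | t + 1 => (Matrix.toEuclideanLin S.A) ∘ₗ state t +
      (Matrix.toEuclideanLin S.B) ∘ₗ (LinearMap.proj t) ∘ₗ (LinearMap.snd ℝ _ _)

/-- The noise-free output at time `t`. -/
noncomputable def output (t : ℕ) : (RVec nx × (ℕ → RVec nu)) →ₗ[ℝ] RVec ny :=
  (Matrix.toEuclideanLin S.C) ∘ₗ S.state t +
      (Matrix.toEuclideanLin S.D) ∘ₗ (LinearMap.proj t) ∘ₗ (LinearMap.snd ℝ _ _)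

theorem state_zero (p : RVec nx × (ℕ → RVec nu)) : S.state 0 p = p.1 := rfl

theorem state_succ (t : ℕ) (p : RVec nx × (ℕ → RVec nu)) :
    S.state (t + 1) p =
      Matrix.toEuclideanLin S.A (S.state t p) + Matrix.toEuclideanLin S.B (p.2 t) := rfl

theorem output_eq (t : ℕ) (p : RVec nx × (ℕ → RVec nu)) :
    S.output t p =
      Matrix.toEuclideanLin S.C (S.state t p) + Matrix.toEuclideanLin S.D (p.2 t) := rfl

theorem state_congr {p q : RVec nx × (ℕ → RVec nu)} (h : p.1 = q.1) {t : ℕ}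
    (h2 : ∀ i < t, p.2 i = q.2 i) : S.state t p = S.state t q := by
  induction t with
  | zero => exact h
  | succ t ih => rw [state_succ, state_succ, ih (fun i hi => h2 i (by omega)), h2 t (by omega)]

theorem output_congr {p q : RVec nx × (ℕ → RVec nu)} (h : p.1 = q.1) {t : ℕ}
    (h2 : ∀ i ≤ t, p.2 i = q.2 i) : S.output t p = S.output t q := by
  rw [output_eq, output_eq, S.state_congr h (fun i hi => h2 i hi.le), h2 t le_rfl]

theorem state_add_time (q i : ℕ) (p : RVec nx × (ℕ → RVec nu)) :
    S.state (q + i) p = S.state i (S.state q p, fun j => p.2 (q + j)) := by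
  induction i with
  | zero => rfl
  | succ i ih => rw [← add_assoc, state_succ, ih, state_succ]

theorem output_add_time (q i : ℕ) (p : RVec nx × (ℕ → RVec nu)) :
    S.output (q + i) p = S.output i (S.state q p, fun j => p.2 (q + j)) := by
  rw [output_eq, output_eq, state_add_time]

theorem state_eq_zero {p : RVec nx × (ℕ → RVec nu)} (h : p.1 = 0) {t : ℕ}
    (h2 : ∀ i < t, p.2 i = 0) : S.state t p = 0 := by
  rw [S.state_congr (q := 0) h h2, map_zero]

theorem output_eq_zero {p : RVec nx × (ℕ → RVec nu)} (h : p.1 = 0) {t : ℕ}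
    (h2 : ∀ i ≤ t, p.2 i = 0) : S.output t p = 0 := by
  rw [S.output_congr (q := 0) h h2, map_zero]

/-- A state that is steered to zero stays there under zero input. -/
theorem state_eq_zero_of_le {p : RVec nx × (ℕ → RVec nu)} {k t : ℕ} (h : S.state k p = 0)
    (h2 : ∀ i, k ≤ i → p.2 i = 0) (hkt : k ≤ t) : S.state t p = 0 := by
  obtain ⟨i, rfl⟩ := Nat.exists_eq_add_of_le hkt
  rw [state_add_time]
  exact S.state_eq_zero h (fun j _ => h2 _ (by omega))

theorem output_eq_zero_of_le {p : RVec nx × (ℕ → RVec nu)} {k t : ℕ} (h : S.state k p = 0)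
    (h2 : ∀ i, k ≤ i → p.2 i = 0) (hkt : k ≤ t) : S.output t p = 0 := by
  rw [output_eq, S.state_eq_zero_of_le h h2 hkt, h2 t hkt, map_zero, map_zero, add_zero]

/-- A noisy trajectory stays close to a noise-free one over a bounded time. -/
theorem exists_perturbation_bound (T : ℕ) : ∃ C : ℝ, 1 ≤ C ∧
    ∀ (X : ℕ → RVec nx) (V : ℕ → RVec nu) (Y : ℕ → RVec ny) (W : ℕ → RVec nx)
      (p : RVec nx × (ℕ → RVec nu)) (e : ℝ) (n : ℕ), n ≤ T → 0 ≤ e →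
      S.IsTrajectoryOn (Set.Iio n) X V Y W → ‖X 0 - p.1‖ ≤ e →
      (∀ t < n, ‖V t - p.2 t‖ ≤ e) → (∀ t < n, ‖W t‖ ≤ e) →
      (∀ t ≤ n, ‖X t - S.state t p‖ ≤ C * e) ∧ (∀ t < n, ‖Y t - S.output t p‖ ≤ C * e) := by
  obtain ⟨a, ha, hA⟩ := (Matrix.toEuclideanLin S.A).exists_norm_bound
  obtain ⟨b, hb, hB⟩ := (Matrix.toEuclideanLin S.B).exists_norm_bound
  obtain ⟨c, hc, hC⟩ := (Matrix.toEuclideanLin S.C).exists_norm_bound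
  obtain ⟨d, hd, hD⟩ := (Matrix.toEuclideanLin S.D).exists_norm_bound
  -- An error of size at least e grows per step at most by the factor m: `a` for the state, `b` for
  -- the input error and 1 for the new noise.
  set m := a + b + 1 with hm
  have hm1 : 1 ≤ m := by linarith
  have hM : 1 ≤ m ^ T := one_le_pow₀ hm1
  refine ⟨(c + 1) * m ^ T + d, by nlinarith, ?_⟩
  intro X V Y W p e n hn he htraj h0 hV hW
  have key : ∀ t ≤ n, ‖X t - S.state t p‖ ≤ m ^ t * e := by
    intro t
    induction t with
    | zero => intro _; simpa [state_zero] using h0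
    | succ t ih =>
      intro ht
      have h1 := ih (by omega)
      rw [(htraj t (show t < n by omega)).1, state_succ]
      have : Matrix.toEuclideanLin S.A (X t) + Matrix.toEuclideanLin S.B (V t) + W t -
          (Matrix.toEuclideanLin S.A (S.state t p) + Matrix.toEuclideanLin S.B (p.2 t)) =
          Matrix.toEuclideanLin S.A (X t - S.state t p) +
            Matrix.toEuclideanLin S.B (V t - p.2 t) + W t := by
        rw [map_sub, map_sub]; abel
      rw [this]
      have h2 := hA (X t - S.state t p)
      have h3 := hB (V t - p.2 t)
      have h4 := hV t (by omega)
      have h5 := hW t (by omega)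
      have h6 : 1 ≤ m ^ t := one_le_pow₀ hm1
      calc _ ≤ ‖Matrix.toEuclideanLin S.A (X t - S.state t p)‖ +
            ‖Matrix.toEuclideanLin S.B (V t - p.2 t)‖ + ‖W t‖ := norm_add₃_le
        _ ≤ a * (m ^ t * e) + b * e + e := by
          have := mul_le_mul_of_nonneg_left h1 ha.le
          have := mul_le_mul_of_nonneg_left h4 hb.le
          linarith
        _ ≤ m ^ (t + 1) * e := by
          have h7 : e ≤ m ^ t * e := le_mul_of_one_le_left he h6
          have h8 := mul_le_mul_of_nonneg_left h7 hb.le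
          rw [pow_succ, hm]; rw [hm] at h7 h8; linarith
  have key2 : ∀ t ≤ n, ‖X t - S.state t p‖ ≤ m ^ T * e := fun t ht =>
    (key t ht).trans (mul_le_mul_of_nonneg_right (pow_le_pow_right₀ hm1 (ht.trans hn)) he)
  have hMe : 0 ≤ m ^ T * e := by positivity
  refine ⟨fun t ht => (key2 t ht).trans ?_, fun t ht => ?_⟩
  · have : 0 ≤ c * (m ^ T * e) := by positivity
    have : 0 ≤ d * e := by positivity
    linarith
  · rw [(htraj t ht).2, output_eq]
    have : Matrix.toEuclideanLin S.C (X t) + Matrix.toEuclideanLin S.D (V t) -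
          (Matrix.toEuclideanLin S.C (S.state t p) + Matrix.toEuclideanLin S.D (p.2 t)) =
          Matrix.toEuclideanLin S.C (X t - S.state t p) +
            Matrix.toEuclideanLin S.D (V t - p.2 t) := by
        rw [map_sub, map_sub]; abel
    rw [this]
    have h2 := hC (X t - S.state t p)
    have h3 := hD (V t - p.2 t)
    have h4 := mul_le_mul_of_nonneg_left (hV t ht) hd.le
    have h5 := mul_le_mul_of_nonneg_left (key2 t ht.le) hc.le
    have h6 := norm_add_le (Matrix.toEuclideanLin S.C (X t - S.state t p))
      (Matrix.toEuclideanLin S.D (V t - p.2 t))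
    linarith

/-- The noise-free trajectories themselves are trajectories. -/
theorem isTrajectoryOn_state (p : RVec nx × (ℕ → RVec nu)) (I : Set ℕ) :
    S.IsTrajectoryOn I (fun t => S.state t p) p.2 (fun t => S.output t p) 0 := by
  intro t _
  simp [state_succ, output_eq]

/-- Boundedness of noise-free trajectories over a bounded time. -/
theorem exists_state_bound (T : ℕ) : ∃ C : ℝ, 1 ≤ C ∧
    ∀ (p : RVec nx × (ℕ → RVec nu)) (e : ℝ) (n : ℕ), n ≤ T → 0 ≤ e → ‖p.1‖ ≤ e →
      (∀ t < n, ‖p.2 t‖ ≤ e) →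
      (∀ t ≤ n, ‖S.state t p‖ ≤ C * e) ∧ (∀ t < n, ‖S.output t p‖ ≤ C * e) := by
  obtain ⟨C, hC, h⟩ := S.exists_perturbation_bound T
  refine ⟨C, hC, fun p e n hn he h0 hv => ?_⟩
  have := h _ _ _ _ 0 e n hn he (S.isTrajectoryOn_state p (Set.Iio n))
    (by simpa [state_zero] using h0) (by simpa using hv) (fun _ _ => by simpa using he)
  simpa using this

theorem state_apply_zero_input (x : RVec nx) (t : ℕ) :
    S.state t (x, 0) = Matrix.toEuclideanLin (S.A ^ t) x := by
  induction t with
  | zero => simp [state_zero]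
  | succ t ih => rw [state_succ, ih, pow_succ']; simp [Matrix.toLpLin_mul_same]

/-- The state is bounded by the outputs over an observability window. -/
theorem exists_observability_bound {η : ℕ} (hη : (S.obsMatrix η).rank = nx) :
    ∃ C : ℝ, 1 ≤ C ∧ ∀ (p : RVec nx × (ℕ → RVec nu)) (e : ℝ), 0 ≤ e →
      (∀ i < η, ‖p.2 i‖ ≤ e) → (∀ i < η, ‖S.output i p‖ ≤ e) → ‖p.1‖ ≤ C * e := by
  let f : RVec nx →ₗ[ℝ] (Fin η → RVec ny) :=
    LinearMap.pi fun i => S.output i ∘ₗ LinearMap.inl ℝ _ _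
  have hker : Function.Injective (S.obsMatrix η).mulVec := by
    exact Matrix.mulVec_injective_of_rank_eq_card (by simpa using hη)
  have hf : Function.Injective f := by
    rw [← LinearMap.ker_eq_bot, LinearMap.ker_eq_bot']
    intro x hx
    have : x.ofLp = 0 := by
      apply hker
      rw [Matrix.mulVec_zero]
      funext ⟨i, a⟩
      have h1 := congrFun hx i
      have h2 := congrArg (fun v : RVec ny => v a) h1
      simp only [f, LinearMap.pi_apply, LinearMap.comp_apply, LinearMap.inl_apply, output_eq,
        state_apply_zero_input] at h2
      simp only [Pi.zero_apply, map_zero, add_zero] at h2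
      have h3 : (S.C *ᵥ (S.A ^ (i : ℕ) *ᵥ x.ofLp)) a = 0 := h2
      rw [Matrix.mulVec_mulVec] at h3
      exact h3
    ext i
    exact congrFun this i
  obtain ⟨C, hC, h⟩ := f.exists_bounded_preimage
  obtain ⟨C', hC', h'⟩ := S.exists_state_bound η
  refine ⟨1 + C * (1 + C'), by nlinarith, fun p e he hv hy => ?_⟩
  obtain ⟨x', h1, h2⟩ := h p.1
  rw [hf h1] at h2
  refine h2.trans ?_
  have h3 : ‖f p.1‖ ≤ (1 + C') * e := by
    refine (pi_norm_le_iff_of_nonneg (by positivity)).2 fun i => ?_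
    -- The output of the free motion is the output minus the forced response, which the inputs
    -- bound.
    have h4 : f p.1 i = S.output i p - S.output i (0, p.2) := by
      rw [← map_sub]
      change S.output i (p.1, 0) = _
      congr 1
      ext <;> simp
    rw [h4]
    have h5 := (h' (0, p.2) e η le_rfl he (by simpa) hv).2 i i.2
    have h6 := hy i i.2
    have h7 := norm_sub_le (S.output i p) (S.output i (0, p.2))
    linarith
  have := mul_le_mul_of_nonneg_left h3 hC.le
  nlinarith

end LTISystem

/-! ### Quadratic forms. -/

section quadForm

variable {ι : Type} [Fintype ι]

theorem quadForm_eq_inner [DecidableEq ι] (M : Matrix ι ι ℝ) (v : EuclideanSpace ℝ ι) :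
    quadForm M v = inner ℝ (Matrix.toEuclideanLin M v) v := by
  simp [quadForm, EuclideanSpace.inner_eq_star_dotProduct, Matrix.toLpLin_apply]

theorem quadForm_nonneg {M : Matrix ι ι ℝ} (hM : M.PosDef) (v : EuclideanSpace ℝ ι) :
    0 ≤ quadForm M v := by
  have := hM.posSemidef.dotProduct_mulVec_nonneg v.ofLp
  simpa [quadForm] using this

/-- The minimum over the compact unit sphere is positive, and homogeneity extends the bound to all
vectors. The sphere is empty only in dimension zero. -/
theorem exists_quadForm_lower_bound {M : Matrix ι ι ℝ} (hM : M.PosDef) :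
    ∃ c : ℝ, 0 < c ∧ ∀ v, c * ‖v‖ ^ 2 ≤ quadForm M v := by
  classical
  by_cases hne : (Metric.sphere (0 : EuclideanSpace ℝ ι) 1).Nonempty
  · have hcont : Continuous (quadForm M) := by
      have : quadForm M = fun v => inner ℝ (Matrix.toEuclideanLin M v) v :=
        funext (quadForm_eq_inner M)
      rw [this]
      exact (LinearMap.continuous_of_finiteDimensional _).inner continuous_id
    obtain ⟨v₀, hv₀, hmin⟩ := (isCompact_sphere (0 : EuclideanSpace ℝ ι) 1).exists_isMinOn hne
      hcont.continuousOn
    have hv₀' : v₀.ofLp ≠ 0 := by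
      intro h
      have : v₀ = 0 := by ext i; exact congrFun h i
      simp [this] at hv₀
    refine ⟨quadForm M v₀, ?_, fun v => ?_⟩
    · have := hM.dotProduct_mulVec_pos hv₀'
      simpa [quadForm] using this
    · by_cases hv : v = 0
      · simp [hv, quadForm]
      · have hnv : ‖v‖ ≠ 0 := norm_ne_zero_iff.mpr hv
        have h1 : quadForm M v₀ ≤ quadForm M (‖v‖⁻¹ • v) := hmin (by
          simp [norm_smul, hnv])
        have h2 : quadForm M (‖v‖⁻¹ • v) = (‖v‖⁻¹) ^ 2 * quadForm M v := by
          simp only [quadForm, WithLp.ofLp_smul, Matrix.mulVec_smul, dotProduct_smul,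
            smul_dotProduct, smul_eq_mul]
          ring
        rw [h2] at h1
        have h3 := mul_le_mul_of_nonneg_right h1 (sq_nonneg ‖v‖)
        have h4 : ‖v‖⁻¹ ^ 2 * quadForm M v * ‖v‖ ^ 2 = quadForm M v := by field_simp
        linarith
  · refine ⟨1, one_pos, fun v => ?_⟩
    have : v = 0 := by
      by_contra hv
      exact hne ⟨‖v‖⁻¹ • v, by simp [norm_smul, norm_ne_zero_iff.mpr hv]⟩
    simp [this, quadForm]

theorem exists_quadForm_lipschitz (M : Matrix ι ι ℝ) :
    ∃ C : ℝ, 0 < C ∧ ∀ v w, |quadForm M v - quadForm M w| ≤ C * (‖v‖ + ‖w‖) * ‖v - w‖ := by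
  classical
  obtain ⟨C, hC, h⟩ := (Matrix.toEuclideanLin M).exists_norm_bound
  refine ⟨C, hC, fun v w => ?_⟩
  have h1 : quadForm M v - quadForm M w =
      inner ℝ (Matrix.toEuclideanLin M v) (v - w) + inner ℝ (Matrix.toEuclideanLin M (v - w)) w := by
    rw [quadForm_eq_inner, quadForm_eq_inner, map_sub, inner_sub_right, inner_sub_left]
    ring
  rw [h1]
  have h2 := abs_real_inner_le_norm (Matrix.toEuclideanLin M v) (v - w)
  have h3 := abs_real_inner_le_norm (Matrix.toEuclideanLin M (v - w)) w
  have h4 := mul_le_mul_of_nonneg_right (h v) (norm_nonneg (v - w))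
  have h5 := mul_le_mul_of_nonneg_right (h (v - w)) (norm_nonneg w)
  calc _ ≤ _ := abs_add_le _ _
    _ ≤ C * (‖v‖ + ‖w‖) * ‖v - w‖ := by linarith

theorem exists_quadForm_upper_bound (M : Matrix ι ι ℝ) :
    ∃ C : ℝ, 0 < C ∧ ∀ v, quadForm M v ≤ C * ‖v‖ ^ 2 := by
  obtain ⟨C, hC, h⟩ := exists_quadForm_lipschitz M
  refine ⟨C, hC, fun v => ?_⟩
  have h1 := h v 0
  have h2 : quadForm M 0 = 0 := by simp [quadForm]
  rw [h2] at h1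
  simp only [sub_zero, norm_zero, add_zero] at h1
  calc _ ≤ _ := le_abs_self _
    _ ≤ _ := h1
    _ = _ := by ring

end quadForm

/-! ### Cayley-Hamilton in the two forms needed below. -/

/-- Reduction of the monomial modulo the characteristic polynomial. It confines reachability
arguments to powers below the dimension. -/
theorem Matrix.pow_eq_sum_lower {n : ℕ} (A : Matrix (Fin n) (Fin n) ℝ) (j : ℕ) :
    ∃ c : ℕ → ℝ, A ^ j = ∑ i ∈ Finset.range n, c i • A ^ i := by
  rcases Nat.eq_zero_or_pos n with rfl | hn
  · exact ⟨0, Subsingleton.elim _ _⟩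
  have : Nonempty (Fin n) := ⟨⟨0, hn⟩⟩
  set q := (Polynomial.X ^ j %ₘ A.charpoly : Polynomial ℝ) with hq
  refine ⟨q.coeff, ?_⟩
  have hdeg : q.natDegree < n := by
    have h1 : q.natDegree < A.charpoly.natDegree := by
      refine Polynomial.natDegree_modByMonic_lt _ A.charpoly_monic ?_
      intro h
      have := A.charpoly_natDegree_eq_dim
      rw [h] at this
      simp at this
      omega
    simpa [A.charpoly_natDegree_eq_dim] using h1
  rw [A.pow_eq_aeval_mod_charpoly, ← hq, Polynomial.aeval_eq_sum_range' hdeg]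

/-- The leading coefficient 1 is what later isolates the last of `nx + 1` shifted windows in
Willems' lemma. -/
theorem Matrix.exists_monic_annihilator {n : ℕ} (A : Matrix (Fin n) (Fin n) ℝ) :
    ∃ c : ℕ → ℝ, c n = 1 ∧ ∑ i ∈ Finset.range (n + 1), c i • A ^ i = 0 := by
  refine ⟨A.charpoly.coeff, ?_, ?_⟩
  · have := A.charpoly_monic.coeff_natDegree
    simpa [A.charpoly_natDegree_eq_dim] using this
  · have h := A.aeval_self_charpoly
    rwa [Polynomial.aeval_eq_sum_range' (n := n + 1)
      (by simp [A.charpoly_natDegree_eq_dim])] at h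

theorem Matrix.toEuclideanLin_pow_succ {n : ℕ} (A : Matrix (Fin n) (Fin n) ℝ) (k : ℕ)
    (x : RVec n) : Matrix.toEuclideanLin (A ^ (k + 1)) x =
      Matrix.toEuclideanLin A (Matrix.toEuclideanLin (A ^ k) x) := by
  rw [pow_succ']; simp [Matrix.toLpLin_mul_same]

theorem Matrix.toEuclideanLin_pow_add {n : ℕ} (A : Matrix (Fin n) (Fin n) ℝ) (k l : ℕ)
    (x : RVec n) : Matrix.toEuclideanLin (A ^ (k + l)) x =
      Matrix.toEuclideanLin (A ^ k) (Matrix.toEuclideanLin (A ^ l) x) := by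
  rw [pow_add, Matrix.toLpLin_mul_same]; rfl

theorem Matrix.toEuclideanLin_pow_eq_sum_lower {n : ℕ} (A : Matrix (Fin n) (Fin n) ℝ) (j : ℕ) :
    ∃ c : ℕ → ℝ, ∀ x : RVec n, Matrix.toEuclideanLin (A ^ j) x =
      ∑ i ∈ Finset.range n, c i • Matrix.toEuclideanLin (A ^ i) x := by
  obtain ⟨c, hc⟩ := A.pow_eq_sum_lower j
  refine ⟨c, fun x => ?_⟩
  rw [hc, map_sum]
  simp only [LinearMap.sum_apply, map_smul, LinearMap.smul_apply]

/-! ### Reachable and null-controllable states, orbit of the offline experiment. -/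

namespace LTISystem

variable {nx nu ny : ℕ} (S : LTISystem nx nu ny)

/-- The reachable subspace. -/
noncomputable def reach : Submodule ℝ (RVec nx) :=
  ⨆ k : ℕ, LinearMap.range (Matrix.toEuclideanLin (S.A ^ k) ∘ₗ Matrix.toEuclideanLin S.B)

theorem pow_B_mem_reach (k : ℕ) (u : RVec nu) :
    Matrix.toEuclideanLin (S.A ^ k) (Matrix.toEuclideanLin S.B u) ∈ S.reach :=
  Submodule.mem_iSup_of_mem k ⟨u, rfl⟩

theorem B_mem_reach (u : RVec nu) : Matrix.toEuclideanLin S.B u ∈ S.reach := by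
  simpa using S.pow_B_mem_reach 0 u

theorem reach_le {P : Submodule ℝ (RVec nx)}
    (h : ∀ k u, Matrix.toEuclideanLin (S.A ^ k) (Matrix.toEuclideanLin S.B u) ∈ P) :
    S.reach ≤ P :=
  iSup_le fun k => by
    rintro _ ⟨u, rfl⟩
    exact h k u

theorem A_mem_reach {x : RVec nx} (hx : x ∈ S.reach) :
    Matrix.toEuclideanLin S.A x ∈ S.reach := by
  have : S.reach ≤ S.reach.comap (Matrix.toEuclideanLin S.A) := S.reach_le fun k u => by
    rw [Submodule.mem_comap, ← Matrix.toEuclideanLin_pow_succ]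
    exact S.pow_B_mem_reach _ u
  exact this hx

theorem pow_A_mem {P : Submodule ℝ (RVec nx)}
    (hP : ∀ x ∈ P, Matrix.toEuclideanLin S.A x ∈ P) {x : RVec nx} (hx : x ∈ P) (k : ℕ) :
    Matrix.toEuclideanLin (S.A ^ k) x ∈ P := by
  induction k with
  | zero => simpa using hx
  | succ k ih => rw [Matrix.toEuclideanLin_pow_succ]; exact hP _ ih

theorem state_sub_pow_mem_reach (t : ℕ) (p : RVec nx × (ℕ → RVec nu)) :
    S.state t p - Matrix.toEuclideanLin (S.A ^ t) p.1 ∈ S.reach := by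
  induction t with
  | zero => simp [state_zero]
  | succ t ih =>
    rw [state_succ, Matrix.toEuclideanLin_pow_succ]
    have := S.reach.add_mem (S.A_mem_reach ih) (S.B_mem_reach (p.2 t))
    rw [map_sub] at this
    convert this using 1
    abel

/-- The response to a single input pulse. -/
theorem state_pulse (m i : ℕ) (u : RVec nu) :
    S.state (m + 1 + i) (0, Pi.single m u) =
      Matrix.toEuclideanLin (S.A ^ i) (Matrix.toEuclideanLin S.B u) := by
  rw [state_add_time, ← state_apply_zero_input]
  have h1 : S.state (m + 1) (0, Pi.single m u) = Matrix.toEuclideanLin S.B u := by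
    rw [state_succ, S.state_eq_zero rfl, map_zero, zero_add]
    · simp
    · intro j hj
      exact Pi.single_eq_of_ne (by omega) _
  rw [h1]
  have h2 : (fun j => (Pi.single m u : ℕ → RVec nu) (m + 1 + j)) = 0 :=
    funext fun j => Pi.single_eq_of_ne (M := fun _ => RVec nu) (by omega) _
  change S.state i (_, fun j => (Pi.single m u : ℕ → RVec nu) (m + 1 + j)) = _
  rw [h2]

theorem state_pulse_eq_zero {m t : ℕ} (h : t ≤ m) (u : RVec nu) :
    S.state t (0, Pi.single m u) = 0 :=
  S.state_eq_zero rfl fun j hj => Pi.single_eq_of_ne (M := fun _ => RVec nu) (by omega) _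

/-- Steering from the origin, over a horizon of at least `nx` steps. -/
theorem exists_input_of_mem_reach {k : ℕ} (hk : nx ≤ k) {x : RVec nx} (hx : x ∈ S.reach) :
    ∃ v : Fin k → RVec nu, S.state k (0, extendZero k v) = x := by
  let Γ : (Fin k → RVec nu) →ₗ[ℝ] RVec nx :=
    S.state k ∘ₗ LinearMap.inr ℝ _ _ ∘ₗ extendZero k
  suffices h : S.reach ≤ LinearMap.range Γ by exact h hx
  refine S.reach_le fun j u => ?_
  obtain ⟨c, hc⟩ := S.A.toEuclideanLin_pow_eq_sum_lower j
  rw [hc]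
  refine Submodule.sum_mem _ fun i hi => Submodule.smul_mem _ _ ?_
  have hik : i < k := by have := Finset.mem_range.mp hi; omega
  -- A pulse at time `k - 1 - i` enters the state with `i` steps left, so it ends as the image of
  -- `u` under `A ^ i * B`.
  refine ⟨fun q => (Pi.single (k - 1 - i) u : ℕ → RVec nu) q, ?_⟩
  change S.state k (0, extendZero k fun q : Fin k => (Pi.single (k - 1 - i) u : ℕ → RVec nu) q) = _
  rw [extendZero_restrict (Pi.single (k - 1 - i) u : ℕ → RVec nu)
    fun q hq => Pi.single_eq_of_ne (M := fun _ => RVec nu) (by omega) _]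
  have := S.state_pulse (k - 1 - i) i u
  rwa [show k - 1 - i + 1 + i = k by omega] at this

/-- The states that can be steered to the origin, up to the reachable subspace, in `l` steps. -/
noncomputable def nullReach (l : ℕ) : Submodule ℝ (RVec nx) :=
  S.reach.comap (Matrix.toEuclideanLin (S.A ^ l))

/-- The free motion ends in the reachable subspace, all of which is reached in `k ≥ nx` steps; hence
an input can cancel it. -/
theorem exists_null_input {k : ℕ} (hk : nx ≤ k) {x : RVec nx} (hx : x ∈ S.nullReach k) :
    ∃ v : Fin k → RVec nu, S.state k (x, extendZero k v) = 0 := by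
  obtain ⟨v, hv⟩ := S.exists_input_of_mem_reach hk (S.reach.neg_mem hx)
  refine ⟨v, ?_⟩
  have : (x, extendZero k v) = (x, (0 : ℕ → RVec nu)) + (0, extendZero k v) := by simp
  rw [this, map_add, hv, state_apply_zero_input, add_neg_cancel]

theorem mem_nullReach_of_state_eq_zero {l : ℕ} {p : RVec nx × (ℕ → RVec nu)}
    (h : S.state l p = 0) : p.1 ∈ S.nullReach l := by
  have := S.state_sub_pow_mem_reach l p
  rw [h, zero_sub] at this
  exact S.reach.neg_mem_iff.mp this

/-- The subspace generated by the reachable subspace and the free motion from `x₀`. -/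
noncomputable def orbit (x₀ : RVec nx) : Submodule ℝ (RVec nx) :=
  S.reach ⊔ Submodule.span ℝ (Set.range fun j : ℕ => Matrix.toEuclideanLin (S.A ^ j) x₀)

theorem reach_le_orbit (x₀ : RVec nx) : S.reach ≤ S.orbit x₀ := le_sup_left

theorem pow_mem_orbit (x₀ : RVec nx) (j : ℕ) :
    Matrix.toEuclideanLin (S.A ^ j) x₀ ∈ S.orbit x₀ :=
  (le_sup_right : _ ≤ S.orbit x₀) (Submodule.subset_span ⟨j, rfl⟩)

theorem A_mem_orbit (x₀ : RVec nx) {x : RVec nx} (hx : x ∈ S.orbit x₀) :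
    Matrix.toEuclideanLin S.A x ∈ S.orbit x₀ := by
  have : S.orbit x₀ ≤ (S.orbit x₀).comap (Matrix.toEuclideanLin S.A) := by
    refine sup_le (fun y hy => S.reach_le_orbit x₀ (S.A_mem_reach hy)) ?_
    rw [Submodule.span_le]
    rintro _ ⟨j, rfl⟩
    change Matrix.toEuclideanLin S.A (Matrix.toEuclideanLin (S.A ^ j) x₀) ∈ S.orbit x₀
    rw [← Matrix.toEuclideanLin_pow_succ]
    exact S.pow_mem_orbit x₀ _
  exact this hx

theorem state_mem_orbit (x₀ : RVec nx) (v : ℕ → RVec nu) (t : ℕ) :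
    S.state t (x₀, v) ∈ S.orbit x₀ := by
  have := (S.orbit x₀).add_mem (S.reach_le_orbit x₀ (S.state_sub_pow_mem_reach t (x₀, v)))
    (S.pow_mem_orbit x₀ t)
  simpa using this

/-- Invariance under A and containment of `reach` are what `Stabilizable.exists_decay` asks of a
subspace. -/
theorem A_mem_nullReach {l : ℕ} {x : RVec nx} (hx : x ∈ S.nullReach l) :
    Matrix.toEuclideanLin S.A x ∈ S.nullReach l := by
  change Matrix.toEuclideanLin (S.A ^ l) (Matrix.toEuclideanLin S.A x) ∈ S.reach
  have h : Matrix.toEuclideanLin (S.A ^ l) (Matrix.toEuclideanLin S.A x) =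
      Matrix.toEuclideanLin S.A (Matrix.toEuclideanLin (S.A ^ l) x) := by
    have h1 := S.A.toEuclideanLin_pow_add l 1 x
    rw [pow_one] at h1
    rw [← h1, Matrix.toEuclideanLin_pow_succ]
  rw [h]
  exact S.A_mem_reach hx

theorem reach_le_nullReach (l : ℕ) : S.reach ≤ S.nullReach l := fun _ hx =>
  S.pow_A_mem (fun _ h => S.A_mem_reach h) hx l

/-- The linear combination of the windows of the offline experiment with weights `g`:
initial state and input. -/
noncomputable def dataComb (x₀ : RVec nx) (us : ℕ → RVec nu) (M : ℕ) :
    RVec M →ₗ[ℝ] RVec nx × (ℕ → RVec nu) where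
  toFun g := ∑ j : Fin M, g j • (S.state j (x₀, us), fun i => us (i + j))
  map_add' g h := by simp only [PiLp.add_apply, add_smul, Finset.sum_add_distrib]
  map_smul' c g := by simp [mul_smul, Finset.smul_sum]

theorem dataComb_apply (x₀ : RVec nx) (us : ℕ → RVec nu) (M : ℕ) (g : RVec M) :
    S.dataComb x₀ us M g = ∑ j : Fin M, g j • (S.state j (x₀, us), fun i => us (i + j)) := rfl

theorem dataComb_fst (x₀ : RVec nx) (us : ℕ → RVec nu) (M : ℕ) (g : RVec M) :
    (S.dataComb x₀ us M g).1 = ∑ j : Fin M, g j • S.state j (x₀, us) := by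
  simp [dataComb_apply, Prod.fst_sum]

theorem dataComb_snd (x₀ : RVec nx) (us : ℕ → RVec nu) (M : ℕ) (g : RVec M) (i : ℕ) :
    (S.dataComb x₀ us M g).2 i = ∑ j : Fin M, g j • us (i + j) := by
  simp [dataComb_apply, Prod.snd_sum]

theorem dataComb_fst_mem_orbit (x₀ : RVec nx) (us : ℕ → RVec nu) (M : ℕ) (g : RVec M) :
    (S.dataComb x₀ us M g).1 ∈ S.orbit x₀ := by
  rw [dataComb_fst]
  exact Submodule.sum_mem _ fun j _ => Submodule.smul_mem _ _ (S.state_mem_orbit x₀ us j)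

theorem output_dataComb (x₀ : RVec nx) (us : ℕ → RVec nu) (M : ℕ) (g : RVec M) (i : ℕ) :
    S.output i (S.dataComb x₀ us M g) = ∑ j : Fin M, g j • S.output (i + j) (x₀, us) := by
  rw [dataComb_apply, map_sum]
  refine Finset.sum_congr rfl fun j _ => ?_
  rw [map_smul, add_comm i, output_add_time]
  simp only [add_comm]

end LTISystem

/-! ### Persistent excitation and Willems' lemma without controllability. -/

/-- Full row rank of the Hankel matrix is surjectivity. -/
theorem PersistentlyExciting.exists_comb {m k N : ℕ} {s : ℕ → RVec m}
    (h : PersistentlyExciting k N s) (v : Fin k → RVec m) :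
    ∃ g : RVec (N + 1 - k), ∀ i : Fin k, ∑ j : Fin (N + 1 - k), g j • s (i + j) = v i := by
  have h1 : Module.finrank ℝ (LinearMap.range (hankel k N s).mulVecLin) = m * k := h
  have h2 : LinearMap.range (hankel k N s).mulVecLin = ⊤ := by
    apply Submodule.eq_top_of_finrank_eq
    rw [h1, Module.finrank_fintype_fun_eq_card]
    simp [mul_comm]
  obtain ⟨g, hg⟩ := LinearMap.range_eq_top.mp h2 (fun p => v p.1 p.2)
  refine ⟨WithLp.toLp 2 g, fun i => ?_⟩
  ext a
  have h3 := congrFun hg (i, a)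
  simp only [Matrix.mulVecLin_apply, Matrix.mulVec, dotProduct, hankel, Matrix.of_apply] at h3
  rw [← h3]
  simp [mul_comm]

/-- The rank cannot exceed the number of columns; this is the source of the lower bound on the
length of the experiment. -/
theorem PersistentlyExciting.le_card {m k N : ℕ} {s : ℕ → RVec m}
    (h : PersistentlyExciting k N s) : m * k ≤ N + 1 - k := by
  have h1 := (hankel k N s).rank_le_card_width
  rw [h] at h1
  simpa using h1

/-- Dual form of persistent excitation: the input windows span, so nothing nonzero annihilates them.
-/
theorem PersistentlyExciting.functional_eq_zero {m k N : ℕ} {s : ℕ → RVec m}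
    (h : PersistentlyExciting k N s) (ψ : (ℕ → RVec m) →ₗ[ℝ] ℝ)
    (hψ : ∀ v w : ℕ → RVec m, (∀ i < k, v i = w i) → ψ v = ψ w)
    (h0 : ∀ j < N + 1 - k, ψ (fun i => s (i + j)) = 0) (v : ℕ → RVec m) : ψ v = 0 := by
  obtain ⟨g, hg⟩ := h.exists_comb (fun i => v i)
  have h1 : ψ v = ψ (∑ j : Fin (N + 1 - k), g j • fun i => s (i + j)) := by
    refine hψ _ _ fun i hi => ?_
    rw [← hg ⟨i, hi⟩]
    simp
  rw [h1, map_sum]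
  refine Finset.sum_eq_zero fun j _ => ?_
  rw [map_smul, h0 j j.2, smul_zero]

namespace LTISystem

variable {nx nu ny : ℕ} (S : LTISystem nx nu ny)

/-- A functional that vanishes on all data windows vanishes on the orbit and on all inputs. -/
theorem functional_eq_zero_of_persistentlyExciting {K N : ℕ} {us : ℕ → RVec nu} {x₀ : RVec nx}
    (hPE : PersistentlyExciting (K + nx) N us) (hN : K + 2 * nx ≤ N + 1)
    (p : RVec nx →ₗ[ℝ] ℝ) (q : Fin K → RVec nu →ₗ[ℝ] ℝ)
    (h : ∀ j < N + 1 - K, p (S.state j (x₀, us)) + ∑ i : Fin K, q i (us (i + j)) = 0) :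
    (∀ x ∈ S.orbit x₀, p x = 0) ∧ q = 0 := by
  obtain ⟨c, hc1, hc⟩ := S.A.exists_monic_annihilator
  -- The annihilator is applied to the windows shifted by 0, …, `nx` and weighted with the
  -- coefficients of the characteristic polynomial. The free motion then cancels by Cayley-Hamilton,
  -- and ψ is what remains: a functional of `K + nx` inputs alone, which persistent excitation
  -- forces to vanish.
  let ψ : (ℕ → RVec nu) →ₗ[ℝ] ℝ := ∑ k ∈ Finset.range (nx + 1), c k •
    (p ∘ₗ S.state k ∘ₗ LinearMap.inr ℝ _ _ + ∑ i : Fin K, q i ∘ₗ LinearMap.proj (k + i))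
  have hψ (v : ℕ → RVec nu) : ψ v = ∑ k ∈ Finset.range (nx + 1), c k *
      (p (S.state k (0, v)) + ∑ i : Fin K, q i (v (k + i))) := by
    simp [ψ, mul_add]
  have hann (x : RVec nx) :
      ∑ k ∈ Finset.range (nx + 1), c k * p (Matrix.toEuclideanLin (S.A ^ k) x) = 0 := by
    have h1 : p (Matrix.toEuclideanLin (∑ k ∈ Finset.range (nx + 1), c k • S.A ^ k) x) = 0 := by
      rw [hc]; simp
    rw [map_sum] at h1
    simpa only [LinearMap.sum_apply, map_smul, LinearMap.smul_apply, map_sum, smul_eq_mul] using h1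
  have hψ0 : ∀ v, ψ v = 0 := by
    refine hPE.functional_eq_zero ψ ?_ ?_
    · intro v w hvw
      rw [hψ, hψ]
      refine Finset.sum_congr rfl fun k hk => ?_
      have hk' := Finset.mem_range.mp hk
      rw [S.state_congr (p := (0, v)) (q := (0, w)) rfl (fun i hi => hvw i (by omega))]
      congr 2
      exact Finset.sum_congr rfl fun i _ => by rw [hvw _ (by omega)]
    · intro j hj
      rw [hψ]
      have h2 : ∀ k ∈ Finset.range (nx + 1), c k * (p (S.state k (0, fun i => us (i + j))) +
          ∑ i : Fin K, q i (us (k + i + j))) =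
          - (c k * p (Matrix.toEuclideanLin (S.A ^ k) (S.state j (x₀, us)))) := by
        intro k hk
        have hk' := Finset.mem_range.mp hk
        have h3 := h (j + k) (by omega)
        have h4 : S.state (j + k) (x₀, us) = Matrix.toEuclideanLin (S.A ^ k) (S.state j (x₀, us)) +
            S.state k (0, fun i => us (i + j)) := by
          rw [state_add_time, ← state_apply_zero_input, ← map_add]
          simp [add_comm]
        have h5 : ∑ i : Fin K, q i (us (k + i + j)) = ∑ i : Fin K, q i (us (i + (j + k))) :=
          Finset.sum_congr rfl fun i _ => by congr 2; omega
        rw [h4, map_add] at h3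
        rw [h5, ← mul_neg]
        congr 1
        linarith
      rw [Finset.sum_congr rfl h2, Finset.sum_neg_distrib, hann, neg_zero]
  -- A pulse at time `nx + i` is seen by `q i` through the last shift, and otherwise only by later
  -- entries of `q`; backward induction from the last entry kills them one by one.
  have hq : ∀ l : ℕ, ∀ i : Fin K, K - 1 - i = l → q i = 0 := by
    intro l
    induction l using Nat.strong_induction_on with
    | _ l ih =>
      intro i hi
      ext1 u
      have h1 := hψ0 (Pi.single (nx + i) u)
      rw [hψ, Finset.sum_eq_single_of_mem nx (by simp)] at h1
      · rw [hc1, one_mul, S.state_pulse_eq_zero (by omega), map_zero, zero_add,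
          Finset.sum_eq_single_of_mem i (Finset.mem_univ _)] at h1
        · simpa using h1
        · intro i' _ hne
          rw [Pi.single_eq_of_ne (M := fun _ => RVec nu), map_zero]
          intro h; apply hne; ext; omega
      · intro k hk hkn
        have hk' := Finset.mem_range.mp hk
        rw [S.state_pulse_eq_zero (by omega), map_zero, zero_add, Finset.sum_eq_zero, mul_zero]
        intro i' _
        by_cases h : k + i' = nx + i
        · rw [ih (K - 1 - i') (by omega) i' rfl]; simp
        · rw [Pi.single_eq_of_ne (M := fun _ => RVec nu) h, map_zero]
  have hq0 : q = 0 := funext fun i => hq _ i rfl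
  -- With `q = 0`, a pulse at `nx - 1 - l` produces the power `l` at the last shift and only lower
  -- powers at the earlier ones.
  have hpB : ∀ l < nx, ∀ u : RVec nu,
      p (Matrix.toEuclideanLin (S.A ^ l) (Matrix.toEuclideanLin S.B u)) = 0 := by
    intro l
    induction l using Nat.strong_induction_on with
    | _ l ih =>
      intro hl u
      have h1 := hψ0 (Pi.single (nx - 1 - l) u)
      rw [hψ, Finset.sum_eq_single_of_mem nx (by simp)] at h1
      · have h2 := S.state_pulse (nx - 1 - l) l u
        rw [show nx - 1 - l + 1 + l = nx by omega] at h2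
        rw [h2, hc1, hq0] at h1
        simpa using h1
      · intro k hk hkn
        have hk' := Finset.mem_range.mp hk
        rw [hq0]
        rcases le_or_gt k (nx - 1 - l) with h3 | h3
        · rw [S.state_pulse_eq_zero h3]; simp
        · have h2 := S.state_pulse (nx - 1 - l) (k - (nx - l)) u
          rw [show nx - 1 - l + 1 + (k - (nx - l)) = k by omega] at h2
          rw [h2, ih _ (by omega) (by omega)]
          simp
  have hreach : ∀ x ∈ S.reach, p x = 0 := by
    have : S.reach ≤ LinearMap.ker p := S.reach_le fun k u => by
      obtain ⟨d, hd⟩ := S.A.toEuclideanLin_pow_eq_sum_lower k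
      rw [LinearMap.mem_ker, hd, map_sum]
      refine Finset.sum_eq_zero fun i hi => ?_
      rw [map_smul, hpB i (Finset.mem_range.mp hi), smul_zero]
    exact this
  -- `hN` guarantees that windows with these offsets exist; modulo the reachable part their states
  -- are the free motion of `x₀`.
  have hpow : ∀ j < nx, p (Matrix.toEuclideanLin (S.A ^ j) x₀) = 0 := by
    intro j hj
    have h1 := h j (by omega)
    have h2 := hreach _ (S.state_sub_pow_mem_reach j (x₀, us))
    rw [hq0] at h1
    rw [map_sub] at h2
    simp only [Pi.zero_apply, LinearMap.zero_apply, Finset.sum_const_zero, add_zero] at h1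
    linarith
  refine ⟨?_, hq0⟩
  have : S.orbit x₀ ≤ LinearMap.ker p := by
    refine sup_le hreach ?_
    rw [Submodule.span_le]
    rintro _ ⟨k, rfl⟩
    obtain ⟨d, hd⟩ := S.A.toEuclideanLin_pow_eq_sum_lower k
    change p _ = 0
    simp only [hd, map_sum]
    refine Finset.sum_eq_zero fun i hi => ?_
    rw [map_smul, hpow i (Finset.mem_range.mp hi), smul_zero]
  exact this

/-- **Willems' lemma** for a plant that need not be controllable: every window that starts in the
orbit of the offline experiment is a bounded linear combination of data windows. -/
theorem exists_dataComb {K N : ℕ} {us : ℕ → RVec nu} (x₀ : RVec nx)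
    (hPE : PersistentlyExciting (K + nx) N us) (hN : K + 2 * nx ≤ N + 1) :
    ∃ C : ℝ, 1 ≤ C ∧ ∀ x ∈ S.orbit x₀, ∀ (v : ℕ → RVec nu) (e : ℝ), 0 ≤ e → ‖x‖ ≤ e →
      (∀ i < K, ‖v i‖ ≤ e) → ∃ g : RVec (N + 1 - K), (S.dataComb x₀ us _ g).1 = x ∧
        (∀ i < K, (S.dataComb x₀ us _ g).2 i = v i) ∧ ‖g‖ ≤ C * e := by
  let f : RVec (N + 1 - K) →ₗ[ℝ] RVec nx × (Fin K → RVec nu) :=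
    (LinearMap.prodMap LinearMap.id (LinearMap.funLeft ℝ _ (fun i : Fin K => (i : ℕ)))) ∘ₗ
      S.dataComb x₀ us _
  have hf (x) (hx : x ∈ S.orbit x₀) (v : Fin K → RVec nu) : (x, v) ∈ LinearMap.range f := by
    -- A point outside the range would be separated from it by a functional that annihilates all
    -- data windows.
    by_contra hcon
    obtain ⟨φ, hφ, hker⟩ := Submodule.exists_le_ker_of_notMem hcon
    apply hφ
    have hdec (x : RVec nx) (v : Fin K → RVec nu) : φ (x, v) = (φ ∘ₗ LinearMap.inl ℝ _ _) x +
        ∑ i : Fin K, (φ ∘ₗ LinearMap.inr ℝ _ _ ∘ₗ LinearMap.single ℝ (fun _ => RVec nu) i) (v i) := by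
      have h1 : (x, v) = LinearMap.inl ℝ _ _ x + LinearMap.inr ℝ _ _ v := by simp
      have h2 : v = ∑ i, LinearMap.single ℝ (fun _ => RVec nu) i (v i) := by
        simp only [LinearMap.coe_single]
        exact (Finset.univ_sum_single v).symm
      rw [h1, map_add]
      congr 1
      conv_lhs => rw [h2]
      simp only [map_sum, LinearMap.comp_apply]
    have h0 := S.functional_eq_zero_of_persistentlyExciting (x₀ := x₀) hPE hN
      (φ ∘ₗ LinearMap.inl ℝ _ _)
      (fun i => φ ∘ₗ LinearMap.inr ℝ _ _ ∘ₗ LinearMap.single ℝ (fun _ => RVec nu) i)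
      (fun j hj => by
        have h1 : f (EuclideanSpace.single ⟨j, hj⟩ 1) ∈ LinearMap.ker φ := hker ⟨_, rfl⟩
        have h2 : f (EuclideanSpace.single ⟨j, hj⟩ 1) =
            (S.state j (x₀, us), fun i : Fin K => us (i + j)) := by
          ext1
          · simp [f, dataComb_fst]
          · funext i
            simp [f, dataComb_snd, LinearMap.funLeft_apply]
        rw [LinearMap.mem_ker, h2, hdec] at h1
        exact h1)
    have h3 : ∀ i : Fin K, φ ∘ₗ LinearMap.inr ℝ _ _ ∘ₗ
        LinearMap.single ℝ (fun _ => RVec nu) i = 0 := fun i => congrFun h0.2 i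
    rw [hdec, h0.1 x hx, Finset.sum_eq_zero, add_zero]
    intro i _
    rw [h3 i]; rfl
  obtain ⟨C, hC, hpre⟩ := f.exists_bounded_preimage
  refine ⟨C + 1, by linarith, fun x hx v e he hxe hve => ?_⟩
  obtain ⟨g₀, hg₀⟩ := hf x hx (fun i => v i)
  obtain ⟨g, h1, h2⟩ := hpre g₀
  rw [hg₀] at h1 h2
  refine ⟨g, congrArg Prod.fst h1, fun i hi => congrFun (congrArg Prod.snd h1) ⟨i, hi⟩, ?_⟩
  have h3 : ‖(x, fun i : Fin K => v i)‖ ≤ e :=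
    max_le hxe ((pi_norm_le_iff_of_nonneg he).2 fun i => hve i i.2)
  nlinarith

end LTISystem

/-! ### Schur stability and contraction modulo invariant subspaces. -/

theorem Matrix.norm_toEuclideanLin_le {m n : ℕ} (F : Matrix (Fin m) (Fin n) ℝ) {b : ℝ}
    (h : ∀ i j, |F i j| ≤ b) (x : RVec n) :
    ‖Matrix.toEuclideanLin F x‖ ≤ m * n * b * ‖x‖ := by
  have hcoord (i : Fin m) : ‖(Matrix.toEuclideanLin F x) i‖ ≤ n * b * ‖x‖ := by
    have h1 : (Matrix.toEuclideanLin F x) i = ∑ j, F i j * x j := rfl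
    rw [h1]
    refine (norm_sum_le _ _).trans ?_
    have h2 : ∀ j ∈ Finset.univ, ‖F i j * x j‖ ≤ b * ‖x‖ := fun j _ => by
      rw [norm_mul]
      exact mul_le_mul (h i j) (PiLp.norm_apply_le x j) (norm_nonneg _)
        ((abs_nonneg _).trans (h i j))
    refine (Finset.sum_le_sum h2).trans (le_of_eq ?_)
    simp [mul_assoc]
  set y := Matrix.toEuclideanLin F x
  have h3 : y = ∑ i, EuclideanSpace.single i (y i) := by
    ext i; simp
  rw [h3]
  refine (norm_sum_le _ _).trans ?_
  have h4 : ∀ i ∈ Finset.univ, ‖EuclideanSpace.single i (y i)‖ ≤ n * b * ‖x‖ := fun i _ => by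
    rw [PiLp.norm_single]
    exact hcoord i
  refine (Finset.sum_le_sum h4).trans (le_of_eq ?_)
  simp [mul_assoc]

-- Gelfand's formula in the operator norm for the maximum norm, which dominates every entry.
attribute [local instance] Matrix.linftyOpNormedRing Matrix.linftyOpNormedAlgebra in
theorem Matrix.exists_norm_pow_le_of_spectrum {n : ℕ} (F : Matrix (Fin n) (Fin n) ℂ)
    (h : ∀ μ ∈ spectrum ℂ F, ‖μ‖ < 1) :
    ∃ C ρ : ℝ, 0 < C ∧ 0 < ρ ∧ ρ < 1 ∧ ∀ t i j, ‖(F ^ t) i j‖ ≤ C * ρ ^ t := by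
  rcases Nat.eq_zero_or_pos n with rfl | hn
  · exact ⟨1, 1 / 2, one_pos, by norm_num, by norm_num, fun _ i => i.elim0⟩
  have : Nonempty (Fin n) := ⟨⟨0, hn⟩⟩
  have hr : spectralRadius ℂ F < 1 := by
    have := spectrum.spectralRadius_lt_of_forall_lt F (r := 1) fun k hk => by
      exact_mod_cast h k hk
    simpa using this
  obtain ⟨ρ, hρ1, hρ2⟩ := ENNReal.lt_iff_exists_nnreal_btwn.mp hr
  have hρ3 : (ρ : ℝ) < 1 := by exact_mod_cast hρ2
  have hρ0 : (0 : ℝ) < ρ := by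
    have : (0 : ENNReal) < ρ := lt_of_le_of_lt zero_le hρ1
    exact_mod_cast this
  have hev := (spectrum.pow_norm_pow_one_div_tendsto_nhds_spectralRadius F).eventually_lt_const hρ1
  obtain ⟨t₀, ht₀⟩ := Filter.eventually_atTop.mp hev
  have hlarge : ∀ t, t₀ + 1 ≤ t → ‖F ^ t‖ ≤ (ρ : ℝ) ^ t := by
    intro t ht
    have h1 := ht₀ t (by omega)
    have h2 : ‖F ^ t‖ ^ (1 / t : ℝ) < ρ := by
      rw [← ENNReal.ofReal_coe_nnreal] at h1
      exact (ENNReal.ofReal_lt_ofReal_iff hρ0).mp h1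
    have h3 := pow_le_pow_left₀ (by positivity) h2.le t
    have ht0 : (t : ℝ) ≠ 0 := by exact_mod_cast (show t ≠ 0 by omega)
    rwa [← Real.rpow_natCast, ← Real.rpow_mul (norm_nonneg _), one_div,
      inv_mul_cancel₀ ht0, Real.rpow_one] at h3
  have hs : 0 ≤ ∑ t ∈ Finset.range (t₀ + 1), ‖F ^ t‖ / (ρ : ℝ) ^ t :=
    Finset.sum_nonneg fun _ _ => by positivity
  -- The sum pays for the finitely many powers that Gelfand's formula does not control.
  refine ⟨1 + ∑ t ∈ Finset.range (t₀ + 1), ‖F ^ t‖ / (ρ : ℝ) ^ t, ρ, by linarith, hρ0, hρ3, ?_⟩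
  intro t i j
  have h1 : ‖(F ^ t) i j‖ ≤ ‖F ^ t‖ := by
    rw [Matrix.linfty_opNorm_def]
    have h2 : ∑ j, ‖(F ^ t) i j‖₊ ≤ Finset.univ.sup fun i => ∑ j, ‖(F ^ t) i j‖₊ :=
      Finset.le_sup (f := fun i => ∑ j, ‖(F ^ t) i j‖₊) (Finset.mem_univ i)
    have h3 : ‖(F ^ t) i j‖₊ ≤ ∑ j, ‖(F ^ t) i j‖₊ :=
      Finset.single_le_sum (f := fun j => ‖(F ^ t) i j‖₊) (fun _ _ => zero_le) (Finset.mem_univ j)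
    exact_mod_cast h3.trans h2
  refine h1.trans ?_
  have hpt : (0 : ℝ) < (ρ : ℝ) ^ t := by positivity
  rcases le_or_gt (t₀ + 1) t with ht | ht
  · have := hlarge t ht
    nlinarith
  · have h4 : ‖F ^ t‖ / (ρ : ℝ) ^ t ≤ ∑ t ∈ Finset.range (t₀ + 1), ‖F ^ t‖ / (ρ : ℝ) ^ t :=
      Finset.single_le_sum (f := fun t => ‖F ^ t‖ / (ρ : ℝ) ^ t) (fun _ _ => by positivity)
        (Finset.mem_range.mpr ht)
    rw [div_le_iff₀ hpt] at h4
    nlinarith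

theorem Matrix.exists_pow_bound_of_schur {n : ℕ} (F : Matrix (Fin n) (Fin n) ℝ)
    (h : ∀ μ ∈ spectrum ℂ (F.map (algebraMap ℝ ℂ)), ‖μ‖ < 1) :
    ∃ C ρ : ℝ, 1 ≤ C ∧ 0 < ρ ∧ ρ < 1 ∧ ∀ t (x : RVec n),
      ‖Matrix.toEuclideanLin (F ^ t) x‖ ≤ C * ρ ^ t * ‖x‖ := by
  obtain ⟨C, ρ, hC, hρ0, hρ1, hb⟩ := Matrix.exists_norm_pow_le_of_spectrum _ h
  refine ⟨n * n * C + 1, ρ, by nlinarith [sq_nonneg (n : ℝ)], hρ0, hρ1, fun t x => ?_⟩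
  have h1 : ∀ i j, |(F ^ t) i j| ≤ C * ρ ^ t := fun i j => by
    have h2 := hb t i j
    have h3 : (F.map (algebraMap ℝ ℂ)) ^ t = (F ^ t).map (algebraMap ℝ ℂ) :=
      (Matrix.map_pow F (algebraMap ℝ ℂ) t).symm
    rw [h3] at h2
    simpa using h2
  refine (Matrix.norm_toEuclideanLin_le _ h1 x).trans ?_
  have : 0 ≤ ρ ^ t * ‖x‖ := by positivity
  nlinarith

namespace LTISystem

variable {nx nu ny : ℕ} (S : LTISystem nx nu ny)

/-- For a stabilizable plant, the distance to an invariant subspace that contains the reachable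
subspace decays exponentially, up to the noise. -/
theorem Stabilizable.exists_decay {S : LTISystem nx nu ny} (hS : S.Stabilizable) :
    ∃ C ρ : ℝ, 1 ≤ C ∧ 0 < ρ ∧ ρ < 1 ∧
    ∀ (P : Submodule ℝ (RVec nx)), S.reach ≤ P →
      (∀ x ∈ P, Matrix.toEuclideanLin S.A x ∈ P) →
    ∀ (X : ℕ → RVec nx) (V : ℕ → RVec nu) (Y : ℕ → RVec ny) (W : ℕ → RVec nx) (e : ℝ) (n : ℕ),
      S.IsTrajectoryOn (Set.Iio n) X V Y W → 0 ≤ e → (∀ t < n, ‖W t‖ ≤ e) →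
      ∀ m ∈ P, ∃ m' ∈ P, ‖X n - m'‖ ≤ C * (ρ ^ n * ‖X 0 - m‖ + e) := by
  obtain ⟨K, hK⟩ := hS
  obtain ⟨C, ρ, hC, hρ0, hρ1, hF⟩ := Matrix.exists_pow_bound_of_schur _ hK
  obtain ⟨F, hFdef⟩ : ∃ F, F = S.A + S.B * K := ⟨_, rfl⟩
  rw [← hFdef] at hF
  have hρ2 : 0 < 1 - ρ := by linarith
  have hinv : 1 ≤ (1 - ρ)⁻¹ := (one_le_inv₀ hρ2).mpr (by linarith)
  refine ⟨C * (1 - ρ)⁻¹, ρ, by nlinarith, hρ0, hρ1, ?_⟩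
  intro P hRP hAP X V Y W e n htraj he hW m hm
  -- `r` follows the stabilized dynamics `F = A + B K` from `X 0 - m` and carries all the noise. The
  -- difference `X - r` obeys the plant equation with some input and no noise, so it never leaves
  -- `P`; the distance to `P` is at most ‖r‖, whatever the actual input is.
  let r : ℕ → RVec nx := fun t => Matrix.toEuclideanLin (F ^ t) (X 0 - m) +
    ∑ i ∈ Finset.range t, Matrix.toEuclideanLin (F ^ (t - 1 - i)) (W i)
  have hr : ∀ t, r (t + 1) = Matrix.toEuclideanLin F (r t) + W t := by
    intro t
    simp only [r]
    rw [Matrix.toEuclideanLin_pow_succ, map_add, Finset.sum_range_succ, map_sum, add_assoc]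
    congr 2
    · refine Finset.sum_congr rfl fun i hi => ?_
      have := Finset.mem_range.mp hi
      rw [← Matrix.toEuclideanLin_pow_succ]
      congr 3
      omega
    · simp
  have hmem : ∀ t ≤ n, X t - r t ∈ P := by
    intro t
    induction t with
    | zero => intro _; simpa [r] using hm
    | succ t ih =>
      intro ht
      have h1 := hAP _ (ih (by omega))
      have h2 := hRP (S.B_mem_reach (V t - Matrix.toEuclideanLin K (r t)))
      have h3 := P.add_mem h1 h2
      rw [hr, (htraj t (show t < n by omega)).1]
      have h4 (z : RVec nx) : Matrix.toEuclideanLin F z = Matrix.toEuclideanLin S.A z +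
          Matrix.toEuclideanLin S.B (Matrix.toEuclideanLin K z) := by
        rw [hFdef, map_add, LinearMap.add_apply, Matrix.toLpLin_mul_same]; rfl
      rw [h4]
      convert h3 using 1
      rw [map_sub, map_sub]; abel
  refine ⟨X n - r n, hmem n le_rfl, ?_⟩
  rw [sub_sub_cancel]
  have hsum : ‖∑ i ∈ Finset.range n, Matrix.toEuclideanLin (F ^ (n - 1 - i)) (W i)‖ ≤
      C * (1 - ρ)⁻¹ * e := by
    refine (norm_sum_le _ _).trans ?_
    have h1 : ∀ i ∈ Finset.range n, ‖Matrix.toEuclideanLin (F ^ (n - 1 - i)) (W i)‖ ≤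
        C * e * ρ ^ (n - 1 - i) := fun i hi => by
      refine (hF _ _).trans ?_
      have h2 := hW i (Finset.mem_range.mp hi)
      have h3 : 0 ≤ C * ρ ^ (n - 1 - i) := by positivity
      nlinarith
    refine (Finset.sum_le_sum h1).trans ?_
    rw [← Finset.mul_sum, Finset.sum_range_reflect (fun i => ρ ^ i) n]
    have h4 : ∑ i ∈ Finset.range n, ρ ^ i ≤ (1 - ρ)⁻¹ := by
      have h5 := (summable_geometric_of_lt_one hρ0.le hρ1).sum_le_tsum (Finset.range n)
        (fun i _ => by positivity)
      rwa [tsum_geometric_of_lt_one hρ0.le hρ1] at h5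
    have h6 : 0 ≤ C * e := by positivity
    nlinarith
  have h7 := norm_add_le (Matrix.toEuclideanLin (F ^ n) (X 0 - m))
    (∑ i ∈ Finset.range n, Matrix.toEuclideanLin (F ^ (n - 1 - i)) (W i))
  have h8 := hF n (X 0 - m)
  have h9 : C * ρ ^ n * ‖X 0 - m‖ ≤ C * (1 - ρ)⁻¹ * (ρ ^ n * ‖X 0 - m‖) := by
    have : 0 ≤ C * (ρ ^ n * ‖X 0 - m‖) := by positivity
    nlinarith
  calc ‖r n‖ ≤ _ := h7
    _ ≤ C * (1 - ρ)⁻¹ * (ρ ^ n * ‖X 0 - m‖ + e) := by linarith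

end LTISystem

/-! ### Accuracy of the data model behind a solution of bounded cost. -/

theorem norm_sum_smul_le {M : ℕ} {E : Type*} [NormedAddCommGroup E] [NormedSpace ℝ E]
    (g : RVec M) (f : Fin M → E) {b : ℝ} (hf : ∀ j, ‖f j‖ ≤ b) :
    ‖∑ j, g j • f j‖ ≤ M * b * ‖g‖ := by
  refine (norm_sum_le _ _).trans ?_
  have h1 : ∀ j ∈ Finset.univ, ‖g j • f j‖ ≤ b * ‖g‖ := fun j _ => by
    rw [norm_smul, mul_comm]
    exact mul_le_mul (hf j) (PiLp.norm_apply_le g j) (norm_nonneg _)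
      ((norm_nonneg _).trans (hf j))
  refine (Finset.sum_le_sum h1).trans (le_of_eq ?_)
  simp [mul_assoc]

theorem hankel_mulVec {m k N : ℕ} (s : ℕ → RVec m) (g : RVec (N + 1 - k)) (i : Fin k)
    (a : Fin m) : (hankel k N s *ᵥ g.ofLp) (i, a) = (∑ j : Fin (N + 1 - k), g j • s (i + j)) a := by
  simp [hankel, Matrix.mulVec, dotProduct, mul_comm]

theorem norm_add_sq_le' {E : Type*} [NormedAddCommGroup E] (a b : E) :
    ‖a + b‖ ^ 2 ≤ ‖a‖ ^ 2 + (2 * ‖a‖ * ‖b‖ + ‖b‖ ^ 2) := by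
  have h := norm_add_le a b
  have := pow_le_pow_left₀ (norm_nonneg _) h 2
  linarith [add_sq ‖a‖ ‖b‖]

namespace MPCProblem

variable {nx nu ny N L η : ℕ}

/-- The parameters of the MPC problem agree with the fixed ones, the weights and the noise level
are bounded, and the recorded outputs differ from the noise-free ones by at most `c * vbar`. -/
structure Admissible (p : MPCProblem nu ny N L η) (S : LTISystem nx nu ny)
    (R₁ : Matrix (Fin nu) (Fin nu) ℝ) (R₂ : Matrix (Fin ny) (Fin ny) ℝ) (U : Set (RVec nu))
    (us : ℕ → RVec nu) (x₀ : RVec nx) (c : ℝ) : Prop where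
  us_eq : p.us = us
  R₁_eq : p.R₁ = R₁
  R₂_eq : p.R₂ = R₂
  U_eq : p.U = U
  one_le_lamg : 1 ≤ p.lamg
  lamg_le : p.lamg ≤ 2
  one_le_lamh : 1 ≤ p.lamh
  lamh_le : p.lamh ≤ 2
  vbar_pos : 0 < p.vbar
  vbar_le : p.vbar ≤ 1
  data : ∀ t < N, ‖p.ys t - S.output t (x₀, us)‖ ≤ c * p.vbar

/-- A noisy trajectory piece of length `η` of the plant whose inputs and noisy outputs form the
window `z`. -/
structure _root_.LTISystem.IsWindow (S : LTISystem nx nu ny) (z : EuclideanSpace ℝ (AugIdx nu ny η))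
    (vbar : ℝ) (X : ℕ → RVec nx) (V : ℕ → RVec nu) (Y : ℕ → RVec ny) (W : ℕ → RVec nx)
    (n : ℕ → RVec ny) : Prop where
  traj : S.IsTrajectoryOn (Set.Iio η) X V Y W
  noise : ∀ t < η, ‖W t‖ ≤ vbar
  outNoise : ∀ t < η, ‖n t‖ ≤ vbar
  input : ∀ (i : Fin η) (a : Fin nu), z (Sum.inl (i, a)) = V i a
  output : ∀ (i : Fin η) (a : Fin ny), z (Sum.inr (i, a)) = Y i a + n i a

variable {S : LTISystem nx nu ny} {R₁ : Matrix (Fin nu) (Fin nu) ℝ}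
  {R₂ : Matrix (Fin ny) (Fin ny) ℝ} {U : Set (RVec nu)} {us : ℕ → RVec nu} {x₀ : RVec nx}
  {c : ℝ} {p : MPCProblem nu ny N L η} {z : EuclideanSpace ℝ (AugIdx nu ny η)}
  {o : MPCVars nu ny N L η}

theorem Admissible.vbar_le_sqrt (hp : p.Admissible S R₁ R₂ U us x₀ c) :
    p.vbar ≤ √p.vbar :=
  Real.le_sqrt_of_sq_le (by nlinarith [hp.vbar_pos, hp.vbar_le])

theorem Admissible.sqrt_le_one (hp : p.Admissible S R₁ R₂ U us x₀ c) : √p.vbar ≤ 1 :=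
  Real.sqrt_le_one.mpr hp.vbar_le

/-- Each recorded output is off by O(v), so the combination is off by O(v‖g‖), exactly the quantity
that the penalty on `g` makes O(√v). -/
theorem Admissible.data_error (hp : p.Admissible S R₁ R₂ U us x₀ c)
    (g : RVec (N + 1 - (L + η))) {i : ℕ} (hi : i < L + η) :
    ‖∑ j : Fin (N + 1 - (L + η)), g j • p.ys (i + j) -
      S.output i (S.dataComb x₀ us _ g)‖ ≤ (N + 1) * c * (p.vbar * ‖g‖) := by
  rw [LTISystem.output_dataComb, ← Finset.sum_sub_distrib]
  simp only [← smul_sub]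
  have h1 : ∀ j : Fin (N + 1 - (L + η)),
      ‖p.ys (i + j) - S.output (i + j) (x₀, us)‖ ≤ c * p.vbar :=
    fun j => hp.data _ (by omega)
  refine (norm_sum_smul_le g _ h1).trans ?_
  rcases isEmpty_or_nonempty (Fin (N + 1 - (L + η))) with h | ⟨⟨j⟩⟩
  · have : g = 0 := by ext j; exact h.elim j
    simp [this]
  · have h2 : 0 ≤ c * p.vbar := (norm_nonneg _).trans (h1 j)
    have h3 : ((N + 1 - (L + η) : ℕ) : ℝ) ≤ N + 1 := by exact_mod_cast Nat.sub_le _ _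
    have h4 : 0 ≤ c * p.vbar * ‖g‖ := by positivity
    nlinarith

/-- The offline input is known exactly, so the computed input is exactly that of the trajectory
generated by `g`; only outputs carry errors. -/
theorem IsFeasible.ubar_eq (hp : p.Admissible S R₁ R₂ U us x₀ c) (ho : p.IsFeasible z o)
    (i : Fin (L + η)) : o.ubar i = (S.dataComb x₀ us _ o.g).2 i := by
  ext a
  rw [ho.hankel_u, hankel_mulVec, hp.us_eq, LTISystem.dataComb_snd]

theorem IsFeasible.ybar_add_h (ho : p.IsFeasible z o) (i : Fin (L + η)) :
    o.ybar i + o.h i = ∑ j : Fin (N + 1 - (L + η)), o.g j • p.ys (i + j) := by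
  ext a
  have := ho.hankel_y i a
  rw [hankel_mulVec] at this
  simpa using this

/-- Consequences of a cost bound. -/
theorem Admissible.cost_bounds (hp : p.Admissible S R₁ R₂ U us x₀ c) (hR₁ : R₁.PosDef)
    (hR₂ : R₂.PosDef) {V : ℝ} (hV : p.cost o ≤ V) :
    0 ≤ V ∧ p.vbar * ‖o.g‖ ≤ √V * √p.vbar ∧ (∀ i, ‖o.h i‖ ≤ √V * √p.vbar) ∧
      ∀ (q : ℕ) (hq : q < L), quadForm R₁ (o.ubar ⟨q + η, by omega⟩) ≤ V := by
  have hv := hp.vbar_pos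
  unfold cost at hV
  rw [hp.R₁_eq, hp.R₂_eq] at hV
  have h1 : ∀ q : Fin L, 0 ≤ quadForm R₁ (o.ubar ⟨q + η, by omega⟩) +
      quadForm R₂ (o.ybar ⟨q + η, by omega⟩) := fun q =>
    add_nonneg (quadForm_nonneg hR₁ _) (quadForm_nonneg hR₂ _)
  have h2 := Finset.sum_nonneg fun q (_ : q ∈ Finset.univ) => h1 q
  have h3 : p.vbar * ‖o.g‖ ^ 2 ≤ p.lamg * p.vbar * ‖o.g‖ ^ 2 := by
    have : 0 ≤ p.vbar * ‖o.g‖ ^ 2 := by positivity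
    nlinarith [hp.one_le_lamg]
  have h3' : 0 ≤ p.vbar * ‖o.g‖ ^ 2 := by positivity
  have h4 : 0 ≤ ∑ i, ‖o.h i‖ ^ 2 := Finset.sum_nonneg fun _ _ => by positivity
  have h5 : (∑ i, ‖o.h i‖ ^ 2) / p.vbar ≤ p.lamh / p.vbar * ∑ i, ‖o.h i‖ ^ 2 := by
    rw [div_mul_eq_mul_div]
    gcongr
    nlinarith [hp.one_le_lamh]
  have h5' : 0 ≤ (∑ i, ‖o.h i‖ ^ 2) / p.vbar := by positivity
  have hV0 : 0 ≤ V := by linarith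
  -- Both penalties give the same order: v‖g‖² ≤ V means (v‖g‖)² ≤ Vv, and ‖h‖²/v ≤ V means ‖h‖² ≤
  -- Vv.
  have hs : ∀ a : ℝ, 0 ≤ a → a ^ 2 ≤ V * p.vbar → a ≤ √V * √p.vbar := fun a ha h => by
    rw [← Real.sqrt_mul hV0]
    exact Real.le_sqrt_of_sq_le h
  refine ⟨hV0, hs _ (by positivity) ?_, fun i => hs _ (norm_nonneg _) ?_, fun q hq => ?_⟩
  · have : p.vbar * ‖o.g‖ ^ 2 ≤ V := by linarith
    nlinarith
  · have h6 : ‖o.h i‖ ^ 2 ≤ ∑ i, ‖o.h i‖ ^ 2 :=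
      Finset.single_le_sum (f := fun i => ‖o.h i‖ ^ 2) (fun _ _ => by positivity)
        (Finset.mem_univ i)
    have h7 : (∑ i, ‖o.h i‖ ^ 2) / p.vbar ≤ V := by linarith
    rw [div_le_iff₀ hv] at h7
    linarith
  · have h6 := Finset.single_le_sum (fun q _ => h1 q) (Finset.mem_univ (⟨q, hq⟩ : Fin L))
    have h7 := quadForm_nonneg hR₂ (o.ybar ⟨q + η, by omega⟩)
    simp only at h6
    linarith

/-- The data model behind a solution of bounded cost agrees with the plant up to
the square root of the noise level. -/
theorem exists_model_error (S : LTISystem nx nu ny) (hR₁ : R₁.PosDef) (hR₂ : R₂.PosDef)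
    (hη : (S.obsMatrix η).rank = nx) (U : Set (RVec nu)) (us : ℕ → RVec nu) (x₀ : RVec nx)
    (hc : 0 ≤ c) (V : ℝ) :
    ∃ C : ℝ, 1 ≤ C ∧ ∀ (p : MPCProblem nu ny N L η) (z : EuclideanSpace ℝ (AugIdx nu ny η))
      (o : MPCVars nu ny N L η), p.Admissible S R₁ R₂ U us x₀ c → p.IsFeasible z o →
      p.cost o ≤ V →
      (∀ (i : ℕ) (hi : i < L + η),
        ‖o.ybar ⟨i, hi⟩ - S.output i (S.dataComb x₀ us _ o.g)‖ ≤ C * √p.vbar) ∧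
      ‖S.state L (S.dataComb x₀ us _ o.g)‖ ≤ C * √p.vbar ∧
      ∀ X V Y W n, S.IsWindow z p.vbar X V Y W n →
        ‖(S.dataComb x₀ us _ o.g).1 - X 0‖ ≤ C * √p.vbar ∧
        ‖X η - S.state η (S.dataComb x₀ us _ o.g)‖ ≤ C * √p.vbar := by
  obtain ⟨Co, hCo, hobs⟩ := S.exists_observability_bound hη
  obtain ⟨Cp, hCp, hpert⟩ := S.exists_perturbation_bound η
  set C₁ := √V * (1 + (N + 1) * c) with hC₁
  have hC₁0 : 0 ≤ C₁ := by positivity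
  set C₂ := Co * (C₁ + Cp + 1) with hC₂
  have h12 : C₁ + Cp + 1 ≤ C₂ := le_mul_of_one_le_left (by positivity) hCo
  have h23 : C₂ ≤ Cp * C₂ := le_mul_of_one_le_left (by positivity) hCp
  refine ⟨Cp * C₂, by linarith, fun p z o hp ho hV => ?_⟩
  obtain ⟨hV0, hg, hh, -⟩ := hp.cost_bounds hR₁ hR₂ hV
  set ε := √p.vbar with hε
  have hε0 : 0 ≤ ε := Real.sqrt_nonneg _
  have hvε : p.vbar ≤ ε := hp.vbar_le_sqrt
  set d := S.dataComb x₀ us _ o.g with hd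
  have hy : ∀ (i : ℕ) (hi : i < L + η), ‖o.ybar ⟨i, hi⟩ - S.output i d‖ ≤ C₁ * ε := by
    intro i hi
    have h1 := ho.ybar_add_h ⟨i, hi⟩
    have h2 := hp.data_error o.g hi
    have h3 : o.ybar ⟨i, hi⟩ - S.output i d =
        (∑ j : Fin (N + 1 - (L + η)), o.g j • p.ys (i + j) - S.output i d) - o.h ⟨i, hi⟩ := by
      rw [← h1]; abel
    rw [h3]
    have h4 := norm_sub_le (∑ j : Fin (N + 1 - (L + η)), o.g j • p.ys (i + j) - S.output i d)
      (o.h ⟨i, hi⟩)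
    have h5 := hh ⟨i, hi⟩
    have h6 : (N + 1) * c * (p.vbar * ‖o.g‖) ≤ (N + 1) * c * (√V * ε) :=
      mul_le_mul_of_nonneg_left hg (by positivity)
    rw [hC₁]
    linarith
  refine ⟨fun i hi => (hy i hi).trans (by gcongr; linarith), ?_, ?_⟩
  -- Over the terminal η steps the computed inputs and outputs vanish, so observability applies to
  -- the window that starts at time L.
  · have h1 := hobs (S.state L d, fun j => d.2 (L + j)) (C₁ * ε) (by positivity) ?_ ?_
    · refine h1.trans ?_
      have : Co * C₁ ≤ C₂ := by rw [hC₂]; gcongr; linarith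
      have h3 : Co * C₁ * ε ≤ Cp * C₂ * ε := mul_le_mul_of_nonneg_right (by linarith) hε0
      linarith
    · intro i hi
      have h2 := (ho.terminal ⟨L + i, by omega⟩ (by simp)).1
      rw [ho.ubar_eq hp] at h2
      simp only at h2
      rw [h2]; simp; positivity
    · intro i hi
      have h2 := (ho.terminal ⟨L + i, by omega⟩ (by simp)).2
      have h3 := hy (L + i) (by omega)
      rw [h2, zero_sub, norm_neg] at h3
      rwa [← S.output_add_time]
  · intro X V Y W n hw
    have hVd : ∀ i < η, V i = d.2 i := fun i hi => by
      have h1 := ho.ubar_eq hp ⟨i, by omega⟩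
      rw [← h1]
      ext a
      rw [ho.init_u ⟨i, hi⟩ a, hw.input]
    -- The data trajectory and the plant share their inputs on the window; their difference is, up
    -- to noise, a free motion with outputs of order ε.
    have h1 : ‖d.1 - X 0‖ ≤ C₂ * ε := by
      have h2 := (hpert X V Y W (X 0, d.2) p.vbar η le_rfl hp.vbar_pos.le hw.traj
        (by simpa using hp.vbar_pos.le)
        (fun i hi => by simpa [hVd i hi] using hp.vbar_pos.le) hw.noise).2
      have h3 := hobs (d.1 - X 0, 0) ((C₁ + Cp + 1) * ε) (by positivity)
        (fun i hi => by simp; positivity) ?_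
      · rw [hC₂]; linarith
      · intro i hi
        have h4 : (d.1 - X 0, (0 : ℕ → RVec nu)) = d - (X 0, d.2) := by ext <;> simp
        have h5 : o.ybar ⟨i, by omega⟩ = Y i + n i := by
          ext a
          rw [ho.init_y ⟨i, hi⟩ a, hw.output]; rfl
        have h6 := hy i (by omega)
        rw [h4, map_sub]
        have h7 : S.output i d - S.output i (X 0, d.2) =
            -(o.ybar ⟨i, by omega⟩ - S.output i d) + (Y i - S.output i (X 0, d.2)) + n i := by
          rw [h5]; abel
        rw [h7]
        have h8 := h2 i hi
        have h9 := hw.outNoise i hi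
        have h10 : Cp * p.vbar ≤ Cp * ε := by gcongr
        refine norm_add₃_le.trans ?_
        rw [norm_neg]
        linarith
    have hC₂0 : 0 ≤ C₂ := by positivity
    refine ⟨h1.trans (by gcongr), ?_⟩
    have h2 := (hpert X V Y W d (C₂ * ε) η le_rfl (by positivity) hw.traj
      (by rwa [norm_sub_rev]) (fun i hi => by simp [hVd i hi]; positivity)
      (fun i hi => (hw.noise i hi).trans (hvε.trans (le_mul_of_one_le_left hε0 (by linarith))))).1
      η le_rfl
    linarith

end MPCProblem

/-! ### Near-optimality of the MPC solution for the noise-free problem. -/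

/-- Quadratic forms of nearby bounded vectors are close. -/
theorem exists_quadForm_close {ι : Type} [Fintype ι] (M : Matrix ι ι ℝ) (m : ℝ) :
    ∃ C : ℝ, 0 < C ∧ ∀ v w (e : ℝ), ‖v - w‖ ≤ e → e ≤ 1 → ‖w‖ ≤ m →
      |quadForm M v - quadForm M w| ≤ C * e := by
  obtain ⟨C, hC, h⟩ := exists_quadForm_lipschitz M
  refine ⟨C * (2 * |m| + 1), by positivity, fun v w e h1 h2 h3 => (h v w).trans ?_⟩
  have h4 : ‖v‖ ≤ ‖v - w‖ + ‖w‖ := by simpa using norm_add_le (v - w) w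
  have h5 := le_abs_self m
  have h6 : ‖v‖ + ‖w‖ ≤ 2 * |m| + 1 := by linarith
  gcongr

namespace LTISystem

variable {nx nu ny : ℕ} (S : LTISystem nx nu ny)

/-- The stage cost at time `i` of the noise-free trajectory generated by `p`. -/
noncomputable def stageCost (R₁ : Matrix (Fin nu) (Fin nu) ℝ) (R₂ : Matrix (Fin ny) (Fin ny) ℝ)
    (p : RVec nx × (ℕ → RVec nu)) (i : ℕ) : ℝ :=
  quadForm R₁ (p.2 i) + quadForm R₂ (S.output i p)

/-- The cost over the horizon `L` of the noise-free trajectory generated by `p`. -/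
noncomputable def horizonCost (R₁ : Matrix (Fin nu) (Fin nu) ℝ) (R₂ : Matrix (Fin ny) (Fin ny) ℝ)
    (L : ℕ) (p : RVec nx × (ℕ → RVec nu)) : ℝ :=
  ∑ i ∈ Finset.range L, S.stageCost R₁ R₂ p i

/-- The input sequence `pred` is, up to the error `e`, an input `v` that steers the noise-free
plant from `x'` to the origin in `k` steps, where `x'` is close to `x`, and `v` is almost optimal
among such inputs of size at most `r`. -/
structure IsNearOptimal (R₁ : Matrix (Fin nu) (Fin nu) ℝ) (R₂ : Matrix (Fin ny) (Fin ny) ℝ)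
    (L : ℕ) {k : ℕ} (r e : ℝ) (pred : ℕ → RVec nu) (x x' : RVec nx) (v : Fin k → RVec nu) :
    Prop where
  null : S.state k (x', extendZero k v) = 0
  near : ‖x - x'‖ ≤ e
  input : ∀ i, ‖pred i - extendZero k v i‖ ≤ e
  opt : ∀ w : Fin k → RVec nu, S.state k (x', extendZero k w) = 0 → ‖w‖ ≤ r →
    S.horizonCost R₁ R₂ L (x', extendZero k v) ≤ S.horizonCost R₁ R₂ L (x', extendZero k w) + e

end LTISystem

namespace MPCProblem

variable {nx nu ny N L η : ℕ}
variable {S : LTISystem nx nu ny} {R₁ : Matrix (Fin nu) (Fin nu) ℝ}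
  {R₂ : Matrix (Fin ny) (Fin ny) ℝ} {U : Set (RVec nu)} {us : ℕ → RVec nu} {x₀ : RVec nx}
  {c : ℝ} {p : MPCProblem nu ny N L η} {z : EuclideanSpace ℝ (AugIdx nu ny η)}
  {o : MPCVars nu ny N L η}

/-- Variation of a solution along a combination of data windows. -/
noncomputable def _root_.MPCVars.shift (o : MPCVars nu ny N L η) (S : LTISystem nx nu ny)
    (us : ℕ → RVec nu) (x₀ : RVec nx) (ys : ℕ → RVec ny) (g : RVec (N + 1 - (L + η))) :
    MPCVars nu ny N L η where
  g := o.g + g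
  ubar i := o.ubar i + (S.dataComb x₀ us _ g).2 i
  ybar i := o.ybar i + S.output i (S.dataComb x₀ us _ g)
  h i := o.h i + (∑ j : Fin (N + 1 - (L + η)), g j • ys (i + j) -
    S.output i (S.dataComb x₀ us _ g))

/-- All equality constraints are affine, so adding a data trajectory that vanishes on the first and
the last η instants preserves them. The slack takes up the difference between recorded and
noise-free outputs. -/
theorem IsFeasible.shift (hp : p.Admissible S R₁ R₂ U us x₀ c) (ho : p.IsFeasible z o)
    {g : RVec (N + 1 - (L + η))}
    (h0 : ∀ i < η, (S.dataComb x₀ us _ g).2 i = 0 ∧ S.output i (S.dataComb x₀ us _ g) = 0)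
    (h1 : ∀ i < η, (S.dataComb x₀ us _ g).2 (L + i) = 0 ∧
      S.output (L + i) (S.dataComb x₀ us _ g) = 0)
    (hU : ∀ i : Fin (L + η), η ≤ (i : ℕ) → o.ubar i + (S.dataComb x₀ us _ g).2 i ∈ U) :
    p.IsFeasible z (o.shift S us x₀ p.ys g) where
  hankel_u i a := by
    rw [hankel_mulVec, hp.us_eq]
    have h2 := congrArg (fun v : RVec nu => v a) (ho.ubar_eq hp i)
    simp only [LTISystem.dataComb_snd] at h2
    simp [MPCVars.shift, h2, add_mul, Finset.sum_add_distrib, LTISystem.dataComb_snd]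
  hankel_y i a := by
    rw [hankel_mulVec]
    have h2 := congrArg (fun v : RVec ny => v a) (ho.ybar_add_h i)
    simp only [PiLp.add_apply, WithLp.ofLp_sum, Finset.sum_apply, PiLp.smul_apply,
      smul_eq_mul] at h2
    simp only [MPCVars.shift, PiLp.add_apply, PiLp.sub_apply, WithLp.ofLp_sum, Finset.sum_apply,
      PiLp.smul_apply, smul_eq_mul, add_mul, Finset.sum_add_distrib]
    linarith
  init_u i a := by
    simp only [MPCVars.shift, (h0 i i.2).1, add_zero]
    exact ho.init_u i a
  init_y i a := by
    simp only [MPCVars.shift, (h0 i i.2).2, add_zero]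
    exact ho.init_y i a
  terminal i hi := by
    have h2 := ho.terminal i hi
    obtain ⟨j, hj⟩ := Nat.exists_eq_add_of_le hi
    have h3 := h1 j (by omega)
    rw [← hj] at h3
    simp [MPCVars.shift, h2.1, h2.2, h3.1, h3.2]
  input_mem i hi := by
    rw [hp.U_eq]
    exact hU i hi

/-- The regularization terms change little along a combination of data windows. -/
theorem exists_penalty_shift_bound (S : LTISystem nx nu ny) (hR₁ : R₁.PosDef) (hR₂ : R₂.PosDef)
    (U : Set (RVec nu)) (us : ℕ → RVec nu) (x₀ : RVec nx) (hc : 0 ≤ c) (V G : ℝ) (hG : 0 ≤ G) :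
    ∃ C : ℝ, 1 ≤ C ∧ ∀ (p : MPCProblem nu ny N L η)
      (o : MPCVars nu ny N L η), p.Admissible S R₁ R₂ U us x₀ c → p.cost o ≤ V →
      ∀ g : RVec (N + 1 - (L + η)), ‖g‖ ≤ G →
      p.lamg * p.vbar * ‖(o.shift S us x₀ p.ys g).g‖ ^ 2 +
          p.lamh / p.vbar * ∑ i, ‖(o.shift S us x₀ p.ys g).h i‖ ^ 2 ≤
        p.lamg * p.vbar * ‖o.g‖ ^ 2 + p.lamh / p.vbar * ∑ i, ‖o.h i‖ ^ 2 + C * √p.vbar := by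
  set b := (N + 1) * c * G with hb
  have hb0 : 0 ≤ b := by positivity
  refine ⟨1 + 2 * (2 * √V * G + G ^ 2) + 2 * ((L + η) * (2 * √V * b + b ^ 2)), ?_,
    fun p o hp hV g hg => ?_⟩
  · have : 0 ≤ 2 * (2 * √V * G + G ^ 2) + 2 * ((L + η) * (2 * √V * b + b ^ 2)) := by positivity
    linarith
  obtain ⟨hV0, hog, hoh, -⟩ := hp.cost_bounds hR₁ hR₂ hV
  have hv := hp.vbar_pos
  have hlg := hp.one_le_lamg
  have hlh := hp.one_le_lamh
  set ε := √p.vbar with hε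
  have hε0 : 0 ≤ ε := Real.sqrt_nonneg _
  have hvε : p.vbar ≤ ε := hp.vbar_le_sqrt
  -- ‖`o.g`‖ may grow like 1/√v, but the cross term contains only v‖`o.g`‖, which is O(√v).
  have h1 : p.lamg * p.vbar * ‖o.g + g‖ ^ 2 ≤ p.lamg * p.vbar * ‖o.g‖ ^ 2 +
      2 * (2 * √V * G + G ^ 2) * ε := by
    have h2 := norm_add_sq_le' o.g g
    have h3 : p.vbar * (2 * ‖o.g‖ * ‖g‖ + ‖g‖ ^ 2) ≤ (2 * √V * G + G ^ 2) * ε := by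
      have h4 : (p.vbar * ‖o.g‖) * ‖g‖ ≤ (√V * ε) * G :=
        mul_le_mul hog hg (norm_nonneg _) (by positivity)
      have h5 : p.vbar * ‖g‖ ^ 2 ≤ ε * G ^ 2 := by gcongr
      linarith
    have h4 : 0 ≤ p.vbar * (2 * ‖o.g‖ * ‖g‖ + ‖g‖ ^ 2) := by positivity
    calc p.lamg * p.vbar * ‖o.g + g‖ ^ 2
        ≤ p.lamg * p.vbar * (‖o.g‖ ^ 2 + (2 * ‖o.g‖ * ‖g‖ + ‖g‖ ^ 2)) := by gcongr
      _ = p.lamg * p.vbar * ‖o.g‖ ^ 2 + p.lamg * (p.vbar * (2 * ‖o.g‖ * ‖g‖ + ‖g‖ ^ 2)) := by ring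
      _ ≤ p.lamg * p.vbar * ‖o.g‖ ^ 2 + 2 * ((2 * √V * G + G ^ 2) * ε) := by
          gcongr
          exact hp.lamg_le
      _ = _ := by ring
  -- The slack changes by O(v) and is itself O(√v), so its square changes by v · O(√v); the factor v
  -- cancels against the weight `lamh / vbar`.
  have h2 : ∀ i : Fin (L + η), ‖(o.shift S us x₀ p.ys g).h i‖ ^ 2 ≤
      ‖o.h i‖ ^ 2 + p.vbar * ((2 * √V * b + b ^ 2) * ε) := by
    intro i
    have h3 := hp.data_error g i.2
    have h4 : (N + 1) * c * (p.vbar * ‖g‖) ≤ b * p.vbar := by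
      rw [hb]
      have : (N + 1) * c * (p.vbar * ‖g‖) ≤ (N + 1) * c * (p.vbar * G) := by gcongr
      linarith
    have h5 := h3.trans h4
    refine (norm_add_sq_le' _ _).trans ?_
    gcongr
    have h6 := mul_le_mul (hoh i) h5 (norm_nonneg _) (by positivity)
    have h7 := pow_le_pow_left₀ (norm_nonneg _) h5 2
    have h8 : b ^ 2 * p.vbar * p.vbar ≤ b ^ 2 * p.vbar * ε := by gcongr
    linarith
  have h3 : p.lamh / p.vbar * ∑ i, ‖(o.shift S us x₀ p.ys g).h i‖ ^ 2 ≤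
      p.lamh / p.vbar * ∑ i, ‖o.h i‖ ^ 2 + 2 * ((L + η) * (2 * √V * b + b ^ 2)) * ε := by
    have h4 := Finset.sum_le_sum fun i (_ : i ∈ Finset.univ) => h2 i
    rw [Finset.sum_add_distrib, Finset.sum_const, Finset.card_univ, Fintype.card_fin,
      nsmul_eq_mul] at h4
    have h5 : 0 ≤ (2 * √V * b + b ^ 2) * ε := by positivity
    calc p.lamh / p.vbar * ∑ i, ‖(o.shift S us x₀ p.ys g).h i‖ ^ 2
        ≤ p.lamh / p.vbar * (∑ i, ‖o.h i‖ ^ 2 +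
            ((L + η : ℕ) : ℝ) * (p.vbar * ((2 * √V * b + b ^ 2) * ε))) := by gcongr
      _ = p.lamh / p.vbar * ∑ i, ‖o.h i‖ ^ 2 +
            p.lamh * (((L + η : ℕ) : ℝ) * ((2 * √V * b + b ^ 2) * ε)) := by
          field_simp
      _ ≤ p.lamh / p.vbar * ∑ i, ‖o.h i‖ ^ 2 +
            2 * (((L + η : ℕ) : ℝ) * ((2 * √V * b + b ^ 2) * ε)) := by
          gcongr
          exact hp.lamh_le
      _ = _ := by push_cast; ring
  have h4 : (o.shift S us x₀ p.ys g).g = o.g + g := rfl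
  rw [h4]
  linarith

end MPCProblem

namespace LTISystem

variable {nx nu ny : ℕ} (S : LTISystem nx nu ny)

/-- The final state after `k` steps as a function of the initial state and of `k` inputs. -/
noncomputable def finalState (k : ℕ) : (RVec nx × (Fin k → RVec nu)) →ₗ[ℝ] RVec nx :=
  S.state k ∘ₗ LinearMap.prodMap LinearMap.id (extendZero k)

theorem finalState_apply (k : ℕ) (x : RVec nx) (v : Fin k → RVec nu) :
    S.finalState k (x, v) = S.state k (x, extendZero k v) := rfl

/-- Data windows that start at the origin, with zero input in the first `η` steps and a prescribed
input afterwards. -/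
theorem exists_dataComb_pulse {L η k N : ℕ} {us : ℕ → RVec nu} (x₀ : RVec nx)
    (hPE : PersistentlyExciting (L + η + nx) N us) (hN : L + η + 2 * nx ≤ N + 1) :
    ∃ C : ℝ, 1 ≤ C ∧ ∀ d : Fin k → RVec nu, ∃ g : RVec (N + 1 - (L + η)), ‖g‖ ≤ C * ‖d‖ ∧
      (∀ i < η, (S.dataComb x₀ us _ g).2 i = 0 ∧ S.output i (S.dataComb x₀ us _ g) = 0) ∧
      (∀ j < L, (S.dataComb x₀ us _ g).2 (j + η) = extendZero k d j ∧
        S.output (j + η) (S.dataComb x₀ us _ g) = S.output j (0, extendZero k d)) := by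
  obtain ⟨C, hC, h⟩ := S.exists_dataComb x₀ hPE hN
  refine ⟨C, hC, fun d => ?_⟩
  obtain ⟨g, h1, h2, h3⟩ := h 0 (Submodule.zero_mem _)
    (fun i => if i < η then 0 else extendZero k d (i - η)) ‖d‖ (norm_nonneg _) (by simp)
    (fun i _ => by
      split_ifs
      · simp
      · exact norm_extendZero_le d _)
  have h4 : ∀ i < η, (S.dataComb x₀ us _ g).2 i = 0 := fun i hi => by
    by_cases hL : i < L + η
    · rw [h2 i hL, if_pos hi]
    · omega
  have h5 : ∀ j < L, (S.dataComb x₀ us _ g).2 (j + η) = extendZero k d j := fun j hj => by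
    rw [h2 _ (by omega), if_neg (by omega), Nat.add_sub_cancel]
  refine ⟨g, h3, fun i hi => ⟨h4 i hi, S.output_eq_zero h1 fun j hj => h4 j (by omega)⟩,
    fun j hj => ⟨h5 j hj, ?_⟩⟩
  rw [add_comm j, S.output_add_time]
  refine S.output_congr (S.state_eq_zero h1 fun j hj => h4 j (by omega)) fun i hi => ?_
  simpa [add_comm] using h5 i (by omega)

end LTISystem

namespace MPCProblem

variable {nx nu ny N L η : ℕ}
variable {S : LTISystem nx nu ny} {R₁ : Matrix (Fin nu) (Fin nu) ℝ}
  {R₂ : Matrix (Fin ny) (Fin ny) ℝ} {U : Set (RVec nu)} {us : ℕ → RVec nu} {x₀ : RVec nx}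
  {c : ℝ} {p : MPCProblem nu ny N L η} {z : EuclideanSpace ℝ (AugIdx nu ny η)}
  {o : MPCVars nu ny N L η}

/-- A solution of bounded cost is close to a noise-free trajectory that is steered to the
origin. -/
theorem exists_near_null (S : LTISystem nx nu ny) (hR₁ : R₁.PosDef) (hR₂ : R₂.PosDef)
    (hη : (S.obsMatrix η).rank = nx) (U : Set (RVec nu)) (us : ℕ → RVec nu) (x₀ : RVec nx)
    (hc : 0 ≤ c) {k : ℕ} (hk : k + η = L) (V : ℝ) :
    ∃ C : ℝ, 1 ≤ C ∧ ∀ (p : MPCProblem nu ny N L η) (z : EuclideanSpace ℝ (AugIdx nu ny η))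
      (o : MPCVars nu ny N L η), p.Admissible S R₁ R₂ U us x₀ c → p.IsFeasible z o →
      p.cost o ≤ V → ∀ X Vu Y W n, S.IsWindow z p.vbar X Vu Y W n →
      ∃ x' : RVec nx, ∃ v : Fin k → RVec nu, S.state k (x', extendZero k v) = 0 ∧
        ‖X η - x'‖ ≤ C * √p.vbar ∧
        (∀ (j : ℕ) (hj : j < L), ‖o.ubar ⟨j + η, by omega⟩ - extendZero k v j‖ ≤ C * √p.vbar ∧
          ‖o.ybar ⟨j + η, by omega⟩ - S.output j (x', extendZero k v)‖ ≤ C * √p.vbar) := by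
  obtain ⟨Cm, hCm, hmodel⟩ := exists_model_error (N := N) (L := L) S hR₁ hR₂ hη U us x₀ hc V
  obtain ⟨Ck, hCk, hker⟩ := (S.finalState k).exists_near_ker
  obtain ⟨Cs, hCs, hsb⟩ := S.exists_state_bound L
  have ha1 : 0 ≤ Ck * Cm := by positivity
  have ha2 : 0 ≤ Cs * (Ck * Cm) := by positivity
  refine ⟨Cm + Ck * Cm + Cs * (Ck * Cm), by linarith, fun p z o hp ho hV X Vu Y W n hw => ?_⟩
  obtain ⟨hy, hL, hX⟩ := hmodel p z o hp ho hV
  obtain ⟨-, hXη⟩ := hX X Vu Y W n hw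
  set ε := √p.vbar with hε
  have hε0 : 0 ≤ ε := Real.sqrt_nonneg _
  set d := S.dataComb x₀ us _ o.g with hd
  have hu (i : ℕ) (hi : i < L + η) : o.ubar ⟨i, hi⟩ = d.2 i := ho.ubar_eq hp ⟨i, hi⟩
  set xs := S.state η d with hxs
  -- The final state of this trajectory is O(ε), so a point at distance O(ε) lies in the kernel of
  -- the final-state map and reaches the origin exactly.
  obtain ⟨⟨x', v⟩, h0, hnear⟩ := hker (xs, fun j : Fin k => d.2 (j + η))
  have hfin : S.finalState k (xs, fun j : Fin k => d.2 (j + η)) = S.state L d := by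
    rw [LTISystem.finalState_apply, ← hk, add_comm k, S.state_add_time]
    refine S.state_congr (p := (xs, extendZero k fun j : Fin k => d.2 (j + η)))
      (q := (S.state η d, fun j => d.2 (η + j))) rfl fun i hi => ?_
    simp [extendZero_of_lt _ hi, add_comm]
  rw [hfin] at hnear
  have he : ‖(xs, fun j : Fin k => d.2 (j + η)) - (x', v)‖ ≤ Ck * Cm * ε := by
    refine hnear.trans ?_
    rw [mul_assoc]
    gcongr
  have he1 : ‖xs - x'‖ ≤ Ck * Cm * ε := (norm_fst_le _).trans he
  have he2 : ‖(fun j : Fin k => d.2 (j + η)) - v‖ ≤ Ck * Cm * ε := (norm_snd_le _).trans he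
  have hin (j : ℕ) (hj : j < L) : ‖d.2 (j + η) - extendZero k v j‖ ≤ Ck * Cm * ε := by
    rcases lt_or_ge j k with h | h
    · rw [extendZero_of_lt _ h]
      exact (norm_le_pi_norm ((fun j : Fin k => d.2 (j + η)) - v) ⟨j, h⟩).trans he2
    · rw [extendZero_of_le _ h, ← hu _ (by omega), (ho.terminal ⟨j + η, _⟩ (by simp; omega)).1]
      simp; positivity
  have hb1 : 0 ≤ Cm * ε := by positivity
  have hb2 : 0 ≤ Ck * Cm * ε := by positivity
  have hb3 : 0 ≤ Cs * (Ck * Cm) * ε := by positivity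
  refine ⟨x', v, h0, ?_, fun j hj => ⟨?_, ?_⟩⟩
  · have := norm_sub_le_norm_sub_add_norm_sub (X η) xs x'
    linarith
  · rw [hu]
    have := hin j hj
    linarith
  · have h1 := hy (j + η) (by omega)
    have h2 : S.output (j + η) d = S.output j (xs, fun i => d.2 (i + η)) := by
      rw [add_comm, S.output_add_time]
      simp only [add_comm, hxs]
    have h3 := (hsb ((xs, fun i => d.2 (i + η)) - (x', extendZero k v)) (Ck * Cm * ε) L le_rfl
      (by positivity) he1 (fun t ht => hin t ht)).2 j hj
    rw [map_sub, ← h2] at h3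
    have := norm_sub_le_norm_sub_add_norm_sub (o.ybar ⟨j + η, by omega⟩) (S.output (j + η) d)
      (S.output j (x', extendZero k v))
    linarith

/-- An optimal solution of bounded cost yields an almost optimal noise-free control. -/
theorem exists_isNearOptimal (S : LTISystem nx nu ny) (hR₁ : R₁.PosDef) (hR₂ : R₂.PosDef)
    (hη : (S.obsMatrix η).rank = nx) {U : Set (RVec nu)} {us : ℕ → RVec nu} (x₀ : RVec nx)
    (hc : 0 ≤ c) {k : ℕ} (hk : k + η = L)
    (hPE : PersistentlyExciting (L + η + nx) N us) (hN : L + η + 2 * nx ≤ N + 1)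
    {r : ℝ} (hr1 : r ≤ 1) (hU : Metric.closedBall 0 (2 * r) ⊆ U) (V : ℝ) :
    ∃ C : ℝ, 1 ≤ C ∧ ∀ (p : MPCProblem nu ny N L η) (z : EuclideanSpace ℝ (AugIdx nu ny η))
      (o : MPCVars nu ny N L η), p.Admissible S R₁ R₂ U us x₀ c → p.IsOptimal z o →
      p.cost o ≤ V → C * √p.vbar ≤ r → ∀ X Vu Y W n, S.IsWindow z p.vbar X Vu Y W n →
      ‖X η‖ ≤ 1 → ∃ x' : RVec nx, ∃ v : Fin k → RVec nu,
        S.IsNearOptimal R₁ R₂ L r (C * √p.vbar) o.predInput (X η) x' v := by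
  obtain ⟨Cn, hCn, hnull⟩ := exists_near_null (N := N) S hR₁ hR₂ hη U us x₀ hc hk V
  obtain ⟨Cs, hCs, hsb⟩ := S.exists_state_bound L
  obtain ⟨Cd, hCd, hdata⟩ := S.exists_dataComb_pulse (k := k) x₀ hPE hN
  obtain ⟨c₁, hc₁, hlow⟩ := exists_quadForm_lower_bound hR₁
  set m := √(V / c₁) + 3 with hm
  have hm3 : 3 ≤ m := by have := Real.sqrt_nonneg (V / c₁); linarith
  obtain ⟨Q₁, hQ₁, hq1⟩ := exists_quadForm_close R₁ m
  obtain ⟨Q₂, hQ₂, hq2⟩ := exists_quadForm_close R₂ (Cs * m)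
  obtain ⟨Cp, hCp, hpen⟩ := exists_penalty_shift_bound (N := N) (L := L) (η := η) S hR₁ hR₂ U us x₀
    hc V (Cd * (1 + m)) (by positivity)
  set Q := (Q₁ + Q₂) * Cn with hQ
  have hQ0 : 0 ≤ Q := by positivity
  refine ⟨Cn + 2 * (L * Q) + Cp, ?_, fun p z o hp hopt hV hsmall X Vu Y W n hw hX => ?_⟩
  · have : 0 ≤ 2 * (L * Q) := by positivity
    linarith
  obtain ⟨ho, hmin⟩ := hopt
  obtain ⟨x', v, h0, hnear, hio⟩ := hnull p z o hp ho hV X Vu Y W n hw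
  obtain ⟨hV0, -, -, hstage⟩ := hp.cost_bounds hR₁ hR₂ hV
  set ε := √p.vbar with hε
  have hε0 : 0 ≤ ε := Real.sqrt_nonneg _
  have hCn' : 0 ≤ Cn * ε := by positivity
  have hlq : 0 ≤ 2 * (L * Q) * ε := by positivity
  have hcp : 0 ≤ Cp * ε := by positivity
  have hexp : (Cn + 2 * (L * Q) + Cp) * ε = Cn * ε + 2 * (L * Q) * ε + Cp * ε := by ring
  have hle : Cn * ε ≤ (Cn + 2 * (L * Q) + Cp) * ε := by linarith
  have hCn1 : Cn * ε ≤ r := hle.trans hsmall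
  have hr0 : 0 ≤ r := hCn'.trans hCn1
  have hubar (j : ℕ) (hj : j < L) : ‖o.ubar ⟨j + η, by omega⟩‖ ≤ √(V / c₁) := by
    refine Real.le_sqrt_of_sq_le ?_
    rw [le_div_iff₀ hc₁, mul_comm]
    exact (hlow _).trans (hstage j hj)
  have hvm (j : ℕ) : ‖extendZero k v j‖ ≤ m := by
    rcases lt_or_ge j L with hj | hj
    · have h1 := (hio j hj).1
      have h2 := hubar j hj
      have h3 := norm_sub_norm_le (extendZero k v j) (o.ubar ⟨j + η, by omega⟩)
      rw [norm_sub_rev] at h3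
      linarith
    · rw [extendZero_of_le _ (by omega)]
      simp; linarith
  have hxm : ‖x'‖ ≤ m := by
    have h3 := norm_sub_norm_le x' (X η)
    rw [norm_sub_rev] at h3
    linarith
  have hvm' : ‖v‖ ≤ m := (pi_norm_le_iff_of_nonneg (by linarith)).2 fun j => by
    have := hvm j
    rwa [extendZero_of_lt v j.2] at this
  refine ⟨x', v, h0, hnear.trans hle, fun j => ?_, fun w hw0 hwr => ?_⟩
  · refine le_trans ?_ hle
    unfold MPCVars.predInput
    split_ifs with hj
    · exact (hio j hj).1
    · rw [extendZero_of_le _ (by omega)]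
      simpa using hCn'
  -- The difference of two null controls from the same `x'` steers the origin back to the origin, so
  -- shifting by it keeps the initial window and the terminal zeros.
  obtain ⟨g, hg, hg0, hg1⟩ := hdata (w - v)
  have hgG : ‖g‖ ≤ Cd * (1 + m) := by
    refine hg.trans ?_
    have := norm_sub_le w v
    gcongr
    linarith
  have hd0 : S.state k (0, extendZero k (w - v)) = 0 := by
    have : ((0 : RVec nx), extendZero k (w - v)) = (x', extendZero k w) - (x', extendZero k v) := by
      rw [map_sub]; ext <;> simp
    rw [this, map_sub, hw0, h0, sub_zero]
  have hU0 : (0 : RVec nu) ∈ U := hU (by simp; linarith)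
  have hfeas : p.IsFeasible z (o.shift S us x₀ p.ys g) := by
    refine ho.shift hp hg0 (fun i hi => ?_) fun i hi => ?_
    · obtain ⟨h1, h2⟩ := hg1 (k + i) (by omega)
      rw [show L + i = k + i + η by omega, h1, h2]
      exact ⟨extendZero_of_le _ (by omega),
        S.output_eq_zero_of_le hd0 (fun j hj => extendZero_of_le _ hj) (by omega)⟩
    · obtain ⟨j, hj⟩ := Nat.exists_eq_add_of_le' hi
      have hjL : j < L := by omega
      have hi' : i = ⟨j + η, by omega⟩ := Fin.ext hj
      rw [hi', (hg1 j hjL).1]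
      apply hU
      rw [mem_closedBall_zero_iff, map_sub]
      -- One radius `r` for the mismatch with `v` and one for `w`: hence the ball of radius `2 * r`
      -- inside `U`.
      have h2 : o.ubar ⟨j + η, by omega⟩ + (extendZero k w - extendZero k v) j =
          (o.ubar ⟨j + η, by omega⟩ - extendZero k v j) + extendZero k w j := by
        simp only [Pi.sub_apply]; abel
      rw [h2]
      have h3 := norm_add_le (o.ubar ⟨j + η, by omega⟩ - extendZero k v j) (extendZero k w j)
      have h4 := (hio j hjL).1
      have h5 := norm_extendZero_le w j
      linarith
  have hout (v : Fin k → RVec nu) (hv : ‖v‖ ≤ m) (j : ℕ) (hj : j < L) :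
      ‖S.output j (x', extendZero k v)‖ ≤ Cs * m :=
    (hsb (x', extendZero k v) m L le_rfl (by linarith) hxm
      (fun t _ => (norm_extendZero_le v t).trans hv)).2 j hj
  have hwm : ‖w‖ ≤ m := by linarith
  have hs1 (j : Fin L) : S.stageCost R₁ R₂ (x', extendZero k v) j ≤
      quadForm R₁ (o.ubar ⟨j + η, by omega⟩) + quadForm R₂ (o.ybar ⟨j + η, by omega⟩) + Q * ε := by
    have h1 := hq1 _ _ _ (hio j j.2).1 (hCn1.trans hr1) (hvm j)
    have h2 := hq2 _ _ _ (hio j j.2).2 (hCn1.trans hr1) (hout v hvm' j j.2)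
    rw [abs_le] at h1 h2
    simp only [LTISystem.stageCost]
    have : Q * ε = Q₁ * (Cn * ε) + Q₂ * (Cn * ε) := by rw [hQ]; ring
    linarith [h1.1, h2.1]
  have hs2 (j : Fin L) : quadForm R₁ ((o.shift S us x₀ p.ys g).ubar ⟨j + η, by omega⟩) +
      quadForm R₂ ((o.shift S us x₀ p.ys g).ybar ⟨j + η, by omega⟩) ≤
      S.stageCost R₁ R₂ (x', extendZero k w) j + Q * ε := by
    -- The shifted point differs from the `w`-trajectory exactly as `o` differs from the
    -- `v`-trajectory, so the same closeness bounds apply.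
    have e1 : (o.shift S us x₀ p.ys g).ubar ⟨j + η, by omega⟩ - extendZero k w j =
        o.ubar ⟨j + η, by omega⟩ - extendZero k v j := by
      simp only [MPCVars.shift, (hg1 j j.2).1, map_sub, Pi.sub_apply]; abel
    have e2 : (o.shift S us x₀ p.ys g).ybar ⟨j + η, by omega⟩ -
        S.output j (x', extendZero k w) =
        o.ybar ⟨j + η, by omega⟩ - S.output j (x', extendZero k v) := by
      have : ((0 : RVec nx), extendZero k (w - v)) =
          (x', extendZero k w) - (x', extendZero k v) := by
        rw [map_sub]; ext <;> simp
      simp only [MPCVars.shift, (hg1 j j.2).2]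
      rw [this, map_sub]; abel
    have h1 := hq1 _ (extendZero k w j) _ (by rw [e1]; exact (hio j j.2).1) (hCn1.trans hr1)
      ((norm_extendZero_le w j).trans hwm)
    have h2 := hq2 _ (S.output j (x', extendZero k w)) _ (by rw [e2]; exact (hio j j.2).2)
      (hCn1.trans hr1) (hout w hwm j j.2)
    rw [abs_le] at h1 h2
    simp only [LTISystem.stageCost]
    have : Q * ε = Q₁ * (Cn * ε) + Q₂ * (Cn * ε) := by rw [hQ]; ring
    linarith [h1.2, h2.2]
  have hs1' := Finset.sum_le_sum fun j (_ : j ∈ Finset.univ) => hs1 j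
  have hs2' := Finset.sum_le_sum fun j (_ : j ∈ Finset.univ) => hs2 j
  rw [Finset.sum_add_distrib (g := fun _ => Q * ε), Finset.sum_const, Finset.card_univ,
    Fintype.card_fin, nsmul_eq_mul] at hs1' hs2'
  have hcost := hmin _ hfeas
  have hpen' := hpen p o hp hV g hgG
  unfold cost at hcost
  rw [hp.R₁_eq, hp.R₂_eq] at hcost
  unfold LTISystem.horizonCost
  rw [Finset.sum_range, Finset.sum_range]
  linarith

end MPCProblem

/-! ### Feasible points of bounded cost, and what a bounded cost implies. -/

namespace LTISystem

variable {nx nu ny : ℕ} (S : LTISystem nx nu ny)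

/-- A null-controllable state is steered to the origin by an input bounded by the state. -/
theorem exists_bounded_null_input (k : ℕ) : ∃ C : ℝ, 1 ≤ C ∧ ∀ x : RVec nx,
    (∃ v : Fin k → RVec nu, S.state k (x, extendZero k v) = 0) →
    ∃ w : Fin k → RVec nu, S.state k (x, extendZero k w) = 0 ∧ ‖w‖ ≤ C * ‖x‖ := by
  obtain ⟨C, hC, h⟩ :=
    (S.finalState k ∘ₗ LinearMap.inr ℝ (RVec nx) (Fin k → RVec nu)).exists_bounded_preimage
  obtain ⟨C', hC', h'⟩ := (S.state k ∘ₗ LinearMap.inl ℝ (RVec nx) (ℕ → RVec nu)).exists_norm_bound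
  refine ⟨1 + C * C', by nlinarith, fun x ⟨v, hv⟩ => ?_⟩
  have hdec (w : Fin k → RVec nu) : S.state k (x, extendZero k w) =
      S.state k (x, 0) + S.state k (0, extendZero k w) := by
    rw [← map_add]; simp
  obtain ⟨w, hw1, hw2⟩ := h v
  have e1 (w : Fin k → RVec nu) : (S.finalState k ∘ₗ LinearMap.inr ℝ (RVec nx) (Fin k → RVec nu)) w
      = S.state k (0, extendZero k w) := rfl
  rw [e1] at hw1 hw2
  rw [e1] at hw1
  refine ⟨w, by rw [hdec, hw1, ← hdec, hv], hw2.trans ?_⟩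
  have h2 : S.state k (0, extendZero k v) = -S.state k (x, 0) := by
    rw [hdec] at hv
    exact eq_neg_of_add_eq_zero_right hv
  rw [h2, norm_neg]
  have h3 : ‖S.state k (x, 0)‖ ≤ C' * ‖x‖ := h' x
  have := mul_le_mul_of_nonneg_left h3 hC.le
  have := norm_nonneg x
  linarith

end LTISystem

namespace MPCProblem

variable {nx nu ny N L η : ℕ}
variable {S : LTISystem nx nu ny} {R₁ : Matrix (Fin nu) (Fin nu) ℝ}
  {R₂ : Matrix (Fin ny) (Fin ny) ℝ} {U : Set (RVec nu)} {us : ℕ → RVec nu} {x₀ : RVec nx}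
  {c : ℝ} {p : MPCProblem nu ny N L η} {z : EuclideanSpace ℝ (AugIdx nu ny η)}
  {o : MPCVars nu ny N L η}

/-- The candidate that follows the data combination `g` and absorbs all mismatch in `h`. -/
noncomputable def _root_.MPCVars.ofComb (S : LTISystem nx nu ny) (us : ℕ → RVec nu) (x₀ : RVec nx)
    (ys : ℕ → RVec ny) (zy : Fin η → RVec ny) (f : ℕ → RVec ny) (g : RVec (N + 1 - (L + η))) :
    MPCVars nu ny N L η where
  g := g
  ubar i := (S.dataComb x₀ us _ g).2 i
  ybar i := if h : (i : ℕ) < η then zy ⟨i, h⟩ else f i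
  h i := ∑ j : Fin (N + 1 - (L + η)), g j • ys (i + j) -
    (if h : (i : ℕ) < η then zy ⟨i, h⟩ else f i)

/-- The recorded outputs impose no condition, because `h` is defined as the residual of the output
equation. -/
theorem isFeasible_ofComb (S : LTISystem nx nu ny) (hp_us : p.us = us) (hp_U : p.U = U)
    (x₀ : RVec nx) {g : RVec (N + 1 - (L + η))} {zy : Fin η → RVec ny} {f : ℕ → RVec ny}
    (hL : η ≤ L)
    (hu : ∀ (i : Fin η) (a : Fin nu), (S.dataComb x₀ us _ g).2 i a = z (Sum.inl (i, a)))
    (hy : ∀ (i : Fin η) (a : Fin ny), zy i a = z (Sum.inr (i, a)))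
    (hT : ∀ i < η, (S.dataComb x₀ us _ g).2 (L + i) = 0 ∧ f (L + i) = 0)
    (hU : ∀ j < L, (S.dataComb x₀ us _ g).2 (j + η) ∈ U) :
    p.IsFeasible z (MPCVars.ofComb S us x₀ p.ys zy f g) where
  hankel_u i a := by
    rw [hankel_mulVec, hp_us]
    simp only [MPCVars.ofComb, LTISystem.dataComb_snd]
  hankel_y i a := by
    rw [hankel_mulVec]
    simp only [MPCVars.ofComb, PiLp.sub_apply]
    ring
  init_u i a := hu i a
  init_y i a := by
    simp only [MPCVars.ofComb, i.2, dite_true]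
    exact hy i a
  terminal i hi := by
    obtain ⟨j, hj⟩ := Nat.exists_eq_add_of_le hi
    have h3 := hT j (by omega)
    rw [← hj] at h3
    refine ⟨h3.1, ?_⟩
    simp only [MPCVars.ofComb]
    rw [dif_neg (by omega), h3.2]
  input_mem i hi := by
    obtain ⟨j, hj⟩ := Nat.exists_eq_add_of_le' hi
    rw [hp_U]
    simp only [MPCVars.ofComb, hj]
    exact hU j (by omega)

/-- The slack variable makes the MPC problem feasible for every initial window. -/
theorem feasible_of_exists_dataComb (S : LTISystem nx nu ny) (hp_us : p.us = us) (hp_U : p.U = U)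
    (hU0 : (0 : RVec nu) ∈ U) (hL : η ≤ L) (x₀ : RVec nx)
    (h : ∀ v : ℕ → RVec nu, ∃ g : RVec (N + 1 - (L + η)), ∀ i < L + η,
      (S.dataComb x₀ us _ g).2 i = v i)
    (z : EuclideanSpace ℝ (AugIdx nu ny η)) : p.Feasible z := by
  obtain ⟨g, hg⟩ := h (extendZero η fun i => WithLp.toLp 2 fun a => z (Sum.inl (i, a)))
  refine ⟨_, isFeasible_ofComb (g := g) (zy := fun i => WithLp.toLp 2 fun a => z (Sum.inr (i, a)))
    (f := 0) S hp_us hp_U x₀ hL ?_ (fun i a => rfl) ?_ ?_⟩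
  · intro i a
    rw [hg i (by omega), extendZero_of_lt _ i.2]
  · intro i hi
    rw [hg _ (by omega), extendZero_of_le _ (by omega)]
    exact ⟨rfl, rfl⟩
  · intro j hj
    rwa [hg _ (by omega), extendZero_of_le _ (by omega)]

/-- If the state is small and the initial state of the window is close to a null-controllable state
in the orbit of the offline experiment, then the MPC problem has a solution of bounded cost. -/
theorem exists_feasible_of_near (S : LTISystem nx nu ny) (R₁ : Matrix (Fin nu) (Fin nu) ℝ)
    (R₂ : Matrix (Fin ny) (Fin ny) ℝ) {U : Set (RVec nu)} {us : ℕ → RVec nu} (x₀ : RVec nx)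
    (hc : 0 ≤ c) {k : ℕ} (hk : k + η = L) (hnk : nx ≤ k)
    (hPE : PersistentlyExciting (L + η + nx) N us) (hN : L + η + 2 * nx ≤ N + 1)
    {r : ℝ} (hr0 : 0 < r) (hr1 : r ≤ 1) (hU : Metric.closedBall 0 (2 * r) ⊆ U) :
    ∃ r₁ : ℝ, 0 < r₁ ∧ r₁ ≤ 1 ∧ ∀ C₁ : ℝ, 1 ≤ C₁ → ∃ V ε₀ : ℝ, 0 < ε₀ ∧
      ∀ (p : MPCProblem nu ny N L η) (z : EuclideanSpace ℝ (AugIdx nu ny η)),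
      p.Admissible S R₁ R₂ U us x₀ c → √p.vbar ≤ ε₀ →
      ∀ X Vu Y W n, S.IsWindow z p.vbar X Vu Y W n → ‖X 0‖ ≤ C₁ → (∀ i < η, ‖Vu i‖ ≤ C₁) →
      ‖X η‖ ≤ r₁ →
      ∀ m ∈ S.orbit x₀ ⊓ S.nullReach L, ‖X 0 - m‖ ≤ C₁ * √p.vbar →
      ∃ o, p.IsFeasible z o ∧ p.cost o ≤ V := by
  obtain ⟨Cn, hCn, hnull⟩ := S.exists_bounded_null_input k
  obtain ⟨Cp, hCp, hpert⟩ := S.exists_perturbation_bound η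
  obtain ⟨Cd, hCd, hdata⟩ := S.exists_dataComb x₀ hPE hN
  obtain ⟨Cs, hCs, hsb⟩ := S.exists_state_bound (L + η)
  obtain ⟨Q₁, hQ₁, hq1⟩ := exists_quadForm_upper_bound R₁
  obtain ⟨Q₂, hQ₂, hq2⟩ := exists_quadForm_upper_bound R₂
  -- At this radius the steering input has size at most `r` plus O(√v), hence at most `2 * r`. The
  -- radius does not involve `C₁`, so it can be fixed before the cost level is known.
  refine ⟨r / Cn, by positivity, (div_le_self hr0.le hCn).trans hr1, fun C₁ hC₁ => ?_⟩
  set b := 2 * C₁ + 2 with hb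
  set Ch := (N + 1) * c * (Cd * b) + Cp * C₁ + 1 with hCh
  have hb0 : 0 ≤ b := by positivity
  refine ⟨L * (Q₁ * b ^ 2 + Q₂ * (Cs * b) ^ 2) + 2 * (Cd * b) ^ 2 + 2 * ((L + η) * Ch ^ 2),
    r / (Cn * (Cp * C₁)), by positivity, ?_⟩
  intro p z hp hε₀ X Vu Y W n hw hX0 hVu hXη m hm hXm
  set ε := √p.vbar with hε
  have hε0 : 0 ≤ ε := Real.sqrt_nonneg _
  have hvε : p.vbar ≤ ε := hp.vbar_le_sqrt
  have hε1 : ε ≤ 1 := hp.sqrt_le_one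
  have hvC : p.vbar ≤ C₁ * ε := hvε.trans (le_mul_of_one_le_left hε0 hC₁)
  obtain ⟨hst, hou⟩ := hpert X Vu Y W (m, Vu) (C₁ * ε) η le_rfl (by positivity) hw.traj hXm
    (fun t _ => by simp; positivity) (fun t ht => (hw.noise t ht).trans hvC)
  set xm := S.state η (m, Vu) with hxm
  have hxm1 : ‖xm‖ ≤ r / Cn + Cp * (C₁ * ε) := by
    have h1 := norm_sub_norm_le xm (X η)
    rw [norm_sub_rev] at h1
    have h2 := hst η le_rfl
    linarith
  -- After the η window steps `k = L - η` remain; modulo `reach` the inputs are invisible, so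
  -- membership of `m` in `nullReach L` passes to `xm`.
  have hmem : xm ∈ S.nullReach k := by
    have h1 := S.pow_A_mem (fun _ h => S.A_mem_reach h) (S.state_sub_pow_mem_reach η (m, Vu)) k
    rw [map_sub, ← S.A.toEuclideanLin_pow_add, hk] at h1
    have h2 := S.reach.add_mem h1 (show Matrix.toEuclideanLin (S.A ^ L) m ∈ S.reach from hm.2)
    simp only [sub_add_cancel] at h2
    exact h2
  obtain ⟨w, hw0, hwn⟩ := hnull xm (S.exists_null_input hnk hmem)
  have hwr : ‖w‖ ≤ 2 * r := by
    refine hwn.trans ?_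
    have h1 : Cn * (Cp * C₁) * ε ≤ r := by
      rwa [le_div_iff₀ (by positivity), mul_comm] at hε₀
    have h2 : Cn * (r / Cn) = r := by field_simp
    calc Cn * ‖xm‖ ≤ Cn * (r / Cn + Cp * (C₁ * ε)) := by gcongr
      _ = r + Cn * (Cp * C₁) * ε := by rw [mul_add, h2]; ring
      _ ≤ 2 * r := by linarith
  obtain ⟨g, hg1, hg2, hg3⟩ := hdata m hm.1
    (fun i => if i < η then Vu i else extendZero k w (i - η)) b hb0 (by
      have h1 := norm_sub_norm_le m (X 0)
      rw [norm_sub_rev] at h1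
      have h2 : C₁ * ε ≤ C₁ := mul_le_of_le_one_right (by linarith) hε1
      linarith) (fun i _ => by
      split_ifs with h
      · have := hVu i h; linarith
      · have := norm_extendZero_le w (i - η); linarith)
  set d := S.dataComb x₀ us _ g with hd
  have hdV (i : ℕ) (hi : i < η) : d.2 i = Vu i := by
    rw [hg2 i (by omega), if_pos hi]
  have hdw (j : ℕ) (hj : j < L) : d.2 (j + η) = extendZero k w j := by
    rw [hg2 _ (by omega), if_neg (by omega), Nat.add_sub_cancel]
  have hdb (i : ℕ) (hi : i < L + η) : ‖d.2 i‖ ≤ b := by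
    rcases lt_or_ge i η with h | h
    · rw [hdV i h]; have := hVu i h; linarith
    · obtain ⟨j, rfl⟩ := Nat.exists_eq_add_of_le' h
      rw [hdw j (by omega)]
      have := norm_extendZero_le w j; linarith
  have hd1 : ‖d.1‖ ≤ b := by
    rw [hg1]
    have h1 := norm_sub_norm_le m (X 0)
    rw [norm_sub_rev] at h1
    have h2 : C₁ * ε ≤ C₁ := mul_le_of_le_one_right (by linarith) hε1
    linarith
  have hdout := (hsb d b (L + η) le_rfl hb0 hd1 hdb).2
  have hstη : S.state η d = xm :=
    S.state_congr (q := (m, Vu)) hg1 hdV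
  have hout (i : ℕ) (hi : i < η) : S.output i d = S.output i (m, Vu) :=
    S.output_congr (q := (m, Vu)) hg1 fun j hj => hdV j (by omega)
  have houtw (j : ℕ) (hj : j < L) : S.output (j + η) d = S.output j (xm, extendZero k w) := by
    rw [add_comm j, S.output_add_time, hstη]
    refine S.output_congr (p := (xm, fun i => d.2 (η + i))) (q := (xm, extendZero k w)) rfl
      fun i hi => ?_
    have := hdw i (by omega)
    rwa [add_comm] at this
  set o : MPCVars nu ny N L η := MPCVars.ofComb S us x₀ p.ys (fun i => Y i + n i)
    (fun i => S.output i d) g with ho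
  have hfeas : p.IsFeasible z o := by
    refine isFeasible_ofComb S hp.us_eq hp.U_eq x₀ (by omega) ?_ ?_ ?_ ?_
    · intro i a
      rw [← hd, hdV i i.2, hw.input]
    · intro i a
      rw [hw.output]; rfl
    · intro i hi
      rw [← hd, show L + i = k + i + η by omega, hdw _ (by omega), houtw _ (by omega)]
      exact ⟨extendZero_of_le _ (by omega),
        S.output_eq_zero_of_le hw0 (fun j hj => extendZero_of_le _ hj) (by omega)⟩
    · intro j hj
      rw [← hd, hdw j hj]
      apply hU
      rw [mem_closedBall_zero_iff]
      exact (norm_extendZero_le w j).trans hwr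
  refine ⟨o, hfeas, ?_⟩
  -- On the window `h` contains the distance of `X 0` from `m`, of order √v and not v. This is still
  -- affordable, since the penalty divides ‖h‖² by v.
  have hhb (i : Fin (L + η)) : ‖o.h i‖ ≤ Ch * ε := by
    have h1 := hp.data_error g i.2
    rw [← hd] at h1
    have h2 : (N + 1) * c * (p.vbar * ‖g‖) ≤ (N + 1) * c * (Cd * b) * ε := by
      have : (N + 1) * c * (p.vbar * ‖g‖) ≤ (N + 1) * c * (ε * (Cd * b)) := by gcongr
      linarith
    have h3 : Ch * ε = (N + 1) * c * (Cd * b) * ε + Cp * (C₁ * ε) + ε := by rw [hCh]; ring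
    have h4 : 0 ≤ Cp * (C₁ * ε) := by positivity
    rcases lt_or_ge (i : ℕ) η with hi | hi
    · have e1 : o.h i = (∑ j : Fin (N + 1 - (L + η)), g j • p.ys (i + j) - S.output i d) -
          (Y i - S.output i (m, Vu)) - n i := by
        simp only [ho, MPCVars.ofComb, hi, dite_true, hout i hi]; abel
      rw [e1]
      have h5 := hou i hi
      have h6 := hw.outNoise i hi
      have h7 := norm_sub_le (∑ j : Fin (N + 1 - (L + η)), g j • p.ys (i + j) - S.output i d -
          (Y i - S.output i (m, Vu))) (n i)
      have h8 := norm_sub_le (∑ j : Fin (N + 1 - (L + η)), g j • p.ys (i + j) - S.output i d)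
          (Y i - S.output i (m, Vu))
      linarith
    · have e1 : o.h i = ∑ j : Fin (N + 1 - (L + η)), g j • p.ys (i + j) - S.output i d := by
        simp only [ho, MPCVars.ofComb, dif_neg (not_lt.mpr hi)]
      rw [e1]
      linarith
  have hst' (q : Fin L) : quadForm R₁ (o.ubar ⟨q + η, by omega⟩) +
      quadForm R₂ (o.ybar ⟨q + η, by omega⟩) ≤ Q₁ * b ^ 2 + Q₂ * (Cs * b) ^ 2 := by
    have e1 : o.ubar ⟨q + η, by omega⟩ = d.2 (q + η) := rfl
    have e2 : o.ybar ⟨q + η, by omega⟩ = S.output (q + η) d := by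
      simp only [ho, MPCVars.ofComb]
      rw [dif_neg (by omega)]
    rw [e1, e2]
    have h1 := hdb (q + η) (by omega)
    have h2 := hdout (q + η) (by omega)
    refine add_le_add ((hq1 _).trans ?_) ((hq2 _).trans ?_) <;> gcongr
  have hst'' := Finset.sum_le_sum fun q (_ : q ∈ Finset.univ) => hst' q
  rw [Finset.sum_const, Finset.card_univ, Fintype.card_fin, nsmul_eq_mul] at hst''
  have hg : p.lamg * p.vbar * ‖o.g‖ ^ 2 ≤ 2 * (Cd * b) ^ 2 := by
    have h1 : ‖o.g‖ ^ 2 ≤ (Cd * b) ^ 2 := pow_le_pow_left₀ (norm_nonneg _) hg3 2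
    have h2 : p.lamg * p.vbar ≤ 2 * 1 :=
      mul_le_mul hp.lamg_le hp.vbar_le hp.vbar_pos.le (by norm_num)
    have h3 := mul_le_mul h2 h1 (by positivity) (by norm_num)
    linarith
  have hh : p.lamh / p.vbar * ∑ i, ‖o.h i‖ ^ 2 ≤ 2 * ((L + η) * Ch ^ 2) := by
    have h1 : ∀ i ∈ Finset.univ, ‖o.h i‖ ^ 2 ≤ Ch ^ 2 * p.vbar := fun i _ => by
      have := pow_le_pow_left₀ (norm_nonneg _) (hhb i) 2
      rwa [mul_pow, hε, Real.sq_sqrt hp.vbar_pos.le] at this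
    have h2 := Finset.sum_le_sum h1
    rw [Finset.sum_const, Finset.card_univ, Fintype.card_fin, nsmul_eq_mul] at h2
    have hv := hp.vbar_pos
    have hlh := hp.one_le_lamh
    calc p.lamh / p.vbar * ∑ i, ‖o.h i‖ ^ 2
        ≤ p.lamh / p.vbar * (((L + η : ℕ) : ℝ) * (Ch ^ 2 * p.vbar)) := by gcongr
      _ = p.lamh * (((L + η : ℕ) : ℝ) * Ch ^ 2) := by field_simp
      _ ≤ 2 * (((L + η : ℕ) : ℝ) * Ch ^ 2) := by gcongr; exact hp.lamh_le
      _ = _ := by push_cast; ring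
  unfold cost
  rw [hp.R₁_eq, hp.R₂_eq]
  linarith

/-- A bounded cost forces the initial state of the window to be close to a null-controllable state
in the orbit of the offline experiment. -/
theorem exists_near_orbit_inf_nullReach (S : LTISystem nx nu ny) (hR₁ : R₁.PosDef)
    (hR₂ : R₂.PosDef) (hη : (S.obsMatrix η).rank = nx) (U : Set (RVec nu)) (us : ℕ → RVec nu)
    (x₀ : RVec nx) (hc : 0 ≤ c) (V : ℝ) :
    ∃ C : ℝ, 1 ≤ C ∧ ∀ (p : MPCProblem nu ny N L η) (z : EuclideanSpace ℝ (AugIdx nu ny η))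
      (o : MPCVars nu ny N L η), p.Admissible S R₁ R₂ U us x₀ c → p.IsFeasible z o →
      p.cost o ≤ V → ∀ X Vu Y W n, S.IsWindow z p.vbar X Vu Y W n →
      ∃ m ∈ S.orbit x₀ ⊓ S.nullReach L, ‖X 0 - m‖ ≤ C * √p.vbar := by
  obtain ⟨Cm, hCm, hmodel⟩ := exists_model_error (N := N) (L := L) S hR₁ hR₂ hη U us x₀ hc V
  obtain ⟨Ck, hCk, hker⟩ := (S.finalState L ∘ₗ LinearMap.prodMap (S.orbit x₀).subtype
    (LinearMap.id (M := Fin L → RVec nu))).exists_near_ker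
  have h0 : 0 ≤ Ck * Cm := by positivity
  refine ⟨Cm + Ck * Cm, by linarith, fun p z o hp ho hV X Vu Y W n hw => ?_⟩
  obtain ⟨-, hL, hX⟩ := hmodel p z o hp ho hV
  obtain ⟨hX0, -⟩ := hX X Vu Y W n hw
  set d := S.dataComb x₀ us _ o.g with hd
  -- The passage to the kernel takes place inside orbit times inputs, so the corrected initial state
  -- `m` remains in the orbit.
  obtain ⟨⟨m, v⟩, hm, hnear⟩ := hker
    (⟨d.1, S.dataComb_fst_mem_orbit x₀ us _ _⟩, fun j : Fin L => d.2 j)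
  refine ⟨m, ⟨m.2, ?_⟩, ?_⟩
  · exact S.mem_nullReach_of_state_eq_zero (p := ((m : RVec nx), extendZero L v)) hm
  · have h1 : (S.finalState L ∘ₗ LinearMap.prodMap (S.orbit x₀).subtype
        (LinearMap.id (M := Fin L → RVec nu))) (⟨d.1, S.dataComb_fst_mem_orbit x₀ us _ _⟩,
          fun j : Fin L => d.2 j) = S.state L d := by
      change S.state L (d.1, extendZero L fun j : Fin L => d.2 j) = _
      exact S.state_congr (p := (d.1, extendZero L fun j : Fin L => d.2 j)) (q := d) rfl
        fun i hi => extendZero_of_lt _ hi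
    rw [h1] at hnear
    have h2 : ‖d.1 - m‖ ≤ Ck * (Cm * √p.vbar) :=
      ((norm_fst_le _).trans hnear).trans (by gcongr)
    have h3 := norm_sub_le_norm_sub_add_norm_sub (X 0) d.1 (m : RVec nx)
    rw [norm_sub_rev] at hX0
    linarith

end MPCProblem

/-! ### The noise-free horizon cost as a Lyapunov function. -/

namespace LTISystem

variable {nx nu ny : ℕ} (S : LTISystem nx nu ny)
variable {R₁ : Matrix (Fin nu) (Fin nu) ℝ} {R₂ : Matrix (Fin ny) (Fin ny) ℝ}

theorem stageCost_nonneg (hR₁ : R₁.PosDef) (hR₂ : R₂.PosDef) (p : RVec nx × (ℕ → RVec nu))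
    (i : ℕ) : 0 ≤ S.stageCost R₁ R₂ p i :=
  add_nonneg (quadForm_nonneg hR₁ _) (quadForm_nonneg hR₂ _)

theorem exists_stageCost_lower_bound (hR₁ : R₁.PosDef) (hR₂ : R₂.PosDef) :
    ∃ c : ℝ, 0 < c ∧ ∀ (p : RVec nx × (ℕ → RVec nu)) (i : ℕ),
      c * (‖p.2 i‖ ^ 2 + ‖S.output i p‖ ^ 2) ≤ S.stageCost R₁ R₂ p i := by
  obtain ⟨c₁, hc₁, h₁⟩ := exists_quadForm_lower_bound hR₁
  obtain ⟨c₂, hc₂, h₂⟩ := exists_quadForm_lower_bound hR₂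
  refine ⟨min c₁ c₂, lt_min hc₁ hc₂, fun p i => ?_⟩
  rw [mul_add]
  refine add_le_add (le_trans ?_ (h₁ _)) (le_trans ?_ (h₂ _))
  · exact mul_le_mul_of_nonneg_right (min_le_left _ _) (by positivity)
  · exact mul_le_mul_of_nonneg_right (min_le_right _ _) (by positivity)

theorem horizonCost_nonneg (hR₁ : R₁.PosDef) (hR₂ : R₂.PosDef) (L : ℕ)
    (p : RVec nx × (ℕ → RVec nu)) : 0 ≤ S.horizonCost R₁ R₂ L p :=
  Finset.sum_nonneg fun i _ => S.stageCost_nonneg hR₁ hR₂ p i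

/-- The horizon cost bounds the initial state and the input. -/
theorem exists_bound_of_horizonCost (hR₁ : R₁.PosDef) (hR₂ : R₂.PosDef) {η L k : ℕ}
    (hη : (S.obsMatrix η).rank = nx) (hk : k + η = L) :
    ∃ C : ℝ, 1 ≤ C ∧ ∀ (x : RVec nx) (v : Fin k → RVec nu),
      ‖x‖ ≤ C * √(S.horizonCost R₁ R₂ L (x, extendZero k v)) ∧
      ‖v‖ ≤ C * √(S.horizonCost R₁ R₂ L (x, extendZero k v)) := by
  obtain ⟨c, hc, hlow⟩ := S.exists_stageCost_lower_bound hR₁ hR₂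
  obtain ⟨Co, hCo, hobs⟩ := S.exists_observability_bound hη
  set a := √(1 / c) with ha
  have ha0 : 0 ≤ a := Real.sqrt_nonneg _
  refine ⟨1 + Co * a, by have : 0 ≤ Co * a := by positivity
                         linarith, fun x v => ?_⟩
  set J := S.horizonCost R₁ R₂ L (x, extendZero k v) with hJ
  have hJ0 : 0 ≤ J := S.horizonCost_nonneg hR₁ hR₂ L _
  have hs : ∀ i < L, ‖extendZero k v i‖ ≤ a * √J ∧ ‖S.output i (x, extendZero k v)‖ ≤ a * √J := by
    intro i hi
    have h1 : S.stageCost R₁ R₂ (x, extendZero k v) i ≤ J :=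
      Finset.single_le_sum (fun i _ => S.stageCost_nonneg hR₁ hR₂ (x, extendZero k v) i)
        (Finset.mem_range.mpr hi)
    have h2 := (hlow (x, extendZero k v) i).trans h1
    simp only at h2
    have h3 : ‖extendZero k v i‖ ^ 2 + ‖S.output i (x, extendZero k v)‖ ^ 2 ≤ 1 / c * J := by
      rw [one_div, inv_mul_eq_div, le_div_iff₀ hc]; linarith
    rw [ha, ← Real.sqrt_mul (by positivity)]
    constructor <;> apply Real.le_sqrt_of_sq_le <;> nlinarith [norm_nonneg (extendZero k v i),
      norm_nonneg (S.output i (x, extendZero k v))]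
  have hsJ : 0 ≤ √J := Real.sqrt_nonneg _
  have hCa : a ≤ Co * a := le_mul_of_one_le_left ha0 hCo
  constructor
  · have h1 := hobs (x, extendZero k v) (a * √J) (by positivity) (fun i hi => (hs i (by omega)).1)
      (fun i hi => (hs i (by omega)).2)
    simp only at h1
    linarith
  · refine (pi_norm_le_iff_of_nonneg (by positivity)).2 fun i => ?_
    have h1 := (hs i (by omega)).1
    rw [extendZero_of_lt v i.2] at h1
    have h2 : a * √J ≤ Co * a * √J := by gcongr
    linarith

/-- The horizon cost is quadratically bounded. -/
theorem exists_horizonCost_upper_bound (R₁ : Matrix (Fin nu) (Fin nu) ℝ)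
    (R₂ : Matrix (Fin ny) (Fin ny) ℝ) (L k : ℕ) :
    ∃ C : ℝ, 1 ≤ C ∧ ∀ (x : RVec nx) (v : Fin k → RVec nu) (m : ℝ), 0 ≤ m → ‖x‖ ≤ m → ‖v‖ ≤ m →
      S.horizonCost R₁ R₂ L (x, extendZero k v) ≤ C * m ^ 2 := by
  obtain ⟨Cs, hCs, hsb⟩ := S.exists_state_bound L
  obtain ⟨Q₁, hQ₁, hq1⟩ := exists_quadForm_upper_bound R₁
  obtain ⟨Q₂, hQ₂, hq2⟩ := exists_quadForm_upper_bound R₂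
  refine ⟨1 + L * (Q₁ + Q₂ * Cs ^ 2), by
    have : 0 ≤ L * (Q₁ + Q₂ * Cs ^ 2) := by positivity
    linarith, fun x v m hm hx hv => ?_⟩
  have h1 : ∀ i ∈ Finset.range L, S.stageCost R₁ R₂ (x, extendZero k v) i ≤
      Q₁ * m ^ 2 + Q₂ * (Cs * m) ^ 2 := fun i hi => by
    have h2 := (hsb (x, extendZero k v) m L le_rfl hm hx
      (fun t _ => (norm_extendZero_le v t).trans hv)).2 i (Finset.mem_range.mp hi)
    have h3 := (norm_extendZero_le v i).trans hv
    refine add_le_add ((hq1 _).trans ?_) ((hq2 _).trans ?_)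
    · exact mul_le_mul_of_nonneg_left (pow_le_pow_left₀ (norm_nonneg _) h3 2) hQ₁.le
    · exact mul_le_mul_of_nonneg_left (pow_le_pow_left₀ (norm_nonneg _) h2 2) hQ₂.le
  have h2 := Finset.sum_le_sum h1
  rw [Finset.sum_const, Finset.card_range, nsmul_eq_mul] at h2
  have : 0 ≤ m ^ 2 := by positivity
  unfold horizonCost
  linarith

/-- An almost optimal control has a cost that is quadratic in a small initial state. -/
theorem exists_cost_bound_of_isNearOptimal (R₁ : Matrix (Fin nu) (Fin nu) ℝ)
    (R₂ : Matrix (Fin ny) (Fin ny) ℝ) (L k : ℕ) {r : ℝ} (hr : 0 < r) :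
    ∃ C r₂ : ℝ, 1 ≤ C ∧ 0 < r₂ ∧ ∀ (e : ℝ) (pred : ℕ → RVec nu) (x x' : RVec nx)
      (v : Fin k → RVec nu), 0 ≤ e → e ≤ 1 → S.IsNearOptimal R₁ R₂ L r e pred x x' v →
      ‖x‖ ≤ r₂ → e ≤ r₂ → S.horizonCost R₁ R₂ L (x', extendZero k v) ≤ C * (‖x‖ ^ 2 + e) := by
  obtain ⟨Cn, hCn, hnull⟩ := S.exists_bounded_null_input k
  obtain ⟨Cu, hCu, hup⟩ := S.exists_horizonCost_upper_bound R₁ R₂ L k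
  refine ⟨2 * Cu * Cn ^ 2 + 1, r / (2 * Cn), by
    have : 0 ≤ 2 * Cu * Cn ^ 2 := by positivity
    linarith, by positivity, fun e pred x x' v he he1 h hx her => ?_⟩
  -- Competitor of size proportional to ‖x'‖; for small states it falls within the radius `r` of
  -- near-optimality.
  obtain ⟨w, hw0, hw⟩ := hnull x' ⟨v, h.null⟩
  have hx' : ‖x'‖ ≤ ‖x‖ + e := by
    have h1 := norm_sub_norm_le x' x
    have := h.near
    rw [norm_sub_rev] at h1
    linarith
  have hw' : ‖w‖ ≤ Cn * (‖x‖ + e) := hw.trans (by gcongr)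
  have hwr : ‖w‖ ≤ r := by
    refine hw'.trans ?_
    have : ‖x‖ + e ≤ r / (2 * Cn) + r / (2 * Cn) := add_le_add hx her
    calc Cn * (‖x‖ + e) ≤ Cn * (r / (2 * Cn) + r / (2 * Cn)) := by gcongr
      _ = r := by field_simp; ring
  have h1 := h.opt w hw0 hwr
  have h2 := hup x' w (Cn * (‖x‖ + e)) (by positivity)
    (hx'.trans (le_mul_of_one_le_left (by positivity) hCn)) hw'
  have h3 : (‖x‖ + e) ^ 2 ≤ 2 * (‖x‖ ^ 2 + e) := by nlinarith [sq_nonneg (‖x‖ - e)]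
  have h4 : Cu * (Cn * (‖x‖ + e)) ^ 2 ≤ Cu * Cn ^ 2 * (2 * (‖x‖ ^ 2 + e)) := by
    rw [mul_pow, ← mul_assoc]; gcongr
  have : 0 ≤ ‖x‖ ^ 2 := by positivity
  linarith

/-- The plant driven by an almost optimal control is bounded by the cost of that control. -/
theorem exists_bound_of_isNearOptimal (hR₁ : R₁.PosDef) (hR₂ : R₂.PosDef) {η L k : ℕ}
    (hη : (S.obsMatrix η).rank = nx) (hk : k + η = L) (r : ℝ) (T : ℕ) :
    ∃ C : ℝ, 1 ≤ C ∧ ∀ (e : ℝ) (pred : ℕ → RVec nu) (x' : RVec nx) (v : Fin k → RVec nu)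
      (X : ℕ → RVec nx) (V : ℕ → RVec nu) (Y : ℕ → RVec ny) (W : ℕ → RVec nx) (n : ℕ), n ≤ T →
      0 ≤ e → S.IsTrajectoryOn (Set.Iio n) X V Y W → (∀ t < n, ‖W t‖ ≤ e) →
      (∀ t < n, V t = pred t) → S.IsNearOptimal R₁ R₂ L r e pred (X 0) x' v →
      (∀ t ≤ n, ‖X t‖ ≤ C * (√(S.horizonCost R₁ R₂ L (x', extendZero k v)) + e)) ∧
      (∀ t < n, ‖V t‖ ≤ C * (√(S.horizonCost R₁ R₂ L (x', extendZero k v)) + e)) := by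
  obtain ⟨Cj, hCj, hj⟩ := S.exists_bound_of_horizonCost hR₁ hR₂ hη hk
  obtain ⟨Cp, hCp, hpert⟩ := S.exists_perturbation_bound T
  obtain ⟨Cs, hCs, hsb⟩ := S.exists_state_bound T
  have h0 : 0 ≤ Cs * Cj := by positivity
  refine ⟨Cp + Cs * Cj, by linarith, fun e pred x' v X V Y W n hn he htraj hW hV h => ?_⟩
  set J := S.horizonCost R₁ R₂ L (x', extendZero k v) with hJ
  have hsJ : 0 ≤ √J := Real.sqrt_nonneg _
  obtain ⟨hx', hv⟩ := hj x' v
  rw [← hJ] at hx' hv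
  have h1 := (hpert X V Y W (x', extendZero k v) e n hn he htraj h.near
    (fun t ht => by rw [hV t ht]; exact h.input t) hW).1
  have h2 := (hsb (x', extendZero k v) (Cj * √J) n hn (by positivity) hx'
    (fun t _ => (norm_extendZero_le v t).trans hv)).1
  have hp1 : 0 ≤ Cp * √J := by positivity
  have hp2 : 0 ≤ Cs * Cj * e := by positivity
  have hp3 : e ≤ Cp * e := le_mul_of_one_le_left he hCp
  have hp4 : Cj * √J ≤ Cs * (Cj * √J) := le_mul_of_one_le_left (by positivity) hCs
  constructor
  · intro t ht
    have h3 := h1 t ht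
    have h4 := h2 t ht
    have h5 := norm_le_norm_add_norm_sub (S.state t (x', extendZero k v)) (X t)
    rw [norm_sub_rev] at h5
    linarith
  · intro t ht
    have h3 := h.input t
    rw [← hV t ht] at h3
    have h4 := (norm_extendZero_le v t).trans hv
    have h5 := norm_le_norm_add_norm_sub (extendZero k v t) (V t)
    rw [norm_sub_rev] at h5
    linarith

/-- Between two consecutive optimizations the cost decreases by the energy of the trajectory. -/
theorem exists_cost_decrease (hR₁ : R₁.PosDef) (hR₂ : R₂.PosDef) {η L k : ℕ}
    (hη : (S.obsMatrix η).rank = nx) (hk : k + η = L) {r : ℝ} (hr : 0 < r) (T : ℕ) :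
    ∃ b c C e₀ : ℝ, 0 < b ∧ 0 < c ∧ 1 ≤ C ∧ 0 < e₀ ∧
    ∀ (e : ℝ) (pred pred' : ℕ → RVec nu) (x' x'' : RVec nx) (v v' : Fin k → RVec nu)
      (X : ℕ → RVec nx) (V : ℕ → RVec nu) (Y : ℕ → RVec ny) (W : ℕ → RVec nx) (n : ℕ), n ≤ T →
      0 ≤ e → e ≤ e₀ → S.IsTrajectoryOn (Set.Iio n) X V Y W → (∀ t < n, ‖W t‖ ≤ e) →
      (∀ t < n, V t = pred t) → S.IsNearOptimal R₁ R₂ L r e pred (X 0) x' v →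
      S.IsNearOptimal R₁ R₂ L r e pred' (X n) x'' v' →
      S.horizonCost R₁ R₂ L (x', extendZero k v) ≤ b →
      S.horizonCost R₁ R₂ L (x'', extendZero k v') ≤
        S.horizonCost R₁ R₂ L (x', extendZero k v) -
          c * ∑ t ∈ Finset.range n, (‖V t‖ ^ 2 + ‖Y t‖ ^ 2) + C * e := by
  obtain ⟨Cj, hCj, hj⟩ := S.exists_bound_of_horizonCost hR₁ hR₂ hη hk
  obtain ⟨Cp, hCp, hpert⟩ := S.exists_perturbation_bound T
  obtain ⟨Cs, hCs, hsb⟩ := S.exists_state_bound (T + L)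
  obtain ⟨Cn, hCn, hnull⟩ := S.exists_bounded_null_input k
  obtain ⟨c, hc, hlow⟩ := S.exists_stageCost_lower_bound hR₁ hR₂
  obtain ⟨Q₁, hQ₁, hq1⟩ := exists_quadForm_close R₁ r
  obtain ⟨Q₂, hQ₂, hq2⟩ := exists_quadForm_close R₂ (Cs * r)
  set a := Cn * (1 + Cp) with ha
  have ha1 : 1 + Cp ≤ a := le_mul_of_one_le_left (by positivity) hCn
  have hsa : a ≤ Cs * a := le_mul_of_one_le_left (by linarith) hCs
  set e₀ := min 1 (min (r / (2 * a)) (1 / (Cs * a))) with he₀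
  have hD : 0 ≤ L * ((Q₁ + Q₂) * (Cs * a)) := by positivity
  have hD2 : 0 ≤ T * (c * (1 + Cp ^ 2)) := by positivity
  -- Below the cost level `b` the control has size at most `r / 2`, which leaves `r / 2` for the
  -- correction. The factor 1/2 on `c` is lost in passing from nominal to actual energy.
  refine ⟨(r / (2 * Cj)) ^ 2, c / 2, 1 + L * ((Q₁ + Q₂) * (Cs * a)) + T * (c * (1 + Cp ^ 2)), e₀,
    by positivity, by positivity, by linarith, by positivity, ?_⟩
  intro e pred pred' x' x'' v v' X V Y W n hn he hee₀ htraj hW hV h h' hb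
  have he1 : e ≤ 1 := hee₀.trans (min_le_left _ _)
  have he2 : a * e ≤ r / 2 := by
    have := hee₀.trans ((min_le_right _ _).trans (min_le_left _ _))
    rw [le_div_iff₀ (by positivity)] at this
    linarith
  have he3 : Cs * a * e ≤ 1 := by
    have := hee₀.trans ((min_le_right _ _).trans (min_le_right _ _))
    rw [le_div_iff₀ (by positivity)] at this
    linarith
  set J := S.horizonCost R₁ R₂ L (x', extendZero k v) with hJ
  obtain ⟨hx', hv⟩ := hj x' v
  rw [← hJ] at hx' hv
  have hsJ : Cj * √J ≤ r / 2 := by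
    have h1 : √J ≤ r / (2 * Cj) := Real.sqrt_le_iff.mpr ⟨by positivity, hb⟩
    rw [le_div_iff₀ (by positivity)] at h1
    linarith
  obtain ⟨hst, hou⟩ := hpert X V Y W (x', extendZero k v) e n hn he htraj h.near
    (fun t ht => by rw [hV t ht]; exact h.input t) hW
  set xh := S.state n (x', extendZero k v) with hxh
  -- The tail of the old control, filled up with zeros. It is identically zero if `n ≥ k`, so gaps
  -- longer than the horizon need no special treatment.
  let vs : Fin k → RVec nu := fun j => extendZero k v (n + j)
  have hvs : extendZero k vs = fun j => extendZero k v (n + j) :=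
    extendZero_restrict (fun j => extendZero k v (n + j))
      fun i hi => extendZero_of_le _ (by omega)
  have hnullh : S.state k (xh, extendZero k vs) = 0 := by
    rw [hvs, hxh, ← S.state_add_time n k (x', extendZero k v)]
    exact S.state_eq_zero_of_le h.null (fun i hi => extendZero_of_le _ hi) (by omega)
  have hdist : ‖x'' - xh‖ ≤ (1 + Cp) * e := by
    have h1 := norm_sub_le_norm_sub_add_norm_sub x'' (X n) xh
    have h2 := h'.near
    rw [norm_sub_rev] at h2
    have h3 := hst n le_rfl
    linarith
  have hsplit (w w' : Fin k → RVec nu) : (x'' - xh, extendZero k (w - w')) =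
      (x'', extendZero k w) - (xh, extendZero k w') := by
    rw [map_sub]; rfl
  -- `v'` and `vs` steer `x''` and `xh` to the origin, so `x'' - xh` is null-controllable by their
  -- difference; being O(e), it admits a null input of size O(e).
  obtain ⟨wd, hwd0, hwd⟩ := hnull (x'' - xh) ⟨v' - vs, by
    rw [hsplit, map_sub, h'.null, hnullh, sub_zero]⟩
  have hwd' : ‖wd‖ ≤ a * e := by
    refine hwd.trans ?_
    rw [ha, mul_assoc]
    gcongr
  have hvsn : ‖vs‖ ≤ r / 2 := (pi_norm_le_iff_of_nonneg (by positivity)).2 fun i =>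
    (norm_extendZero_le v _).trans (hv.trans hsJ)
  have hsum : (x'', extendZero k (vs + wd)) = (xh, extendZero k vs) +
      (x'' - xh, extendZero k wd) := by
    rw [map_add]; ext <;> simp
  have hw0 : S.state k (x'', extendZero k (vs + wd)) = 0 := by
    rw [hsum, map_add, hnullh, hwd0, add_zero]
  have hopt := h'.opt (vs + wd) hw0 (by
    have := norm_add_le vs wd
    linarith)
  have hxr : ‖x'‖ ≤ r := by linarith
  have hvr : ‖v‖ ≤ r := by linarith
  have hstage : ∀ i ∈ Finset.range L, S.stageCost R₁ R₂ (x'', extendZero k (vs + wd)) i ≤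
      S.stageCost R₁ R₂ (x', extendZero k v) (n + i) + (Q₁ + Q₂) * (Cs * a * e) := by
    intro i hi
    have hi' := Finset.mem_range.mp hi
    have h1 : ‖extendZero k (vs + wd) i - extendZero k v (n + i)‖ ≤ Cs * a * e := by
      have : extendZero k (vs + wd) i - extendZero k v (n + i) = extendZero k wd i := by
        rw [map_add, hvs]; simp
      rw [this]
      refine (norm_extendZero_le wd i).trans (hwd'.trans ?_)
      gcongr
    have h2 : ‖S.output i (x'', extendZero k (vs + wd)) -
        S.output (n + i) (x', extendZero k v)‖ ≤ Cs * a * e := by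
      have h3 : S.output (n + i) (x', extendZero k v) = S.output i (xh, extendZero k vs) := by
        rw [S.output_add_time, hvs]
      rw [h3, hsum, map_add, add_sub_cancel_left, mul_assoc]
      refine (hsb (x'' - xh, extendZero k wd) (a * e) L (by omega) (by positivity) ?_
        (fun t _ => (norm_extendZero_le wd t).trans hwd')).2 i hi'
      refine hdist.trans ?_
      gcongr
    have h3 := hq1 _ _ _ h1 he3 ((norm_extendZero_le v _).trans hvr)
    have h4 := hq2 _ _ _ h2 he3 ((hsb (x', extendZero k v) r (n + L) (by omega) hr.le hxr
      (fun t _ => (norm_extendZero_le v t).trans hvr)).2 (n + i) (by omega))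
    rw [abs_le] at h3 h4
    simp only [stageCost]
    linarith [h3.2, h4.2]
  have hstage' := Finset.sum_le_sum hstage
  rw [Finset.sum_add_distrib (g := fun _ => (Q₁ + Q₂) * (Cs * a * e)), Finset.sum_const,
    Finset.card_range, nsmul_eq_mul] at hstage'
  -- The null trajectory is at rest from time `k < L` or `k = L` on, so the shifted horizon loses
  -- exactly the first `n` stage costs and gains nothing.
  have hshift : ∑ i ∈ Finset.range n, S.stageCost R₁ R₂ (x', extendZero k v) i +
      ∑ i ∈ Finset.range L, S.stageCost R₁ R₂ (x', extendZero k v) (n + i) = J := by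
    rw [← Finset.sum_range_add, add_comm n L, Finset.sum_range_add, hJ]
    unfold horizonCost
    rw [add_eq_left]
    refine Finset.sum_eq_zero fun i _ => ?_
    simp only [stageCost]
    rw [extendZero_of_le _ (by omega), S.output_eq_zero_of_le h.null
      (fun i hi => extendZero_of_le _ hi) (by omega)]
    simp [quadForm]
  have henergy : ∀ t ∈ Finset.range n, c / 2 * (‖V t‖ ^ 2 + ‖Y t‖ ^ 2) ≤
      S.stageCost R₁ R₂ (x', extendZero k v) t + c * (1 + Cp ^ 2) * e := by
    intro t ht
    have ht' := Finset.mem_range.mp ht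
    have h1 := hlow (x', extendZero k v) t
    simp only at h1
    have h2 := h.input t
    rw [← hV t ht'] at h2
    have h3 := hou t ht'
    have hsq {E : Type} [NormedAddCommGroup E] (y z : E) {d : ℝ} (hd : ‖y - z‖ ≤ d) :
        ‖y‖ ^ 2 ≤ 2 * ‖z‖ ^ 2 + 2 * d ^ 2 := by
      have h4 : ‖y‖ ≤ ‖z‖ + d := by
        have := norm_le_norm_add_norm_sub z y
        rw [norm_sub_rev] at this
        linarith
      have h5 := pow_le_pow_left₀ (norm_nonneg _) h4 2
      linarith [sq_nonneg (‖z‖ - d)]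
    have h4 := hsq _ _ h2
    have h5 := hsq _ _ h3
    have h6 : e ^ 2 ≤ e := by nlinarith
    have h7 : ‖V t‖ ^ 2 + ‖Y t‖ ^ 2 ≤ 2 * (‖extendZero k v t‖ ^ 2 +
        ‖S.output t (x', extendZero k v)‖ ^ 2) + 2 * ((1 + Cp ^ 2) * e) := by
      have : (1 + Cp ^ 2) * e ^ 2 ≤ (1 + Cp ^ 2) * e := by gcongr
      linarith
    have h8 := mul_le_mul_of_nonneg_left h7 (show 0 ≤ c / 2 by positivity)
    linarith
  have henergy' := Finset.sum_le_sum henergy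
  rw [Finset.sum_add_distrib, Finset.sum_const, Finset.card_range, nsmul_eq_mul,
    ← Finset.mul_sum] at henergy'
  have hnT : (n : ℝ) * (c * (1 + Cp ^ 2) * e) ≤ T * (c * (1 + Cp ^ 2) * e) := by gcongr
  have hcost : S.horizonCost R₁ R₂ L (x'', extendZero k (vs + wd)) =
    ∑ i ∈ Finset.range L, S.stageCost R₁ R₂ (x'', extendZero k (vs + wd)) i := rfl
  have hexp : (1 + L * ((Q₁ + Q₂) * (Cs * a)) + T * (c * (1 + Cp ^ 2))) * e =
    e + L * ((Q₁ + Q₂) * (Cs * a * e)) + T * (c * (1 + Cp ^ 2) * e) := by ring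
  linarith

end LTISystem

/-! ### From decrease between successes to exponential decay. -/

/-- Bernoulli's inequality turns a contraction by `1 - κ` every τ steps into a rate per step. -/
theorem exists_root_bound {κ : ℝ} (h0 : 0 < κ) (h1 : κ ≤ 1 / 2) {τ : ℕ} (hτ : 1 ≤ τ) :
    ∃ ρ : ℝ, 0 < ρ ∧ ρ < 1 ∧ 1 - κ ≤ ρ ^ τ := by
  have hτ1 : (1 : ℝ) ≤ τ := by exact_mod_cast hτ
  have hκτ : κ / τ ≤ κ := div_le_self h0.le hτ1
  have hκτ0 : 0 < κ / τ := by positivity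
  refine ⟨1 - κ / τ, by linarith, by linarith, ?_⟩
  have h2 := one_add_mul_le_pow (a := -(κ / τ)) (by linarith) τ
  have h3 : 1 + (τ : ℝ) * -(κ / τ) = 1 - κ := by field_simp; ring
  rw [h3, ← sub_eq_add_neg] at h2
  exact h2

theorem exists_last_success {atk : ℕ → Bool} (h0 : atk 0 = false) (t : ℕ) :
    ∃ s ≤ t, atk s = false ∧ ∀ i, s < i → i ≤ t → atk i = true := by
  induction t with
  | zero => exact ⟨0, le_rfl, h0, fun i h1 h2 => by omega⟩
  | succ t ih =>
    by_cases h : atk (t + 1) = false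
    · exact ⟨t + 1, le_rfl, h, fun i h1 h2 => by omega⟩
    · obtain ⟨s, hs, hs0, hs1⟩ := ih
      refine ⟨s, by omega, hs0, fun i h1 h2 => ?_⟩
      rcases Nat.lt_or_ge t i with h3 | h3
      · rw [show i = t + 1 by omega]; simpa using h
      · exact hs1 i h1 h3

theorem le_add_of_no_success {atk : ℕ → Bool} {T s t : ℕ}
    (hgap : ∀ t, ∃ s, t ≤ s ∧ s ≤ t + T ∧ atk s = false)
    (h : ∀ i, s < i → i ≤ t → atk i = true) : t ≤ s + T := by
  obtain ⟨s', h1, h2, h3⟩ := hgap (s + 1)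
  by_contra hcon
  have := h s' (by omega) (by omega)
  simp [h3] at this

/-- Telescoping of a decrease between consecutive successes. -/
theorem le_sub_sum_of_decrease {α : Type*} {atk : ℕ → Bool} (h0 : atk 0 = false)
    {Good : ℕ → α → Prop} {J : α → ℝ} {En : ℕ → ℝ} {c d : ℝ} (hd : 0 ≤ d) {n : ℕ}
    (hex : ∀ s < n, atk s = false → ∃ q, Good s q)
    (hstep : ∀ s₁ s q₁ q, s₁ < s → s ≤ n → atk s₁ = false → Good s₁ q₁ → Good s q →
      (∀ i, s₁ < i → i < s → atk i = true) →
      J q ≤ J q₁ - c * ∑ t ∈ Finset.Ico s₁ s, En t + d)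
    {s₁ : ℕ} {q₁ : α} (hs₁ : atk s₁ = false) (hq₁ : Good s₁ q₁) (s : ℕ) (hlt : s₁ < s)
    (hsn : s ≤ n) {q : α} (hq : Good s q) :
    J q ≤ J q₁ - c * ∑ t ∈ Finset.Ico s₁ s, En t + ((s : ℝ) - s₁) * d := by
  induction s using Nat.strong_induction_on generalizing q with
  | _ s ihs =>
  -- Recursion through the last success before `s`. Each gap costs one error `d`, generously counted
  -- once per instant.
  obtain ⟨s₂, hs₂, hs₂0, hs₂1⟩ := exists_last_success h0 (s - 1)
  have h12 : s₁ ≤ s₂ := by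
    by_contra hcon
    have := hs₂1 s₁ (by omega) (by omega)
    simp [hs₁] at this
  have hatk : ∀ i, s₂ < i → i < s → atk i = true := fun i h3 h4 => hs₂1 i h3 (by omega)
  have hcast : (1 : ℝ) ≤ (s : ℝ) - s₂ := by
    have : (s₂ : ℝ) + 1 ≤ s := by exact_mod_cast (show s₂ + 1 ≤ s by omega)
    linarith
  have hd' : d ≤ ((s : ℝ) - s₂) * d := le_mul_of_one_le_left hd hcast
  rcases Nat.eq_or_lt_of_le h12 with h3 | h3
  · subst h3
    have h4 := hstep s₁ s q₁ q hlt hsn hs₁ hq₁ hq hatk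
    linarith
  · obtain ⟨q₂, hq₂⟩ := hex s₂ (by omega) hs₂0
    have h4 := hstep s₂ s q₂ q (by omega) hsn hs₂0 hq₂ hq hatk
    have h5 := ihs s₂ (by omega) h3 (by omega) hq₂
    rw [← Finset.sum_Ico_consecutive _ h12 (show s₂ ≤ s by omega)]
    linarith

/-- The propagation step of an exponential bound: the cost decreases by the energy between
successes, and the energy over `η` steps bounds the cost. -/
theorem cost_le_of_decrease {α : Type*} {atk : ℕ → Bool} {T η n : ℕ}
    (hgap : ∀ t, ∃ s, t ≤ s ∧ s ≤ t + T ∧ atk s = false) (h0 : atk 0 = false)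
    {Good : ℕ → α → Prop} {J : α → ℝ} {En xsq : ℕ → ℝ} {c C C₁ Ce e κ ρ K₁ K₂ : ℝ}
    (he : 0 ≤ e) (hc : 0 ≤ c) (hC : 0 ≤ C) (hC₁ : 0 ≤ C₁) (hCe : 1 ≤ Ce)
    (hEn : ∀ t, 0 ≤ En t) (hκ0 : 0 < κ) (hκ1 : κ ≤ 1 / 2) (hκc : κ * (Ce * C₁) ≤ c)
    (hρ0 : 0 < ρ) (hρ1 : ρ ≤ 1) (hρτ : 1 - κ ≤ ρ ^ (η + T)) (hK₁ : 2 * C₁ ≤ K₁)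
    (hK₂ : C₁ + C * (η + T : ℕ) ≤ K₂) (hK₂' : 2 * c + C * (η + T : ℕ) ≤ κ * K₂)
    (ih : ∀ s < n, atk s = false →
      (∃ q, Good s q) ∧ ∀ q, Good s q → J q ≤ K₁ * (ρ ^ s * xsq 0) + K₂ * e)
    (hstep : ∀ s₁ s q₁ q, s₁ < s → s ≤ n → atk s₁ = false → Good s₁ q₁ → Good s q →
      (∀ i, s₁ < i → i < s → atk i = true) →
      J q ≤ J q₁ - c * ∑ t ∈ Finset.Ico s₁ s, En t + C * e)
    (hcost : ∀ s ≤ n, ∀ q, Good s q → J q ≤ C₁ * (xsq s + e))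
    (henergy : ∀ s < n, xsq s ≤ Ce * (∑ t ∈ Finset.Ico s (s + η), En t + e))
    (hη1 : 1 ≤ η) (hx0 : 0 ≤ xsq 0) (q : α) (hq : Good n q) :
    J q ≤ K₁ * (ρ ^ n * xsq 0) + K₂ * e := by
  have htele := fun {s₁ : ℕ} {q₁ : α} (hs₁ : atk s₁ = false) (hq₁ : Good s₁ q₁) (h : s₁ < n) =>
    le_sub_sum_of_decrease h0 (mul_nonneg hC he) (fun s hs h => (ih s hs h).1) hstep hs₁ hq₁ n h
      le_rfl hq
  have hK₁0 : 0 ≤ K₁ := by linarith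
  rcases le_or_gt n (η + T) with hnτ | hnτ
  · have hρn : 1 / 2 ≤ ρ ^ n := by
      have := pow_le_pow_of_le_one hρ0.le hρ1 hnτ
      linarith
    have h4 : C₁ * xsq 0 ≤ K₁ * (ρ ^ n * xsq 0) := by
      calc C₁ * xsq 0 = 2 * C₁ * (1 / 2 * xsq 0) := by ring
        _ ≤ K₁ * (ρ ^ n * xsq 0) := by gcongr
    have h6 : (C₁ + C * (η + T : ℕ)) * e ≤ K₂ * e := by gcongr
    have h7 : 0 ≤ C * (η + T : ℕ) * e := by positivity
    rcases Nat.eq_zero_or_pos n with h1 | h1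
    · have h2 := hcost n le_rfl q hq
      rw [h1] at h2 h4 ⊢
      linarith
    · obtain ⟨⟨q₁, hq₁⟩, -⟩ := ih 0 h1 h0
      have h2 := htele h0 hq₁ h1
      have h3 := hcost 0 (by omega) q₁ hq₁
      have h8 : 0 ≤ c * ∑ t ∈ Finset.Ico 0 n, En t :=
        mul_nonneg hc (Finset.sum_nonneg fun _ _ => hEn _)
      have h5 : ((n : ℝ) - (0 : ℕ)) * (C * e) ≤ (η + T : ℕ) * (C * e) := by
        have : (n : ℝ) ≤ (η + T : ℕ) := by exact_mod_cast hnτ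
        gcongr
        simpa using this
      linarith
  -- This success satisfies n - (η + T) ≤ s₁ ≤ n - η: recent enough for the rate, yet followed by
  -- the η steps that observability needs.
  · obtain ⟨s₁, h1, h2, hs₁⟩ := hgap (n - (η + T))
    obtain ⟨⟨q₁, hq₁⟩, hJ₁⟩ := ih s₁ (by omega) hs₁
    have h4 := htele hs₁ hq₁ (by omega)
    have h5 := hcost s₁ (by omega) q₁ hq₁
    have h6 := hJ₁ q₁ hq₁
    have h7 := henergy s₁ (by omega)
    have h8 : ∑ t ∈ Finset.Ico s₁ (s₁ + η), En t ≤ ∑ t ∈ Finset.Ico s₁ n, En t :=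
      Finset.sum_le_sum_of_subset_of_nonneg (Finset.Ico_subset_Ico le_rfl (by omega))
        fun _ _ _ => hEn _
    set E := ∑ t ∈ Finset.Ico s₁ n, En t with hE
    have hE0 : 0 ≤ E := Finset.sum_nonneg fun _ _ => hEn _
    -- The energy spent since `s₁` pays for the fraction κ of the cost at `s₁`, up to the error.
    have h9 : κ * J q₁ ≤ c * E + 2 * c * e := by
      have h12 : xsq s₁ + e ≤ Ce * (E + 2 * e) := by
        have h10 : xsq s₁ ≤ Ce * (E + e) := h7.trans (by gcongr)
        have : e ≤ Ce * e := le_mul_of_one_le_left he hCe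
        linarith
      calc κ * J q₁ ≤ κ * (C₁ * (Ce * (E + 2 * e))) := by
            gcongr
            exact h5.trans (by gcongr)
        _ = κ * (Ce * C₁) * (E + 2 * e) := by ring
        _ ≤ c * (E + 2 * e) := by gcongr
        _ = _ := by ring
    have h10 : ((n : ℝ) - s₁) * (C * e) ≤ (η + T : ℕ) * (C * e) := by
      have : (n : ℝ) ≤ s₁ + (η + T : ℕ) := by exact_mod_cast (show n ≤ s₁ + (η + T) by omega)
      gcongr
      linarith
    have h12 : (1 - κ) * J q₁ ≤ (1 - κ) * (K₁ * (ρ ^ s₁ * xsq 0) + K₂ * e) :=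
      mul_le_mul_of_nonneg_left h6 (by linarith)
    have h13 : (1 - κ) * ρ ^ s₁ ≤ ρ ^ n := by
      calc (1 - κ) * ρ ^ s₁ ≤ ρ ^ (η + T) * ρ ^ s₁ := by gcongr
        _ = ρ ^ (η + T + s₁) := (pow_add _ _ _).symm
        _ ≤ ρ ^ n := pow_le_pow_of_le_one hρ0.le hρ1 (by omega)
    have h14 : (1 - κ) * ρ ^ s₁ * (K₁ * xsq 0) ≤ ρ ^ n * (K₁ * xsq 0) := by gcongr
    have h15 : (2 * c + C * (η + T : ℕ)) * e ≤ κ * K₂ * e := by gcongr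
    linarith

namespace LTISystem

variable {nx nu ny : ℕ} (S : LTISystem nx nu ny)
variable {R₁ : Matrix (Fin nu) (Fin nu) ℝ} {R₂ : Matrix (Fin ny) (Fin ny) ℝ}

theorem IsTrajectoryOn.shift {S : LTISystem nx nu ny} {X : ℕ → RVec nx} {V : ℕ → RVec nu}
    {Y : ℕ → RVec ny} {W : ℕ → RVec nx} (h : S.IsTrajectoryOn Set.univ X V Y W) (s n : ℕ) :
    S.IsTrajectoryOn (Set.Iio n) (fun t => X (s + t)) (fun t => V (s + t)) (fun t => Y (s + t))
      (fun t => W (s + t)) :=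
  fun t _ => h (s + t) trivial

/-- The energy of the trajectory over an observability window bounds the initial state. -/
theorem exists_energy_bound {η : ℕ} (hη : (S.obsMatrix η).rank = nx) :
    ∃ C : ℝ, 1 ≤ C ∧ ∀ (X : ℕ → RVec nx) (V : ℕ → RVec nu) (Y : ℕ → RVec ny) (W : ℕ → RVec nx)
      (e : ℝ), 0 ≤ e → e ≤ 1 → S.IsTrajectoryOn (Set.Iio η) X V Y W → (∀ t < η, ‖W t‖ ≤ e) →
      ‖X 0‖ ^ 2 ≤ C * (∑ t ∈ Finset.range η, (‖V t‖ ^ 2 + ‖Y t‖ ^ 2) + e) := by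
  obtain ⟨Cp, hCp, hpert⟩ := S.exists_perturbation_bound η
  obtain ⟨Co, hCo, hobs⟩ := S.exists_observability_bound hη
  refine ⟨2 * Co ^ 2 * Cp ^ 2, by
    have h1 : 1 ≤ Co ^ 2 := one_le_pow₀ hCo
    have h2 : 1 ≤ Cp ^ 2 := one_le_pow₀ hCp
    nlinarith, fun X V Y W e he he1 htraj hW => ?_⟩
  set E := ∑ t ∈ Finset.range η, (‖V t‖ ^ 2 + ‖Y t‖ ^ 2) with hE
  have hnn : ∀ t ∈ Finset.range η, 0 ≤ ‖V t‖ ^ 2 + ‖Y t‖ ^ 2 := fun t _ => by positivity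
  have hE0 : 0 ≤ E := Finset.sum_nonneg hnn
  have hs : ∀ t < η, ‖V t‖ ≤ √E ∧ ‖Y t‖ ≤ √E := fun t ht => by
    have h1 := Finset.single_le_sum hnn (Finset.mem_range.mpr ht)
    constructor <;> apply Real.le_sqrt_of_sq_le <;> nlinarith [norm_nonneg (V t), norm_nonneg (Y t)]
  have hsE : 0 ≤ √E := Real.sqrt_nonneg _
  have hCpe : 0 ≤ Cp * e := by positivity
  obtain ⟨-, hou⟩ := hpert X V Y W (X 0, V) e η le_rfl he htraj (by simpa using he)
    (fun t _ => by simpa using he) hW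
  have h1 := hobs (X 0, V) (√E + Cp * e) (by positivity)
    (fun i hi => by have := (hs i hi).1; simp only; linarith) (fun i hi => by
      have h2 := (hs i hi).2
      have h3 := hou i hi
      have h4 := norm_le_norm_add_norm_sub (Y i) (S.output i (X 0, V))
      linarith)
  simp only at h1
  have h2 := pow_le_pow_left₀ (norm_nonneg _) h1 2
  have h3 : (√E + Cp * e) ^ 2 ≤ 2 * Cp ^ 2 * (E + e) := by
    have h4 : √E ^ 2 = E := Real.sq_sqrt hE0
    have h5 : 1 ≤ Cp ^ 2 := one_le_pow₀ hCp
    have h6 : Cp ^ 2 * e ^ 2 ≤ Cp ^ 2 * e := by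
      have : e ^ 2 ≤ e := by nlinarith
      gcongr
    have h7 : E ≤ Cp ^ 2 * E := le_mul_of_one_le_left hE0 h5
    nlinarith [sq_nonneg (√E - Cp * e)]
  calc ‖X 0‖ ^ 2 ≤ (Co * (√E + Cp * e)) ^ 2 := h2
    _ = Co ^ 2 * (√E + Cp * e) ^ 2 := by ring
    _ ≤ Co ^ 2 * (2 * Cp ^ 2 * (E + e)) := by gcongr
    _ = _ := by ring

set_option maxHeartbeats 1600000 in
/-- If the control is almost optimal at every successful transmission as long as the past states
and inputs are small, then the state decays exponentially, up to the error level. -/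
theorem exists_exponential_decay (hR₁ : R₁.PosDef) (hR₂ : R₂.PosDef) {η L k : ℕ}
    (hη : (S.obsMatrix η).rank = nx) (hη1 : 1 ≤ η) (hk : k + η = L) {r : ℝ} (hr : 0 < r) (T : ℕ)
    {r₁ : ℝ} (hr₁ : 0 < r₁) :
    ∃ r₀ e₀ K ρ : ℝ, 0 < r₀ ∧ 0 < e₀ ∧ 1 ≤ K ∧ 0 < ρ ∧ ρ < 1 ∧
    ∀ (e : ℝ) (atk : ℕ → Bool) (X : ℕ → RVec nx) (V : ℕ → RVec nu) (Y : ℕ → RVec ny)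
      (W : ℕ → RVec nx) (pred : ℕ → ℕ → RVec nu), 0 ≤ e → e ≤ e₀ →
      (∀ t, ∃ s, t ≤ s ∧ s ≤ t + T ∧ atk s = false) → atk 0 = false →
      S.IsTrajectoryOn Set.univ X V Y W → (∀ t, ‖W t‖ ≤ e) →
      (∀ s t, s ≤ t → atk s = false → (∀ i, s < i → i ≤ t → atk i = true) →
        V t = pred s (t - s)) →
      (∀ s, atk s = false → (∀ t ≤ s, ‖X t‖ ≤ r₁) → (∀ t < s, ‖V t‖ ≤ 1) →
        ∃ x' : RVec nx, ∃ v : Fin k → RVec nu,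
          S.IsNearOptimal R₁ R₂ L r e (pred s) (X s) x' v) →
      ‖X 0‖ ≤ r₀ → ∀ t, ‖X t‖ ^ 2 ≤ K * (ρ ^ t * ‖X 0‖ ^ 2 + e) := by
  obtain ⟨C₀, hC₀, hbound⟩ := S.exists_bound_of_isNearOptimal hR₁ hR₂ hη hk r (T + 1)
  obtain ⟨C₁, r₂, hC₁, hr₂, hcost⟩ := S.exists_cost_bound_of_isNearOptimal R₁ R₂ L k hr
  obtain ⟨b, c, C, e₁, hb, hc, hC, he₁, hdec⟩ := S.exists_cost_decrease hR₁ hR₂ hη hk hr (T + 1)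
  obtain ⟨Ce, hCe, hen⟩ := S.exists_energy_bound hη
  obtain ⟨κ, hκ0, hκ1, hκc⟩ : ∃ κ : ℝ, 0 < κ ∧ κ ≤ 1 / 2 ∧ κ * (Ce * C₁) ≤ c := by
    refine ⟨min (1 / 2) (c / (Ce * C₁)), by positivity, min_le_left _ _, ?_⟩
    have := min_le_right (1 / 2) (c / (Ce * C₁))
    rwa [le_div_iff₀ (by positivity)] at this
  obtain ⟨ρ, hρ0, hρ1, hρτ⟩ := exists_root_bound hκ0 hκ1 (show 1 ≤ η + T by omega)
  obtain ⟨K₂, hK₂1, hK₂, hK₂'⟩ : ∃ K₂ : ℝ, 1 ≤ K₂ ∧ C₁ + C * (η + T : ℕ) ≤ K₂ ∧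
      2 * c + C * (η + T : ℕ) ≤ κ * K₂ := by
    have h1 : 0 ≤ C * (η + T : ℕ) := by positivity
    have h2 : 0 ≤ (2 * c + C * (η + T : ℕ)) / κ := by positivity
    refine ⟨C₁ + C * (η + T : ℕ) + (2 * c + C * (η + T : ℕ)) / κ, by linarith, by linarith, ?_⟩
    have h3 : κ * ((2 * c + C * (η + T : ℕ)) / κ) = 2 * c + C * (η + T : ℕ) := by field_simp
    have h4 : 0 ≤ κ * (C₁ + C * (η + T : ℕ)) := by positivity
    linarith
  obtain ⟨K₁, hK₁1, hK₁⟩ : ∃ K₁ : ℝ, 1 ≤ K₁ ∧ 2 * C₁ ≤ K₁ := ⟨2 * C₁, by linarith, le_rfl⟩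
  obtain ⟨μ, hμ0, hμ1, hμ2, hμ3⟩ : ∃ μ : ℝ, 0 < μ ∧ μ ≤ r₁ ∧ μ ≤ 1 ∧ μ ≤ r₂ :=
    ⟨min r₁ (min 1 r₂), by positivity, min_le_left _ _, (min_le_right _ _).trans (min_le_left _ _),
      (min_le_right _ _).trans (min_le_right _ _)⟩
  -- The sublevel `B` of the cost keeps states and inputs below μ until the next success, and lies
  -- below the level `b` needed for the decrease.
  obtain ⟨B, hB0, hBb, hBμ⟩ : ∃ B : ℝ, 0 < B ∧ B ≤ b ∧ C₀ * √B ≤ μ / 2 := by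
    refine ⟨min b ((μ / (2 * C₀)) ^ 2), by positivity, min_le_left _ _, ?_⟩
    have h1 : √(min b ((μ / (2 * C₀)) ^ 2)) ≤ μ / (2 * C₀) :=
      Real.sqrt_le_iff.mpr ⟨by positivity, min_le_right _ _⟩
    rw [le_div_iff₀ (by positivity)] at h1
    linarith
  obtain ⟨e₀, he₀0, he₀1, he₀e, he₀μ, he₀B⟩ : ∃ e₀ : ℝ, 0 < e₀ ∧ e₀ ≤ 1 ∧ e₀ ≤ e₁ ∧
      C₀ * e₀ ≤ μ / 2 ∧ K₂ * e₀ ≤ B / 2 := by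
    refine ⟨min (min 1 e₁) (min (μ / (2 * C₀)) (B / (2 * K₂))), by positivity,
      (min_le_left _ _).trans (min_le_left _ _), (min_le_left _ _).trans (min_le_right _ _), ?_, ?_⟩
    · have h1 := (min_le_right (min 1 e₁) (min (μ / (2 * C₀)) (B / (2 * K₂)))).trans
        (min_le_left _ _)
      rw [le_div_iff₀ (by positivity)] at h1
      linarith
    · have h1 := (min_le_right (min 1 e₁) (min (μ / (2 * C₀)) (B / (2 * K₂)))).trans
        (min_le_right _ _)
      rw [le_div_iff₀ (by positivity)] at h1
      linarith
  obtain ⟨r₀, hr₀0, hr₀1, hr₀μ, hr₀B⟩ : ∃ r₀ : ℝ, 0 < r₀ ∧ r₀ ≤ 1 ∧ r₀ ≤ μ ∧ K₁ * r₀ ≤ B / 2 := by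
    refine ⟨min 1 (min μ (B / (2 * K₁))), by positivity, min_le_left _ _,
      (min_le_right _ _).trans (min_le_left _ _), ?_⟩
    have h1 := (min_le_right 1 (min μ (B / (2 * K₁)))).trans (min_le_right _ _)
    rw [le_div_iff₀ (by positivity)] at h1
    linarith
  refine ⟨r₀, e₀, 2 * C₀ ^ 2 * (K₁ / ρ ^ T + K₂ + 1), ρ, hr₀0, he₀0, ?_, hρ0, hρ1, ?_⟩
  · have h1 : 1 ≤ C₀ ^ 2 := one_le_pow₀ hC₀
    have h2 : 0 ≤ K₁ / ρ ^ T := by positivity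
    nlinarith
  intro e atk X V Y W pred he hee₀ hgap h0 htraj hW hinput hopt hX0
  have hee₁ : e ≤ e₁ := hee₀.trans he₀e
  have he1 : e ≤ 1 := hee₀.trans he₀1
  have hC₀e : C₀ * e ≤ μ / 2 := le_trans (by gcongr) he₀μ
  have hK₂e : K₂ * e ≤ B / 2 := le_trans (by gcongr) he₀B
  have her₂ : e ≤ r₂ := by
    have h1 : e ≤ C₀ * e := le_mul_of_one_le_left he hC₀
    linarith
  have hX0sq : K₁ * ‖X 0‖ ^ 2 ≤ B / 2 := by
    have h3 : ‖X 0‖ ^ 2 ≤ r₀ := by nlinarith [norm_nonneg (X 0)]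
    exact le_trans (by gcongr) hr₀B
  -- Near-optimal pairs are not unique, so the induction proves its bound for every pair that is
  -- near-optimal at a given success.
  obtain ⟨Good, hGood⟩ : ∃ Good : ℕ → RVec nx × (Fin k → RVec nu) → Prop, ∀ s q,
      Good s q ↔ S.IsNearOptimal R₁ R₂ L r e (pred s) (X s) q.1 q.2 := ⟨_, fun _ _ => Iff.rfl⟩
  obtain ⟨J, hJdef⟩ : ∃ J : RVec nx × (Fin k → RVec nu) → ℝ, ∀ q,
      J q = S.horizonCost R₁ R₂ L (q.1, extendZero k q.2) := ⟨_, fun _ => rfl⟩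
  have hJ0 (q) : 0 ≤ J q := hJdef q ▸ S.horizonCost_nonneg hR₁ hR₂ L _
  have hbdB (s : ℕ) : K₁ * (ρ ^ s * ‖X 0‖ ^ 2) + K₂ * e ≤ B := by
    have h1 : ρ ^ s * ‖X 0‖ ^ 2 ≤ ‖X 0‖ ^ 2 :=
      mul_le_of_le_one_left (by positivity) (pow_le_one₀ hρ0.le hρ1.le)
    have h2 : K₁ * (ρ ^ s * ‖X 0‖ ^ 2) ≤ K₁ * ‖X 0‖ ^ 2 := by gcongr
    linarith
  have hlocal : ∀ s q, atk s = false → Good s q → ∀ n ≤ T + 1,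
      (∀ i, s < i → i < s + n → atk i = true) →
      (∀ t ≤ n, ‖X (s + t)‖ ≤ C₀ * (√(J q) + e)) ∧
      (∀ t < n, ‖V (s + t)‖ ≤ C₀ * (√(J q) + e)) := by
    intro s q hs hq n hn hatk
    rw [hJdef]
    exact hbound e (pred s) q.1 q.2 _ _ _ _ n hn he (htraj.shift s n) (fun t _ => hW _)
      (fun t ht => by
        have := hinput s (s + t) (by omega) hs (fun i h1 h2 => hatk i h1 (by omega))
        rwa [Nat.add_sub_cancel_left] at this) ((hGood s q).1 hq)
  have hsmall : ∀ q, J q ≤ B → C₀ * (√(J q) + e) ≤ μ := by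
    intro q hq
    have h1 : C₀ * √(J q) ≤ C₀ * √B := by gcongr
    linarith
  have hmain : ∀ s, atk s = false → (∃ q, Good s q) ∧ ∀ q, Good s q →
      J q ≤ K₁ * (ρ ^ s * ‖X 0‖ ^ 2) + K₂ * e := by
    intro s
    induction s using Nat.strong_induction_on with
    | _ n ih =>
    intro hn
    -- Bootstrap: cost bounds at earlier successes keep the motion small up to time `n`, and this
    -- smallness is the premise of near-optimality at `n`.
    have hXμ : ∀ t ≤ n, ‖X t‖ ≤ μ := by
      intro t ht
      rcases Nat.eq_zero_or_pos t with rfl | htpos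
      · exact hX0.trans hr₀μ
      obtain ⟨s, hs, hs0, hs1⟩ := exists_last_success h0 (t - 1)
      obtain ⟨⟨q, hq⟩, hJ⟩ := ih s (by omega) hs0
      have hlen := le_add_of_no_success hgap hs1
      have h1 := (hlocal s q hs0 hq (t - s) (by omega) (fun i h2 h3 => hs1 i h2 (by omega))).1
        (t - s) le_rfl
      rw [Nat.add_sub_cancel' (by omega)] at h1
      exact h1.trans (hsmall q ((hJ q hq).trans (hbdB s)))
    have hVμ : ∀ t < n, ‖V t‖ ≤ μ := by
      intro t ht
      obtain ⟨s, hs, hs0, hs1⟩ := exists_last_success h0 t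
      obtain ⟨⟨q, hq⟩, hJ⟩ := ih s (by omega) hs0
      have hlen := le_add_of_no_success hgap hs1
      have h1 := (hlocal s q hs0 hq (t - s + 1) (by omega)
        (fun i h2 h3 => hs1 i h2 (by omega))).2 (t - s) (by omega)
      rw [Nat.add_sub_cancel' (by omega)] at h1
      exact h1.trans (hsmall q ((hJ q hq).trans (hbdB s)))
    have hcost' : ∀ s ≤ n, ∀ q, Good s q → J q ≤ C₁ * (‖X s‖ ^ 2 + e) := by
      intro s hs q hq
      rw [hJdef]
      exact hcost e (pred s) (X s) q.1 q.2 he he1 ((hGood s q).1 hq)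
        ((hXμ s hs).trans hμ3) her₂
    refine ⟨?_, ?_⟩
    · obtain ⟨x', v, h⟩ := hopt n hn (fun t ht => (hXμ t ht).trans hμ1)
        (fun t ht => (hVμ t ht).trans hμ2)
      exact ⟨(x', v), (hGood n (x', v)).2 h⟩
    refine cost_le_of_decrease (En := fun t => ‖V t‖ ^ 2 + ‖Y t‖ ^ 2) (xsq := fun s => ‖X s‖ ^ 2)
      (Good := Good) (J := J) hgap h0 he hc.le (by linarith) (by linarith) hCe
      (fun t => by positivity) hκ0 hκ1 hκc hρ0 hρ1.le hρτ hK₁ hK₂ hK₂' ih ?_ hcost' ?_ hη1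
      (sq_nonneg _)
    · intro s₁ s q₁ q h1 h2 hs₁ hq₁ hq hatk
      have hlen := le_add_of_no_success (t := s - 1) hgap (fun i h3 h4 => hatk i h3 (by omega))
      have hJ := ((ih s₁ (by omega) hs₁).2 q₁ hq₁).trans (hbdB s₁)
      have h3 := hdec e (pred s₁) (pred s) q₁.1 q.1 q₁.2 q.2 _ _ _ _ (s - s₁) (by omega) he hee₁
        (htraj.shift s₁ (s - s₁)) (fun t _ => hW _) (fun t ht => by
          have := hinput s₁ (s₁ + t) (by omega) hs₁ (fun i h1 h2 => hatk i h1 (by omega))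
          rwa [Nat.add_sub_cancel_left] at this) ((hGood s₁ q₁).1 hq₁)
        (by
          rw [Nat.add_sub_cancel' h1.le]
          exact (hGood s q).1 hq) (hJdef q₁ ▸ hJ.trans hBb)
      rw [Finset.sum_Ico_eq_sum_range, hJdef, hJdef]
      exact h3
    · intro s _
      have h7 := hen _ _ _ _ e he he1 (htraj.shift s η) (fun t _ => hW _)
      rw [Finset.sum_Ico_eq_sum_range, Nat.add_sub_cancel_left]
      exact h7
  intro t
  obtain ⟨s, hs, hs0, hs1⟩ := exists_last_success h0 t
  obtain ⟨⟨q, hq⟩, hJ⟩ := hmain s hs0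
  have hlen := le_add_of_no_success hgap hs1
  have h1 := (hlocal s q hs0 hq (t - s) (by omega) (fun i h2 h3 => hs1 i h2 (by omega))).1
    (t - s) le_rfl
  rw [Nat.add_sub_cancel' hs] at h1
  have h2 := pow_le_pow_left₀ (norm_nonneg _) h1 2
  have h3 : (√(J q) + e) ^ 2 ≤ 2 * (J q + e) := by
    have h4 : √(J q) ^ 2 = J q := Real.sq_sqrt (hJ0 q)
    have h5 : e ^ 2 ≤ e := by nlinarith
    nlinarith [sq_nonneg (√(J q) - e)]
  -- The last success lies at most T steps back, which loses a factor `ρ ^ T`.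
  have h4 : ρ ^ s ≤ 1 / ρ ^ T * ρ ^ t := by
    rw [div_mul_eq_mul_div, one_mul, le_div_iff₀ (by positivity), ← pow_add]
    exact pow_le_pow_of_le_one hρ0.le hρ1.le hlen
  have h5 : J q + e ≤ (K₁ / ρ ^ T + K₂ + 1) * (ρ ^ t * ‖X 0‖ ^ 2 + e) := by
    have h6 := hJ q hq
    have h7 : K₁ * (ρ ^ s * ‖X 0‖ ^ 2) ≤ K₁ * (1 / ρ ^ T * ρ ^ t * ‖X 0‖ ^ 2) := by gcongr
    have h8 : 0 ≤ K₁ / ρ ^ T * e := by positivity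
    have h9 : 0 ≤ (K₂ + 1) * (ρ ^ t * ‖X 0‖ ^ 2) := by positivity
    have h10 : K₁ * (1 / ρ ^ T * ρ ^ t * ‖X 0‖ ^ 2) = K₁ / ρ ^ T * (ρ ^ t * ‖X 0‖ ^ 2) := by ring
    linarith
  calc ‖X t‖ ^ 2 ≤ (C₀ * (√(J q) + e)) ^ 2 := h2
    _ = C₀ ^ 2 * (√(J q) + e) ^ 2 := by ring
    _ ≤ C₀ ^ 2 * (2 * ((K₁ / ρ ^ T + K₂ + 1) * (ρ ^ t * ‖X 0‖ ^ 2 + e))) := by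
        gcongr
        exact h3.trans (by gcongr)
    _ = _ := by ring

end LTISystem

/-! ### Comparison functions, attack duration and the phase before the first success. -/

theorem isClassKL_exponential {C ρ : ℝ} (hC : 0 < C) (hρ0 : 0 < ρ) (hρ1 : ρ < 1) :
    IsClassKL fun s t => C * s * ρ ^ t := by
  refine ⟨fun t _ => ⟨by fun_prop, fun a _ b _ h => ?_, by simp⟩, fun s hs => ⟨?_, ?_⟩⟩
  · have : 0 < ρ ^ t := Real.rpow_pos_of_pos hρ0 t
    simp only
    gcongr
  · intro a _ b _ h
    simp only
    gcongr C * s * ?_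
    exact Real.rpow_le_rpow_of_exponent_ge hρ0 hρ1.le h
  · simpa using (tendsto_rpow_atTop_of_base_lt_one ρ (by linarith) hρ1).const_mul (C * s)

theorem isClassKInf_sqrt_sqrt {C : ℝ} (hC : 0 < C) : IsClassKInf fun v => C * √(√v) := by
  refine ⟨⟨by fun_prop, fun a ha b _ h => ?_, by simp⟩, fun M => ?_⟩
  · have := Real.sqrt_lt_sqrt (Real.sqrt_nonneg a) (Real.sqrt_lt_sqrt ha h)
    simp only
    gcongr
  · refine ⟨(((|M| + 1) / C) ^ 2) ^ 2, by positivity, ?_⟩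
    have h : 0 ≤ (|M| + 1) / C := by positivity
    simp only
    rw [Real.sqrt_sq (by positivity), Real.sqrt_sq h, mul_div_cancel₀ _ hC.ne']
    linarith [le_abs_self M]

/-- Lets linear noise terms be absorbed by the fourth root of the noise level. -/
theorem le_sqrt_sqrt {v : ℝ} (h0 : 0 ≤ v) (h1 : v ≤ 1) : v ≤ √(√v) := by
  refine Real.le_sqrt_of_sq_le (Real.le_sqrt_of_sq_le ?_)
  calc (v ^ 2) ^ 2 = v * v ^ 3 := by ring
    _ ≤ v * 1 := by
      gcongr
      exact pow_le_one₀ h0 h1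
    _ = v := mul_one v

/-- The bounds on frequency and duration limit the number of consecutive attacked instants. -/
theorem exists_success_bound {κf νf κd νd : ℝ} (hνf : 2 ≤ νf)
    (hdos : 1 / νf + 1 / νd < 1) :
    ∃ T : ℕ, ∀ atk, DosBounded κf νf κd νd atk → ∀ t, ∃ s, t ≤ s ∧ s ≤ t + T ∧ atk s = false := by
  have h1 : 0 < 1 - 1 / νd := by
    have : 0 < 1 / νf := by positivity
    linarith
  obtain ⟨T, hT⟩ := exists_nat_gt (κd / (1 - 1 / νd))
  refine ⟨T, fun atk hatk t => ?_⟩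
  by_contra! hcon
  -- With no success, the duration bound would read T ≤ κd + T/νd, contrary to the choice of T.
  have h2 : dosDuration atk t (t + T) = T := by
    unfold dosDuration
    rw [Finset.sum_congr rfl (g := fun _ => 1)]
    · simp
    · intro i hi
      rw [Finset.mem_Ico] at hi
      simpa using hcon i hi.1 hi.2.le
  have h3 := (hatk t (t + T) (by omega)).2
  rw [h2] at h3
  rw [div_lt_iff₀ h1] at hT
  push_cast at h3
  have h4 : ((t : ℝ) + T - t) / νd = T * (1 / νd) := by ring
  rw [h4] at h3
  linarith

theorem norm_input_le_norm_augState {nu ny η : ℕ} (u : ℤ → RVec nu) (y : ℤ → RVec ny) (t : ℤ)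
    {i : ℕ} (hi : i < η) : ‖u (t - η + i)‖ ≤ ‖augState η u y t‖ := by
  rw [EuclideanSpace.norm_eq, EuclideanSpace.norm_eq, Fintype.sum_sum_type, Fintype.sum_prod_type]
  refine Real.sqrt_le_sqrt ?_
  have h1 := Finset.single_le_sum (f := fun j : Fin η =>
    ∑ a, ‖augState η u y t (Sum.inl (j, a))‖ ^ 2) (fun _ _ => by positivity)
    (Finset.mem_univ ⟨i, hi⟩)
  have h2 : 0 ≤ ∑ b, ‖augState η u y t (Sum.inr b)‖ ^ 2 := by positivity
  exact h1.trans (le_add_of_nonneg_right h2)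

theorem norm_output_le_norm_augState {nu ny η : ℕ} (u : ℤ → RVec nu) (y : ℤ → RVec ny) (t : ℤ)
    {i : ℕ} (hi : i < η) : ‖y (t - η + i)‖ ≤ ‖augState η u y t‖ := by
  rw [EuclideanSpace.norm_eq, EuclideanSpace.norm_eq, Fintype.sum_sum_type, Fintype.sum_prod_type
    (f := fun b => ‖augState η u y t (Sum.inr b)‖ ^ 2)]
  refine Real.sqrt_le_sqrt ?_
  have h1 := Finset.single_le_sum (f := fun j : Fin η =>
    ∑ a, ‖augState η u y t (Sum.inr (j, a))‖ ^ 2) (fun _ _ => by positivity)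
    (Finset.mem_univ ⟨i, hi⟩)
  have h2 : 0 ≤ ∑ b, ‖augState η u y t (Sum.inl b)‖ ^ 2 := by positivity
  exact h1.trans (le_add_of_nonneg_left h2)

/-- A bound on the squares after time `s₀` and a linear bound up to time `s₀` combine to a bound
for all times. -/
theorem exists_bound_of_sq_bound {Cz Ce K ρ : ℝ} (hCz : 1 ≤ Cz) (hCe : 0 ≤ Ce) (hK : 1 ≤ K)
    (hρ0 : 0 < ρ) (hρ1 : ρ < 1) (T : ℕ) :
    ∃ C : ℝ, 1 ≤ C ∧ ∀ (a : ℕ → ℝ) (v : ℝ) (s₀ : ℕ), s₀ ≤ T → 0 ≤ v → v ≤ 1 → (∀ t, 0 ≤ a t) →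
      (∀ t ≤ s₀, a t ≤ Cz * (a 0 + v)) →
      (∀ t, a (s₀ + t) ^ 2 ≤ K * (ρ ^ t * a s₀ ^ 2 + Ce * √v)) →
      ∀ t, a t ≤ C * (√ρ ^ t * a 0 + √(√v)) := by
  have hσ0 : 0 < √ρ := Real.sqrt_pos.mpr hρ0
  have hσ1 : √ρ ≤ 1 := Real.sqrt_le_one.mpr hρ1.le
  set σ := √ρ with hσ
  -- The rate of the norm is σ = √ρ. On the at most T steps before `s₀` the factor `D` replaces the
  -- missing decay.
  obtain ⟨D, hD⟩ : ∃ D, D = (σ ^ T)⁻¹ := ⟨_, rfl⟩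
  have hσT : 0 < σ ^ T := by positivity
  have hD1 : 1 ≤ D := by
    rw [hD]
    exact (one_le_inv₀ hσT).2 (pow_le_one₀ hσ0.le hσ1)
  have hDσ : ∀ t ≤ T, 1 ≤ D * σ ^ t := fun t ht => by
    rw [hD, inv_mul_eq_div, le_div_iff₀ hσT, one_mul]
    exact pow_le_pow_of_le_one hσ0.le hσ1 ht
  have hk : 1 ≤ √K := Real.one_le_sqrt.mpr hK
  have hCD : 1 ≤ Cz * D := by nlinarith
  refine ⟨√K * (Cz * D + √Ce), by nlinarith [Real.sqrt_nonneg Ce], ?_⟩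
  intro a v s₀ hs₀ hv hv1 ha h1 h2 t
  have hvs := le_sqrt_sqrt hv hv1
  set q := √(√v) with hq
  have hq0 : 0 ≤ q := Real.sqrt_nonneg _
  have hse := Real.sqrt_nonneg Ce
  have ha0 := ha 0
  rcases le_or_gt t s₀ with ht | ht
  · have h3 := hDσ t (ht.trans hs₀)
    calc a t ≤ Cz * (a 0 + v) := h1 t ht
      _ ≤ Cz * (D * σ ^ t * a 0 + D * q) := by
        gcongr
        · exact le_mul_of_one_le_left ha0 h3
        · exact hvs.trans (le_mul_of_one_le_left hq0 hD1)
      _ = 1 * (Cz * D + 0) * (σ ^ t * a 0 + q) := by ring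
      _ ≤ _ := by gcongr
  · obtain ⟨n, rfl⟩ := Nat.exists_eq_add_of_le ht.le
    have h3 : σ ^ n ≤ D * σ ^ (s₀ + n) := by
      rw [pow_add, ← mul_assoc]
      exact le_mul_of_one_le_left (by positivity) (hDσ s₀ hs₀)
    have h4 : a (s₀ + n) ≤ √K * (σ ^ n * a s₀ + √Ce * q) := by
      refine (abs_le_of_sq_le_sq' ((h2 n).trans ?_) ?_).2
      · rw [mul_pow, Real.sq_sqrt (by linarith)]
        gcongr
        have h5 : (σ ^ n) ^ 2 = ρ ^ n := by
          rw [← pow_mul, mul_comm, pow_mul, hσ, Real.sq_sqrt hρ0.le]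
        have h6 : (√Ce * q) ^ 2 = Ce * √v := by
          rw [mul_pow, Real.sq_sqrt hCe, hq, Real.sq_sqrt (Real.sqrt_nonneg v)]
        rw [add_sq, mul_pow, h5, h6]
        have := ha s₀
        have : 0 ≤ 2 * (σ ^ n * a s₀) * (√Ce * q) := by positivity
        linarith
      · have := ha s₀
        positivity
    calc a (s₀ + n) ≤ √K * (σ ^ n * a s₀ + √Ce * q) := h4
      _ ≤ √K * (σ ^ n * (Cz * (a 0 + q)) + √Ce * q) := by
        gcongr
        exact (h1 s₀ le_rfl).trans (by gcongr)
      _ = √K * (Cz * (σ ^ n * a 0) + Cz * (σ ^ n * q) + √Ce * q) := by ring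
      _ ≤ √K * (Cz * (D * σ ^ (s₀ + n) * a 0) + Cz * (D * q) +
            √Ce * (σ ^ (s₀ + n) * a 0 + q)) := by
        gcongr
        · exact (pow_le_one₀ hσ0.le hσ1).trans hD1
        · exact le_add_of_nonneg_left (by positivity)
      _ = √K * (Cz * D + √Ce) * (σ ^ (s₀ + n) * a 0 + q) := by ring

namespace LTISystem

variable {nx nu ny : ℕ} (S : LTISystem nx nu ny)
variable {x : ℤ → RVec nx} {u : ℤ → RVec nu} {y : ℤ → RVec ny} {w : ℤ → RVec nx} {n : ℤ → RVec ny}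

theorem IsTrajectoryOn.of_int {S : LTISystem nx nu ny} {b : ℤ}
    (h : S.IsTrajectoryOn (Set.Ici b) x u y w) {a : ℤ} (ha : b ≤ a) (I : Set ℕ) :
    S.IsTrajectoryOn I (fun i => x (a + i)) (fun i => u (a + i)) (fun i => y (a + i))
      (fun i => w (a + i)) := by
  intro i _
  have := h (a + i) (by simp only [Set.mem_Ici]; omega)
  rw [add_assoc] at this
  exact_mod_cast this

theorem isWindow_augState {S : LTISystem nx nu ny} {η : ℕ}
    (h : S.IsTrajectoryOn (Set.Ici (-(η : ℤ))) x u y w) {e : ℝ}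
    (hn : ∀ t : ℤ, -(η : ℤ) ≤ t → ‖w t‖ ≤ e ∧ ‖n t‖ ≤ e) (s : ℕ) :
    S.IsWindow (augState η u (y + n) s) e (fun i => x ((s : ℤ) - η + i))
      (fun i => u ((s : ℤ) - η + i)) (fun i => y ((s : ℤ) - η + i)) (fun i => w ((s : ℤ) - η + i))
      (fun i => n ((s : ℤ) - η + i)) where
  traj := h.of_int (by omega) _
  noise t _ := (hn _ (by omega)).1
  outNoise t _ := (hn _ (by omega)).2
  input _ _ := rfl
  output _ _ := rfl

/-- Without control before the first success, the trajectory is bounded by the initial window. -/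
theorem exists_initial_bound {η : ℕ} (hη : (S.obsMatrix η).rank = nx) (T : ℕ) :
    ∃ C : ℝ, 1 ≤ C ∧ ∀ (x : ℤ → RVec nx) (u : ℤ → RVec nu) (y : ℤ → RVec ny) (w : ℤ → RVec nx)
      (δ e : ℝ) (s : ℕ), S.IsTrajectoryOn (Set.Ici (-(η : ℤ))) x u y w → s ≤ T → 0 ≤ e →
      (∀ t : ℤ, -(η : ℤ) ≤ t → ‖w t‖ ≤ e) → ‖augState η u y 0‖ ≤ δ →
      (∀ t : ℕ, t < s → u t = 0) →
      (∀ t : ℤ, -(η : ℤ) ≤ t → t ≤ s → ‖x t‖ ≤ C * (δ + e)) ∧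
      (∀ t : ℤ, -(η : ℤ) ≤ t → t < s → ‖u t‖ ≤ δ) ∧
      (∀ t : ℕ, t ≤ s → ‖x t‖ ≤ C * (‖x 0‖ + e)) := by
  obtain ⟨Co, hCo, hobs⟩ := S.exists_observability_bound hη
  obtain ⟨Cp, hCp, hpert⟩ := S.exists_perturbation_bound (η + T)
  have h1 : Cp ≤ Cp * (Co * Cp) := le_mul_of_one_le_right (by linarith) (by nlinarith)
  refine ⟨Cp * (Co * Cp), by linarith, ?_⟩
  intro x u y w δ e s htraj hs he hw hz hu
  have hδ : 0 ≤ δ := (norm_nonneg _).trans hz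
  have hu' : ∀ t : ℤ, -(η : ℤ) ≤ t → t < s → ‖u t‖ ≤ δ := by
    intro t ht1 ht2
    rcases lt_or_ge t 0 with h | h
    · obtain ⟨i, hi⟩ := Int.eq_ofNat_of_zero_le (show 0 ≤ t + η by omega)
      have := norm_input_le_norm_augState u y 0 (show i < η by omega)
      rw [show (0 : ℤ) - η + i = t by omega] at this
      exact this.trans hz
    · obtain ⟨i, rfl⟩ := Int.eq_ofNat_of_zero_le h
      rw [hu i (by omega), norm_zero]
      exact hδ
  refine ⟨?_, hu', ?_⟩
  · have htr := htraj.of_int le_rfl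
    have h2 : ‖x (-(η : ℤ))‖ ≤ Co * (δ + Cp * e) := by
      obtain ⟨-, hy⟩ := hpert _ _ _ _ (x (-(η : ℤ)), fun i : ℕ => u (-(η : ℤ) + i)) e η (by omega) he
        (htr _) (by simpa using he) (fun t _ => by simpa using he) (fun t _ => hw _ (by omega))
      have hCe : 0 ≤ Cp * e := by positivity
      refine hobs (x (-(η : ℤ)), fun i : ℕ => u (-(η : ℤ) + i)) _ (by positivity) (fun i hi => ?_)
        (fun i hi => ?_)
      · have := hu' (-(η : ℤ) + i) (by omega) (by omega)
        simp only
        linarith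
      · have h3 := norm_output_le_norm_augState u y 0 hi
        rw [zero_sub] at h3
        have h4 := norm_le_norm_add_norm_sub (y (-(η : ℤ) + i))
          (S.output i (x (-(η : ℤ)), fun i : ℕ => u (-(η : ℤ) + i)))
        have h5 := hy i hi
        linarith
    have h3 : Co * (δ + Cp * e) ≤ Co * Cp * (δ + e) := by
      have : Co * δ ≤ Co * (Cp * δ) := by
        gcongr
        exact le_mul_of_one_le_left hδ hCp
      linarith
    have h4 : δ + e ≤ Co * Cp * (δ + e) := le_mul_of_one_le_left (by positivity) (by nlinarith)
    intro t ht1 ht2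
    obtain ⟨i, hi⟩ := Int.eq_ofNat_of_zero_le (show 0 ≤ t + η by omega)
    have h5 := (hpert _ _ _ _ 0 (Co * Cp * (δ + e)) (η + s) (by omega) (by positivity) (htr _)
      (by simpa using h2.trans h3) (fun j hj => by
        have := hu' (-(η : ℤ) + j) (by omega) (by omega)
        simp only [Prod.snd_zero, Pi.zero_apply, sub_zero]
        linarith) (fun j _ => by
        have := hw (-(η : ℤ) + j) (by omega)
        linarith)).1 i (by omega)
    rw [map_zero, sub_zero, show (-(η : ℤ)) + i = t by omega] at h5
    linarith
  -- Restarted at time 0, where the input is already zero, the bound involves ‖x 0‖ only; the class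
  -- KL estimate needs this form rather than the bound by the window.
  · intro t ht
    have h5 := (hpert _ _ _ _ 0 (‖x 0‖ + e) s (by omega) (by positivity)
      (htraj.of_int (a := 0) (by omega) _) (by simpa using he) (fun j hj => by
        simp only [zero_add, hu j hj]
        simp
        positivity) (fun j _ => by
        have := hw (0 + j) (by omega)
        have := norm_nonneg (x 0)
        linarith)).1 t ht
    rw [map_zero, sub_zero, zero_add] at h5
    exact h5.trans (by gcongr)

end LTISystem

/-- Stability of the closed loop for a plant without input. -/
theorem LTISystem.Stabilizable.exists_autonomous_bound {nx ny : ℕ} {S : LTISystem nx 0 ny}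
    (hS : S.Stabilizable) :
    ∃ C ρ : ℝ, 1 ≤ C ∧ 0 < ρ ∧ ρ < 1 ∧ ∀ (x : ℤ → RVec nx) (u : ℤ → RVec 0) (y : ℤ → RVec ny)
      (w : ℤ → RVec nx) (e : ℝ), S.IsTrajectoryOn (Set.Ici 0) x u y w → 0 ≤ e →
      (∀ t : ℤ, 0 ≤ t → ‖w t‖ ≤ e) → ∀ t : ℕ, ‖x t‖ ≤ C * (ρ ^ t * ‖x 0‖ + e) := by
  obtain ⟨C, ρ, hC, hρ0, hρ1, h⟩ := hS.exists_decay
  refine ⟨C, ρ, hC, hρ0, hρ1, fun x u y w e htraj he hw t => ?_⟩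
  -- Without inputs the reachable subspace is zero, so contraction modulo the zero subspace is
  -- contraction of the state itself.
  obtain ⟨m, hm, hx⟩ := h ⊥ (S.reach_le fun k u => by simp [Subsingleton.elim u 0])
    (fun x hx => by simp [(Submodule.mem_bot ℝ).1 hx]) _ _ _ _ e t
    (htraj.of_int (a := 0) le_rfl _) he (fun t _ => hw _ (by omega)) 0 (Submodule.zero_mem _)
  rw [(Submodule.mem_bot ℝ).1 hm] at hx
  simpa using hx

/-! ### Assembly of the closed-loop estimate. -/

namespace MPCProblem

variable {nx nu ny N L η : ℕ} {c : ℝ}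

/-- Practical exponential stability of the closed loop as long as all problems are feasible. -/
theorem exists_closedLoop_bound (S : LTISystem nx nu ny) (hS : S.Stabilizable)
    {R₁ : Matrix (Fin nu) (Fin nu) ℝ} {R₂ : Matrix (Fin ny) (Fin ny) ℝ} (hR₁ : R₁.PosDef)
    (hR₂ : R₂.PosDef) (hη1 : 1 ≤ η) (hη : (S.obsMatrix η).rank = nx) {U : Set (RVec nu)}
    {us : ℕ → RVec nu} (x₀ : RVec nx) (hc : 0 ≤ c) (hL : η + nx ≤ L)
    (hPE : PersistentlyExciting (L + η + nx) N us) (hN : L + η + 2 * nx ≤ N + 1)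
    (hU0 : (0 : RVec nu) ∈ interior U) (T : ℕ) :
    ∃ δ : ℝ, 0 < δ ∧ ∀ Vin : ℝ, ∃ v₀ C ρ : ℝ, 0 < v₀ ∧ v₀ ≤ 1 ∧ 1 ≤ C ∧ 0 < ρ ∧ ρ < 1 ∧
      ∀ (p : MPCProblem nu ny N L η) (atk : ℕ → Bool) (x : ℤ → RVec nx) (u : ℤ → RVec nu)
        (y : ℤ → RVec ny) (w : ℤ → RVec nx) (n : ℤ → RVec ny) (opt : ℕ → MPCVars nu ny N L η)
        (s₀ : ℕ),
      p.Admissible S R₁ R₂ U us x₀ c → p.vbar ≤ v₀ → (∀ z, p.Feasible z) →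
      (∀ t, ∃ s, t ≤ s ∧ s ≤ t + T ∧ atk s = false) →
      (∀ t : ℤ, -(η : ℤ) ≤ t → ‖w t‖ ≤ p.vbar ∧ ‖n t‖ ≤ p.vbar) →
      IsClosedLoop S p atk x u y w n opt → ‖augState η u y 0‖ ≤ δ → atk s₀ = false →
      (∀ i < s₀, atk i = true) → p.cost (opt s₀) ≤ Vin →
      ∀ t : ℕ, ‖x t‖ ≤ C * (ρ ^ t * ‖x 0‖ + √(√p.vbar)) := by
  obtain ⟨k, hk⟩ : ∃ k, k + η = L := ⟨L - η, by omega⟩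
  obtain ⟨r, hr0, hr1, hrU⟩ : ∃ r : ℝ, 0 < r ∧ r ≤ 1 ∧ Metric.closedBall 0 (2 * r) ⊆ U := by
    obtain ⟨ε, hε, h⟩ := Metric.isOpen_iff.1 isOpen_interior _ hU0
    refine ⟨min 1 (ε / 4), by positivity, min_le_left _ _, fun a ha => interior_subset (h ?_)⟩
    have := min_le_right 1 (ε / 4)
    rw [Metric.mem_closedBall] at ha
    rw [Metric.mem_ball]
    linarith
  obtain ⟨r₁, hr₁0, hr₁1, hfeas⟩ := exists_feasible_of_near S R₁ R₂ x₀ hc hk (by omega) hPE hN hr0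
    hr1 hrU
  obtain ⟨r₀, e₀, K, ρ, hr₀, he₀, hK, hρ0, hρ1, hdecay⟩ :=
    S.exists_exponential_decay hR₁ hR₂ hη hη1 hk hr0 T hr₁0
  obtain ⟨Cz, hCz, hinit⟩ := S.exists_initial_bound hη T
  obtain ⟨Ca, ρa, hCa, hρa0, hρa1, hstab⟩ := hS.exists_decay
  have hm0 : 0 < min r₀ 1 := by positivity
  -- Half of the budget `min r₀ 1` for the state up to `s₀` goes to the initial window and half to
  -- the noise. None of these constants depends on `Vin`.
  refine ⟨min (min r₀ 1 / (2 * Cz)) 1, by positivity, fun Vin => ?_⟩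
  obtain ⟨Ce, hCe, horbit⟩ :=
    exists_near_orbit_inf_nullReach (N := N) (L := L) S hR₁ hR₂ hη U us x₀ hc Vin
  have hC₁ : 1 ≤ Ca * (Ce + 1) := by nlinarith
  obtain ⟨V, ε₀, hε₀, hfeas⟩ := hfeas (Ca * (Ce + 1)) hC₁
  obtain ⟨Cn, hCn, hnear⟩ := exists_isNearOptimal S hR₁ hR₂ hη x₀ hc hk hPE hN hr1 hrU (max Vin V)
  obtain ⟨C, hC, hfinal⟩ := exists_bound_of_sq_bound hCz (by positivity : 0 ≤ Cn) hK hρ0 hρ1 T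
  obtain ⟨m, hm, hmr, hme, hmε⟩ : ∃ m : ℝ, 0 < m ∧ Cn * m ≤ r ∧ Cn * m ≤ e₀ ∧ m ≤ ε₀ := by
    refine ⟨min (min (r / Cn) (e₀ / Cn)) ε₀, by positivity, ?_, ?_, min_le_right _ _⟩
    · rw [mul_comm, ← le_div_iff₀ (by positivity)]
      exact (min_le_left _ _).trans (min_le_left _ _)
    · rw [mul_comm, ← le_div_iff₀ (by positivity)]
      exact (min_le_left _ _).trans (min_le_right _ _)
  refine ⟨min (min 1 (m ^ 2)) (min r₀ 1 / (2 * Cz)), C, √ρ, by positivity,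
    (min_le_left _ _).trans (min_le_left _ _), hC, Real.sqrt_pos.mpr hρ0, ?_, ?_⟩
  · rw [Real.sqrt_lt' one_pos]
    simpa using hρ1
  intro p atk x u y w n opt s₀ hp hv hfeasible hgap hnoise hloop hz hs₀ hfirst hcost
  have hv0 := hp.vbar_pos
  have hvm : √p.vbar ≤ m :=
    Real.sqrt_le_iff.mpr ⟨hm.le, (hv.trans (min_le_left _ _)).trans (min_le_right _ _)⟩
  have hsv : p.vbar ≤ √p.vbar := hp.vbar_le_sqrt
  have hsv0 : 0 ≤ √p.vbar := Real.sqrt_nonneg _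
  have hCnm : Cn * √p.vbar ≤ Cn * m := by gcongr
  have hs₀T : s₀ ≤ T := by
    obtain ⟨s, -, h1, h2⟩ := hgap 0
    by_contra! h
    rw [hfirst s (by omega)] at h2
    exact Bool.noConfusion h2
  obtain ⟨hx1, hu1, hx2⟩ := hinit x u y w _ p.vbar s₀ hloop.plant hs₀T hv0.le
    (fun t ht => (hnoise t ht).1) hz
    (fun t ht => hloop.input_init t fun i hi => hfirst i (by omega))
  have hsmall : Cz * (min (min r₀ 1 / (2 * Cz)) 1 + p.vbar) ≤ min r₀ 1 := by
    have h1 : min (min r₀ 1 / (2 * Cz)) 1 ≤ min r₀ 1 / (2 * Cz) := min_le_left _ _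
    have h2 : p.vbar ≤ min r₀ 1 / (2 * Cz) := hv.trans (min_le_right _ _)
    calc Cz * (min (min r₀ 1 / (2 * Cz)) 1 + p.vbar)
        ≤ Cz * (min r₀ 1 / (2 * Cz) + min r₀ 1 / (2 * Cz)) := by gcongr
      _ = min r₀ 1 := by field_simp; ring
  have hx1' : ∀ t : ℤ, -(η : ℤ) ≤ t → t ≤ s₀ → ‖x t‖ ≤ min r₀ 1 := fun t h1 h2 =>
    (hx1 t h1 h2).trans hsmall
  have hwindow := fun s : ℕ => LTISystem.isWindow_augState hloop.plant hnoise s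
  have hopt := fun (s : ℕ) (hs : atk s = false) => hloop.solve s hs (hfeasible _)
  -- The cost bound at `s₀` places the start of that window near the subspace from which
  -- data-generated null trajectories start.
  obtain ⟨m₀, hm₀, hxm₀⟩ := horbit p _ _ hp (hopt s₀ hs₀).1 hcost _ _ _ _ _ (hwindow s₀)
  refine hfinal (fun t => ‖x t‖) p.vbar s₀ hs₀T hv0.le hp.vbar_le (fun _ => norm_nonneg _)
    (by simpa using hx2) ?_
  have hmain := hdecay (Cn * √p.vbar) (fun t => atk (s₀ + t)) (fun t => x (s₀ + t))
    (fun t => u (s₀ + t)) (fun t => y (s₀ + t)) (fun t => w (s₀ + t))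
    (fun s => (opt (s₀ + s)).predInput) (by positivity) (hCnm.trans hme) ?_ hs₀
    (hloop.plant.of_int (by omega) _) ?_ ?_ ?_ ?_
  · simpa using hmain
  · intro t
    obtain ⟨s, h1, h2, h3⟩ := hgap (s₀ + t)
    refine ⟨s - s₀, by omega, by omega, ?_⟩
    rwa [Nat.add_sub_cancel' (by omega)]
  · intro t
    refine ((hnoise _ (by omega)).1.trans hsv).trans (le_mul_of_one_le_left hsv0 hCn)
  · intro s t hst hs hatk
    have h1 := hloop.input (s₀ + s) (s₀ + t) (by omega) hs (fun i h1 h2 => by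
      have := hatk (i - s₀) (by omega) (by omega)
      rwa [Nat.add_sub_cancel' (by omega)] at this)
    rw [show s₀ + t - (s₀ + s) = t - s by omega] at h1
    exact_mod_cast h1
  · intro s hs hxs hus
    have hX : ∀ t : ℤ, -(η : ℤ) ≤ t → t ≤ s₀ + s → ‖x t‖ ≤ 1 := by
      intro t h1 h2
      rcases le_or_gt t s₀ with h | h
      · exact (hx1' t h1 h).trans (min_le_right _ _)
      · obtain ⟨i, hi⟩ := Int.eq_ofNat_of_zero_le (show 0 ≤ t - s₀ by omega)
        have := hxs i (by omega)
        rw [show (s₀ : ℤ) + i = t by omega] at this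
        exact this.trans hr₁1
    have hVu : ∀ t : ℤ, -(η : ℤ) ≤ t → t < s₀ + s → ‖u t‖ ≤ 1 := by
      intro t h1 h2
      rcases lt_or_ge t s₀ with h | h
      · exact (hu1 t h1 h).trans (min_le_right _ _)
      · obtain ⟨i, hi⟩ := Int.eq_ofNat_of_zero_le (show 0 ≤ t - s₀ by omega)
        have := hus i (by omega)
        rwa [show (s₀ : ℤ) + i = t by omega] at this
    have hend : ((s₀ + s : ℕ) : ℤ) - η + η = s₀ + s := by push_cast; ring
    have hend1 : ‖x (((s₀ + s : ℕ) : ℤ) - η + η)‖ ≤ r₁ := by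
      rw [hend]
      exact hxs s le_rfl
    have hbound : p.cost (opt (s₀ + s)) ≤ max Vin V := by
      rcases Nat.eq_zero_or_pos s with rfl | hspos
      · exact hcost.trans (le_max_left _ _)
      -- Proximity is carried from time s₀ - η to s₀ + s - η, the start of the current window. The
      -- feasible point built from it then bounds the optimal cost.
      obtain ⟨m', hm', hxm'⟩ := hstab (S.orbit x₀ ⊓ S.nullReach L)
        (le_inf (S.reach_le_orbit x₀) (S.reach_le_nullReach L))
        (fun a ha => ⟨S.A_mem_orbit x₀ ha.1, S.A_mem_nullReach ha.2⟩) _ _ _ _ p.vbar s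
        (hloop.plant.of_int (a := (s₀ : ℤ) - η) (by omega) _) hv0.le
        (fun t _ => (hnoise _ (by omega)).1) m₀ hm₀
      have h1 : Ca * (ρa ^ s * ‖x ((s₀ : ℤ) - η + (0 : ℕ)) - m₀‖ + p.vbar) ≤
          Ca * (Ce + 1) * √p.vbar := by
        have h2 : ρa ^ s * ‖x ((s₀ : ℤ) - η + (0 : ℕ)) - m₀‖ ≤ Ce * √p.vbar :=
          (mul_le_of_le_one_left (norm_nonneg _) (pow_le_one₀ hρa0.le hρa1.le)).trans hxm₀
        rw [mul_assoc, add_mul, one_mul]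
        gcongr
      have h3 : (s₀ : ℤ) - η + s = ((s₀ + s : ℕ) : ℤ) - η + (0 : ℕ) := by push_cast; ring
      rw [h3] at hxm'
      obtain ⟨o, ho, hoV⟩ := hfeas p _ hp (hvm.trans hmε) _ _ _ _ _ (hwindow (s₀ + s))
        ((hX _ (by omega) (by push_cast; omega)).trans hC₁)
        (fun i hi => (hVu _ (by omega) (by push_cast; omega)).trans hC₁) hend1 m' hm'
        (hxm'.trans h1)
      exact (((hopt (s₀ + s) hs).2 o ho).trans hoV).trans (le_max_right _ _)
    have := hnear p _ _ hp (hopt (s₀ + s) hs) hbound (hCnm.trans hmr) _ _ _ _ _ (hwindow (s₀ + s))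
      (hend1.trans hr₁1)
    rwa [hend] at this
  · simpa using (hx1' s₀ (by omega) le_rfl).trans (min_le_left _ _)

end MPCProblem

theorem MPCProblem.IsOptimal.value_eq {nu ny N L η : ℕ} {p : MPCProblem nu ny N L η}
    {z : EuclideanSpace ℝ (AugIdx nu ny η)} {o : MPCVars nu ny N L η} (h : p.IsOptimal z o) :
    p.value z = p.cost o :=
  IsLeast.csInf_eq ⟨⟨o, h.1, rfl⟩, by rintro _ ⟨o', ho', rfl⟩; exact h.2 o' ho'⟩

/-- Feasibility and practical exponential stability of the closed loop. -/
theorem exists_resilient_bound {nx nu ny : ℕ} (S : LTISystem nx nu ny) (hstab : S.Stabilizable)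
    {η L N : ℕ} (hη1 : 1 ≤ η) (hηr : (S.obsMatrix η).rank = nx) (hL : η + nx ≤ L)
    {R₁ : Matrix (Fin nu) (Fin nu) ℝ} (hR₁ : R₁.PosDef)
    {R₂ : Matrix (Fin ny) (Fin ny) ℝ} (hR₂ : R₂.PosDef) {U : Set (RVec nu)}
    (hU0 : (0 : RVec nu) ∈ interior U) {us : ℕ → RVec nu} (x₀s : RVec nx)
    (hPE : PersistentlyExciting (L + nx + η) N us) {c : ℝ} (hc : 0 ≤ c) (T : ℕ) :
    ∃ δ : ℝ, 0 < δ ∧ ∀ Vin : ℝ, ∃ v₀ C ρ : ℝ, 0 < v₀ ∧ v₀ ≤ 1 ∧ 1 ≤ C ∧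
    0 < ρ ∧ ρ < 1 ∧
    ∀ (p : MPCProblem nu ny N L η) (atk : ℕ → Bool) (x : ℤ → RVec nx) (u : ℤ → RVec nu)
      (y : ℤ → RVec ny) (w : ℤ → RVec nx) (n : ℤ → RVec ny) (opt : ℕ → MPCVars nu ny N L η)
      (s₀ : ℕ),
    p.Admissible S R₁ R₂ U us x₀s c → p.vbar ≤ v₀ →
      (∀ t, ∃ s, t ≤ s ∧ s ≤ t + T ∧ atk s = false) →
      (∀ t : ℤ, -(η : ℤ) ≤ t → ‖w t‖ ≤ p.vbar ∧ ‖n t‖ ≤ p.vbar) →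
    IsClosedLoop S p atk x u y w n opt → ‖augState η u y 0‖ ≤ δ → atk s₀ = false →
    (∀ i < s₀, atk i = true) → p.cost (opt s₀) ≤ Vin →
    (∀ z, p.Feasible z) ∧ ∀ t : ℕ, ‖x t‖ ≤ C * (ρ ^ t * ‖x 0‖ + √(√p.vbar)) := by
  rcases Nat.eq_zero_or_pos nu with rfl | hnu
  -- Without inputs persistent excitation holds trivially and gives no lower bound on `N`, but
  -- stabilizability says that A itself is Schur, and `g = 0` matches all inputs.
  · obtain ⟨C, ρ, hC, hρ0, hρ1, h⟩ := hstab.exists_autonomous_bound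
    refine ⟨1, one_pos, fun _ => ⟨1, C, ρ, one_pos, le_rfl, hC, hρ0, hρ1, ?_⟩⟩
    intro p atk x u y w n opt s₀ hp _ _ hnoise hloop _ _ _ _
    refine ⟨MPCProblem.feasible_of_exists_dataComb S hp.us_eq hp.U_eq (interior_subset hU0)
      (by omega) x₀s fun v => ⟨0, fun _ _ => Subsingleton.elim _ _⟩, fun t => ?_⟩
    refine (h x u y w p.vbar (fun t ht => hloop.plant t ?_) hp.vbar_pos.le
      (fun t ht => (hnoise t (by omega)).1) t).trans ?_
    · simp only [Set.mem_Ici] at ht ⊢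
      omega
    · have := le_sqrt_sqrt hp.vbar_pos.le hp.vbar_le
      gcongr
  · have hPE' : PersistentlyExciting (L + η + nx) N us := by rwa [Nat.add_right_comm]
    -- With at least one input, the Hankel matrix of depth `L + η + nx` has at least that many
    -- columns.
    have hN : L + η + 2 * nx ≤ N + 1 := by
      have h1 := hPE'.le_card
      have h2 : L + η + nx ≤ nu * (L + η + nx) := Nat.le_mul_of_pos_left _ hnu
      omega
    obtain ⟨δ, hδ, h⟩ := MPCProblem.exists_closedLoop_bound S hstab hR₁ hR₂ hη1 hηr x₀s
      hc hL hPE' hN hU0 T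
    obtain ⟨Cd, -, hcomb⟩ := S.exists_dataComb x₀s hPE' hN
    refine ⟨δ, hδ, fun Vin => ?_⟩
    obtain ⟨v₀, C, ρ, hv₀, hv₀1, hC, hρ0, hρ1, h⟩ := h Vin
    refine ⟨v₀, C, ρ, hv₀, hv₀1, hC, hρ0, hρ1, ?_⟩
    intro p atk x u y w n opt s₀ hp hv hgap hnoise hloop hz hs₀ hfirst hcost
    have hfeas := fun z => MPCProblem.feasible_of_exists_dataComb (p := p) S hp.us_eq hp.U_eq
      (interior_subset hU0) (by omega) x₀s (fun v => by
        have he : 0 ≤ ∑ i ∈ Finset.range (L + η), ‖v i‖ := by positivity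
        obtain ⟨g, -, hg, -⟩ := hcomb 0 (Submodule.zero_mem _) v _ he (by simpa using he)
          fun i hi => Finset.single_le_sum (f := fun i => ‖v i‖) (fun _ _ => norm_nonneg _)
            (Finset.mem_range.2 hi)
        exact ⟨g, hg⟩) z
    exact ⟨hfeas, h p atk x u y w n opt s₀ hp hv hfeas hgap hnoise hloop hz hs₀ hfirst hcost⟩

theorem theorem1 {nx nu ny : ℕ} (S : LTISystem nx nu ny)
    (hstab : S.Stabilizable) (hobs : S.Observable)
    (η : ℕ) (hη : S.IsObservabilityIndex η)
    -- prediction horizon, stage cost, input constraint set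
    (L : ℕ) (hL : η + nx ≤ L)
    (R₁ : Matrix (Fin nu) (Fin nu) ℝ) (hR₁ : R₁.PosDef)
    (R₂ : Matrix (Fin ny) (Fin ny) ℝ) (hR₂ : R₂.PosDef)
    (U : Set (RVec nu)) (hUconv : Convex ℝ U) (hU0 : (0 : RVec nu) ∈ interior U)
    -- input and initial state of the offline experiment
    (N : ℕ) (us : ℕ → RVec nu) (x₀s : RVec nx)
    (hPE : PersistentlyExciting (L + nx + η) N us)
    -- parameters of the attacks
    (κf νf κd νd : ℝ) (hκf : 0 ≤ κf) (hνf : 2 ≤ νf) (hκd : 0 ≤ κd) (hνd : 1 ≤ νd)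
    (hdos : 1 / νf + 1 / νd < 1)
    -- the Lyapunov function `V = J* + γ zᵀ P z`
    (P : Matrix (AugIdx nu ny η) (AugIdx nu ny η) ℝ) (hP : IsUIOSSLyapunov S P)
    (γ : ℝ) (hγ : 0 < γ) :
    ∃ δ : ℝ, 0 < δ ∧ ∀ Vin : ℝ, 0 < Vin →
    ∃ glo ghi hlo hhi v₀ : ℝ,
      0 < glo ∧ glo < ghi ∧ 0 < hlo ∧ hlo < hhi ∧ 0 < v₀ ∧
    ∃ (β : ℝ → ℝ → ℝ) (α : ℝ → ℝ), IsClassKL β ∧ IsClassKInf α ∧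
    ∀ lamg lamh vbar : ℝ, glo ≤ lamg → lamg ≤ ghi → hlo ≤ lamh → lamh ≤ hhi →
      0 < vbar → vbar ≤ v₀ →
    -- the offline data, with process noise bounded by `vbar`
    ∀ (xs : ℕ → RVec nx) (ys : ℕ → RVec ny) (ws : ℕ → RVec nx),
      xs 0 = x₀s → S.IsTrajectoryOn (Set.Iio N) xs us ys ws → (∀ t < N, ‖ws t‖ ≤ vbar) →
    -- the attack, and the closed loop with noise bounded by `vbar`
    ∀ (atk : ℕ → Bool), DosBounded κf νf κd νd atk →
    ∀ (x : ℤ → RVec nx) (u : ℤ → RVec nu) (y : ℤ → RVec ny)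
      (w : ℤ → RVec nx) (n : ℤ → RVec ny) (opt : ℕ → MPCVars nu ny N L η),
      (∀ t : ℤ, -(η : ℤ) ≤ t → ‖w t‖ ≤ vbar ∧ ‖n t‖ ≤ vbar) →
      IsClosedLoop S ⟨us, ys, R₁, R₂, U, lamg, lamh, vbar⟩ atk x u y w n opt →
      ‖augState η u y 0‖ ≤ δ →
    ∀ s₀ : ℕ, atk s₀ = false → (∀ i < s₀, atk i = true) →
      (⟨us, ys, R₁, R₂, U, lamg, lamh, vbar⟩ : MPCProblem nu ny N L η).Feasible
        (augState η u (y + n) s₀) →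
      (⟨us, ys, R₁, R₂, U, lamg, lamh, vbar⟩ : MPCProblem nu ny N L η).value
        (augState η u (y + n) s₀) + γ * quadForm P (augState η u y s₀) ≤ Vin →
      (∀ s : ℕ, atk s = false →
        (⟨us, ys, R₁, R₂, U, lamg, lamh, vbar⟩ : MPCProblem nu ny N L η).Feasible
          (augState η u (y + n) s)) ∧
      (∀ t : ℕ, ‖x t‖ ≤ β ‖x 0‖ t + α vbar) := by

  have hη1 : 1 ≤ η := hη.1.1
  have hηr : (S.obsMatrix η).rank = nx := hη.1.2
  obtain ⟨c, hc, hdata⟩ := S.exists_perturbation_bound N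
  obtain ⟨T, hT⟩ := exists_success_bound (κf := κf) (κd := κd) hνf hdos
  obtain ⟨δ, hδ, hbound⟩ := exists_resilient_bound S hstab hη1 hηr hL hR₁ hR₂ hU0 x₀s hPE
    (zero_le_one.trans hc) T
  refine ⟨δ, hδ, fun Vin _ => ?_⟩
  obtain ⟨v₀, C, ρ, hv₀, hv₀1, hC, hρ0, hρ1, hbound⟩ := hbound Vin
  have hC0 : 0 < C := by linarith
  -- The weights enter only through the bounds 1 and 2 in `Admissible`. The gain is a fourth root
  -- because the squared state carries an error of order √v.
  refine ⟨1, 2, 1, 2, v₀, one_pos, one_lt_two, one_pos, one_lt_two, hv₀,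
    fun s t => C * s * ρ ^ t, fun v => C * √(√v), isClassKL_exponential hC0 hρ0 hρ1,
    isClassKInf_sqrt_sqrt hC0, ?_⟩
  intro lamg lamh vbar hg1 hg2 hh1 hh2 hv hvv₀ xs ys ws hxs htraj hws atk hatk x u y w n opt hnoise
    hloop hz s₀ hs₀ hfirst hfeas₀ hV
  have hout := (hdata xs us ys ws (x₀s, us) vbar N le_rfl hv.le htraj (by simpa [hxs] using hv.le)
    (fun _ _ => by simpa using hv.le) hws).2
  have hopt := hloop.solve s₀ hs₀ hfeas₀
  rw [hopt.value_eq] at hV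
  -- The quadratic term of the Lyapunov function is nonnegative, so `Vin` bounds the optimal cost
  -- alone.
  have hcost := hV.trans' (le_add_of_nonneg_right
    (mul_nonneg hγ.le (quadForm_nonneg hP.1 (augState η u y s₀))))
  have hp : (⟨us, ys, R₁, R₂, U, lamg, lamh, vbar⟩ : MPCProblem nu ny N L η).Admissible S R₁ R₂ U
      us x₀s c := ⟨rfl, rfl, rfl, rfl, hg1, hg2, hh1, hh2, hv, hvv₀.trans hv₀1, hout⟩
  obtain ⟨hfeas, hx⟩ := hbound ⟨us, ys, R₁, R₂, U, lamg, lamh, vbar⟩ atk x u y w n opt s₀ hp hvv₀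
    (hT atk hatk) hnoise hloop hz hs₀ hfirst hcost
  refine ⟨fun s _ => hfeas _, fun t => (hx t).trans (le_of_eq ?_)⟩
  simp only [Real.rpow_natCast]
  ring
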